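/- Fix a sequence $(u_n)_{n\in\mathbb N}$ of uniformly computable continuous functions $u_n:\mathbb R^{k_n}\to\mathbb R$ (the arities $k_n$, the values at rational points up to any given precision, and moduli of uniform continuity on the boxes $[-B,B]^{k_n}$ are computable, uniformly in $n$) that contains addition, multiplication, $x\mapsto \lambda x$ for each $\lambda\in\mathbb Q$ (with index computable from $\lambda$), $x\mathbin{\dot-}y:=\max(x-y,0)$, $x\mapsto 0$, $x\mapsto 1$ and $x\mapsto x/2$. Let $L$ be a computable (possibly many-sorted) language for metric structures: the sorts, function symbols and predicate symbols are effectively coded by natural numbers, and the arities, the rational bounds on the diameters of the sorts, the rational bounds on the values of the predicates, and the moduli of uniform continuity (at rational arguments) are computable. An $L$-formula is *restricted* if all its connectives are among the $u_n$. $L$-structures consist of nonempty complete metric spaces and obey the bounds and moduli of $L$. A *universal* sentence is one of the form $\sup_{x_1}\cdots\sup_{x_n}\psi$ with $\psi$ quantifier-free. For a set $T$ of sentences, $N\models T$ means that $\sigma^N=0$ for all $\sigma\in T$. A set of restricted sentences is *effectively enumerable* if some algorithm enumerates (the Gödel numbers of) its elements. **Theorem.** Let $M$ be an $L$-structure. Suppose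 that the $M$EP has a positive solution: there is an effectively enumerable set $T$ of restricted $L$-sentences $\sigma$ with $\sigma^M=0$ such that every $L$-structure $N$ with $N\models T$ embeds into an ultrapower of $M$. Then the universal theory of $M$ is weakly effectively enumerable: the set of all sentences $\sigma\mathbin{\dot-}r$, where $\sigma$ is a restricted universal $L$-sentence, $r\in\mathbb Q^{>0}$ and $\sigma^M<r$, is effectively enumerable. -/

import Mathlib

open Filter Topology

universe u

noncomputable section

namespace ContLogic

/-! ### Names of rational numbers and computability of rational-valued data -/

/-- The rational number named by `(a, b, c)`, namely `(a - b) / (c + 1)`. Every rational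
number has a name. -/
def ratOf (q : ℕ × ℕ × ℕ) : ℚ := ((q.1 : ℚ) - q.2.1) / (q.2.2 + 1)

/-- A rational-valued function is computable if names of its values can be computed. -/
def ComputableRat {α : Type} [Primcodable α] (f : α → ℚ) : Prop :=
  ∃ g : α → ℕ × ℕ × ℕ, Computable g ∧ ∀ a, f a = ratOf (g a)

/-! ### Connectives -/

/-- A fixed sequence `u 0, u 1, …` of continuous functions `ℝᵏ → ℝ` (`k` varies), uniformly
computable, among which are addition, multiplication, truncated subtraction, multiplication
by each rational number, the unary constant functions `0` and `1`, and halving. -/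
structure Connectives where
  /-- the `n`-th connective, together with its number of arguments -/
  u : ℕ → Σ k : ℕ, ((Fin k → ℝ) → ℝ)
  continuous_u : ∀ n, Continuous (u n).2
  computable_arity : Computable fun n => (u n).1
  /-- the values at rational points can be computed with arbitrary precision, uniformly -/
  computable_values : ∃ g : ℕ × List (ℕ × ℕ × ℕ) × ℕ → ℕ × ℕ × ℕ, Computable g ∧
    ∀ (n : ℕ) (q : List (ℕ × ℕ × ℕ)) (m : ℕ) (h : q.length = (u n).1),
      |(ratOf (g (n, q, m)) : ℝ) - (u n).2 fun i => (ratOf (q.get (i.cast h.symm)) : ℝ)|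
        ≤ (1 / 2) ^ m
  /-- moduli of uniform continuity on the boxes `[-B, B]ᵏ` can be computed, uniformly -/
  computable_modulus : ∃ δ : ℕ × ℕ × ℕ → ℕ, Computable δ ∧
    ∀ (n B m : ℕ) (x y : Fin (u n).1 → ℝ), (∀ i, |x i| ≤ B) → (∀ i, |y i| ≤ B) →
      (∀ i, |x i - y i| ≤ (1 / 2) ^ δ (n, B, m)) → |(u n).2 x - (u n).2 y| ≤ (1 / 2) ^ m
  /-- index of addition -/
  add : ℕ
  u_add : u add = ⟨2, fun x => x 0 + x 1⟩
  /-- index of multiplication -/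
  mul : ℕ
  u_mul : u mul = ⟨2, fun x => x 0 * x 1⟩
  /-- index of truncated subtraction -/
  dotminus : ℕ
  u_dotminus : u dotminus = ⟨2, fun x => max (x 0 - x 1) 0⟩
  /-- index of multiplication by a rational number -/
  scale : ℚ → ℕ
  u_scale : ∀ c, u (scale c) = ⟨1, fun x => (c : ℝ) * x 0⟩
  computable_scale : Computable fun q => scale (ratOf q)
  /-- index of the unary constant function `0` -/
  zero : ℕ
  u_zero : u zero = ⟨1, fun _ => 0⟩
  /-- index of the unary constant function `1` -/
  one : ℕ
  u_one : u one = ⟨1, fun _ => 1⟩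
  /-- index of halving -/
  half : ℕ
  u_half : u half = ⟨1, fun x => x 0 / 2⟩

/-! ### Languages and structures -/

/-- A (many-sorted) language for metric structures: sorts with diameter bounds, function
symbols and predicate symbols (of any arity, so constants are included) with moduli of uniform
continuity, and compact intervals that contain the values of the predicates. -/
structure MetricLanguage where
  /-- sorts -/
  Srt : Type
  /-- function symbols -/
  Fn : Type
  /-- predicate symbols -/
  Rel : Type
  [codeSrt : Primcodable Srt]
  [codeFn : Primcodable Fn]
  [codeRel : Primcodable Rel]
  /-- bound on the diameter of a sort -/
  diam : Srt → ℚ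
  /-- sorts of the arguments of a function symbol -/
  fnDom : Fn → List Srt
  /-- sort of the values of a function symbol -/
  fnCod : Fn → Srt
  /-- modulus of uniform continuity of a function symbol -/
  fnMod : Fn → ℚ → ℚ
  fnMod_pos : ∀ f ε, 0 < ε → 0 < fnMod f ε
  /-- sorts of the arguments of a predicate symbol -/
  relDom : Rel → List Srt
  /-- modulus of uniform continuity of a predicate symbol -/
  relMod : Rel → ℚ → ℚ
  relMod_pos : ∀ R ε, 0 < ε → 0 < relMod R ε
  /-- lower bound for the values of a predicate symbol -/
  relLo : Rel → ℚ
  /-- upper bound for the values of a predicate symbol -/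
  relHi : Rel → ℚ

attribute [instance] MetricLanguage.codeSrt MetricLanguage.codeFn MetricLanguage.codeRel

/-- The language is computable: all its data are. -/
structure MetricLanguage.IsComputable (L : MetricLanguage) : Prop where
  diam : ComputableRat L.diam
  fnDom : Computable L.fnDom
  fnCod : Computable L.fnCod
  fnMod : ComputableRat fun p : L.Fn × (ℕ × ℕ × ℕ) => L.fnMod p.1 (ratOf p.2)
  relDom : Computable L.relDom
  relMod : ComputableRat fun p : L.Rel × (ℕ × ℕ × ℕ) => L.relMod p.1 (ratOf p.2)
  relLo : ComputableRat L.relLo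
  relHi : ComputableRat L.relHi

/-- Tuples of elements whose sorts are prescribed by a list. -/
abbrev Tuple {S : Type} (X : S → Type u) (Γ : List S) : Type u :=
  (i : Fin Γ.length) → X (Γ.get i)

/-- The tuple `(a, v₀, v₁, …)`. -/
def Tuple.cons {S : Type} {X : S → Type u} {s : S} {Γ : List S} (a : X s) (v : Tuple X Γ) :
    Tuple X (s :: Γ)
  | ⟨0, _⟩ => a
  | ⟨i + 1, h⟩ => v ⟨i, Nat.lt_of_succ_lt_succ h⟩

/-- A metric structure: nonempty complete bounded metric spaces with uniformly continuous
functions and predicates that obey the bounds and moduli of the language. -/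
structure MetricStructure (L : MetricLanguage) where
  /-- the underlying metric spaces -/
  carrier : L.Srt → Type u
  [metric : ∀ s, MetricSpace (carrier s)]
  [complete : ∀ s, CompleteSpace (carrier s)]
  [nonempty : ∀ s, Nonempty (carrier s)]
  dist_le_diam : ∀ s (x y : carrier s), dist x y ≤ L.diam s
  /-- interpretation of function symbols -/
  fn : (f : L.Fn) → Tuple carrier (L.fnDom f) → carrier (L.fnCod f)
  fn_modulus : ∀ (f : L.Fn) (ε : ℚ), 0 < ε → ∀ x y : Tuple carrier (L.fnDom f),
    (∀ i, dist (x i) (y i) < L.fnMod f ε) → dist (fn f x) (fn f y) ≤ ε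
  /-- interpretation of predicate symbols -/
  rel : (R : L.Rel) → Tuple carrier (L.relDom R) → ℝ
  rel_mem : ∀ R x, rel R x ∈ Set.Icc (L.relLo R : ℝ) (L.relHi R)
  rel_modulus : ∀ (R : L.Rel) (ε : ℚ), 0 < ε → ∀ x y : Tuple carrier (L.relDom R),
    (∀ i, dist (x i) (y i) < L.relMod R ε) → |rel R x - rel R y| ≤ ε

attribute [instance] MetricStructure.metric MetricStructure.complete MetricStructure.nonempty

/-- An embedding of metric structures: a family of isometric maps, one for each sort, that
commute with all function symbols and preserve the values of all predicate symbols. -/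
structure Embedding {L : MetricLanguage} (N M : MetricStructure.{u} L) where
  /-- the maps -/
  toFun : ∀ s, N.carrier s → M.carrier s
  isometry : ∀ s, Isometry (toFun s)
  map_fn : ∀ f (x : Tuple N.carrier (L.fnDom f)),
    toFun _ (N.fn f x) = M.fn f fun i => toFun _ (x i)
  map_rel : ∀ R (x : Tuple N.carrier (L.relDom R)),
    M.rel R (fun i => toFun _ (x i)) = N.rel R x

/-! ### Restricted formulas -/

section Formulas

variable (C : Connectives) (L : MetricLanguage)

/-- Terms of a given sort, in variables whose sorts are listed in `Γ`. -/
inductive Term (Γ : List L.Srt) : L.Srt → Type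
  | var (i : Fin Γ.length) : Term Γ (Γ.get i)
  | func (f : L.Fn) (ts : (i : Fin (L.fnDom f).length) → Term Γ ((L.fnDom f).get i)) :
      Term Γ (L.fnCod f)

/-- Restricted formulas with free variables listed in `Γ`: the connectives are those of `C`. A
quantifier binds the variable at the head of the list. -/
inductive Formula : List L.Srt → Type
  | dist {Γ : List L.Srt} (s : L.Srt) (t₁ t₂ : Term L Γ s) : Formula Γ
  | rel {Γ : List L.Srt} (R : L.Rel)
      (ts : (i : Fin (L.relDom R).length) → Term L Γ ((L.relDom R).get i)) : Formula Γ
  | conn {Γ : List L.Srt} (n : ℕ) (φs : Fin (C.u n).1 → Formula Γ) : Formula Γ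
  | sup {Γ : List L.Srt} (s : L.Srt) (φ : Formula (s :: Γ)) : Formula Γ
  | inf {Γ : List L.Srt} (s : L.Srt) (φ : Formula (s :: Γ)) : Formula Γ

/-- Restricted sentences. -/
abbrev Sentence : Type := Formula C L []

end Formulas

variable {C : Connectives} {L : MetricLanguage}

/-- The Gödel number of a term. -/
def Term.code {Γ : List L.Srt} : {s : L.Srt} → Term L Γ s → ℕ
  | _, .var i => Nat.pair 0 i
  | _, .func f ts =>
      Nat.pair 1 (Nat.pair (Encodable.encode f) (Encodable.encode (List.ofFn fun i => (ts i).code)))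

/-- The Gödel number of a restricted formula. -/
def Formula.code : {Γ : List L.Srt} → Formula C L Γ → ℕ
  | _, .dist s t₁ t₂ => Nat.pair 0 (Nat.pair (Encodable.encode s) (Nat.pair t₁.code t₂.code))
  | _, .rel R ts =>
      Nat.pair 1 (Nat.pair (Encodable.encode R) (Encodable.encode (List.ofFn fun i => (ts i).code)))
  | _, .conn n φs =>
      Nat.pair 2 (Nat.pair n (Encodable.encode (List.ofFn fun i => (φs i).code)))
  | _, .sup s φ => Nat.pair 3 (Nat.pair (Encodable.encode s) φ.code)
  | _, .inf s φ => Nat.pair 4 (Nat.pair (Encodable.encode s) φ.code)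

/-- Quantifier-free restricted formulas. -/
inductive Formula.IsQF : {Γ : List L.Srt} → Formula C L Γ → Prop
  | dist {Γ : List L.Srt} (s : L.Srt) (t₁ t₂ : Term L Γ s) : IsQF (.dist s t₁ t₂)
  | rel {Γ : List L.Srt} (R : L.Rel)
      (ts : (i : Fin (L.relDom R).length) → Term L Γ ((L.relDom R).get i)) : IsQF (.rel R ts)
  | conn {Γ : List L.Srt} (n : ℕ) (φs : Fin (C.u n).1 → Formula C L Γ)
      (h : ∀ i, (φs i).IsQF) : IsQF (.conn n φs)

/-- Universal restricted formulas: `sup_{x₁} ⋯ sup_{xₙ} ψ` with `ψ` quantifier-free. -/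
inductive Formula.IsUniversal : {Γ : List L.Srt} → Formula C L Γ → Prop
  | qf {Γ : List L.Srt} (φ : Formula C L Γ) (h : φ.IsQF) : IsUniversal φ
  | sup {Γ : List L.Srt} (s : L.Srt) (φ : Formula C L (s :: Γ)) (h : φ.IsUniversal) :
      IsUniversal (.sup s φ)

/-- The formula `σ ∸ r`, for a rational number `r`. The constant `r` is written as `r · 1(σ)`
with the unary connectives `1` and multiplication by `r`. -/
def Formula.dotminusRat {Γ : List L.Srt} (σ : Formula C L Γ) (r : ℚ) : Formula C L Γ :=
  .conn C.dotminus fun i =>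
    ![σ, .conn (C.scale r) fun _ => .conn C.one fun _ => σ]
      (i.cast (congrArg Sigma.fst C.u_dotminus))

/-! ### Semantics -/

/-- The value of a term. -/
def Term.eval (M : MetricStructure.{u} L) {Γ : List L.Srt} (v : Tuple M.carrier Γ) :
    {s : L.Srt} → Term L Γ s → M.carrier s
  | _, .var i => v i
  | _, .func f ts => M.fn f fun i => (ts i).eval M v

/-- The value of a restricted formula. -/
def Formula.eval (M : MetricStructure.{u} L) :
    {Γ : List L.Srt} → Formula C L Γ → Tuple M.carrier Γ → ℝ
  | _, .dist _ t₁ t₂, v => Dist.dist (t₁.eval M v) (t₂.eval M v)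
  | _, .rel R ts, v => M.rel R fun i => (ts i).eval M v
  | _, .conn n φs, v => (C.u n).2 fun i => (φs i).eval M v
  | _, .sup s φ, v => ⨆ a : M.carrier s, φ.eval M (Tuple.cons a v)
  | _, .inf s φ, v => ⨅ a : M.carrier s, φ.eval M (Tuple.cons a v)

/-- The value `σ^M` of a restricted sentence. -/
def Sentence.value (M : MetricStructure.{u} L) (σ : Sentence C L) : ℝ :=
  Formula.eval M σ fun i => i.elim0

/-- `M ⊨ T`: every sentence in `T` has value `0` in `M`. -/
def Models (M : MetricStructure.{u} L) (T : Set (Sentence C L)) : Prop :=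
  ∀ σ ∈ T, Sentence.value M σ = 0

/-- The full theory of `M`, as a set of restricted sentences. -/
def fullTheory (C : Connectives) (M : MetricStructure.{u} L) : Set (Sentence C L) :=
  {σ | Sentence.value M σ = 0}

/-! ### Effective enumerability -/

/-- A set of restricted sentences is effectively enumerable if its set of Gödel numbers is. -/
def EffectivelyEnumerable (S : Set (Sentence C L)) : Prop :=
  REPred fun n : ℕ => ∃ σ ∈ S, Formula.code σ = n

/-- The universal theory of `M` is weakly effectively enumerable: the sentences `σ ∸ r`, where
`σ` is a universal restricted sentence, `r` is a positive rational number and `σ^M < r`, can be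
effectively enumerated. -/
def WeaklyEffectivelyEnumerable (C : Connectives) (M : MetricStructure.{u} L) : Prop :=
  EffectivelyEnumerable {τ : Sentence C L | ∃ (σ : Sentence C L) (r : ℚ),
    σ.IsUniversal ∧ 0 < r ∧ Sentence.value M σ < r ∧ τ = σ.dotminusRat r}

/-! ### Ultrapowers -/

section Ultrapower

variable {I : Type u} (U : Ultrafilter I)

theorem tendsto_limUnder_of_mem_Icc {f : I → ℝ} {a b : ℝ} (h : ∀ i, f i ∈ Set.Icc a b) :
    Tendsto f U (𝓝 (limUnder (U : Filter I) f)) := by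
  refine tendsto_nhds_limUnder ?_
  have hU : ((U.map f : Ultrafilter ℝ) : Filter ℝ) ≤ 𝓟 (Set.Icc a b) := by
    rw [Ultrafilter.coe_map, le_principal_iff]
    exact mem_map.2 (Filter.univ_mem' h)
  obtain ⟨x, -, hx⟩ := isCompact_Icc.ultrafilter_le_nhds _ hU
  exact ⟨x, hx⟩

theorem limUnder_mem_Icc {f : I → ℝ} {a b : ℝ} (h : ∀ i, f i ∈ Set.Icc a b) :
    limUnder (U : Filter I) f ∈ Set.Icc a b :=
  isClosed_Icc.mem_of_tendsto (tendsto_limUnder_of_mem_Icc U h) (Eventually.of_forall h)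

/-- `I`-indexed families in `X`, to be compared along the ultrafilter `U`. -/
def UltraSeq (_U : Ultrafilter I) (X : Type u) : Type u := I → X

variable {X : Type u} [MetricSpace X] [BoundedSpace X]

theorem exists_dist_mem_Icc : ∃ D : ℝ, ∀ x y : X, dist x y ∈ Set.Icc 0 D := by
  obtain ⟨D, hD⟩ := Metric.isBounded_iff.1 (BoundedSpace.bounded_univ (α := X))
  exact ⟨D, fun x y => ⟨dist_nonneg, hD (Set.mem_univ x) (Set.mem_univ y)⟩⟩

theorem tendsto_dist_limUnder (x y : I → X) :
    Tendsto (fun i => dist (x i) (y i)) U (𝓝 (limUnder (U : Filter I) fun i => dist (x i) (y i))) := by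
  obtain ⟨D, hD⟩ := exists_dist_mem_Icc (X := X)
  exact tendsto_limUnder_of_mem_Icc U fun i => hD _ _

/-- The pseudometric `d(x, y) = lim_{i → U} d(x i, y i)`. -/
instance : PseudoMetricSpace (UltraSeq U X) where
  dist x y := limUnder (U : Filter I) fun i => dist (x i) (y i)
  dist_self x := by
    have h := tendsto_dist_limUnder U x x
    simp only [dist_self] at h
    simpa using tendsto_nhds_unique h tendsto_const_nhds
  dist_comm x y := by simp only [dist_comm]
  dist_triangle x y z :=
    le_of_tendsto_of_tendsto' (tendsto_dist_limUnder U x z)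
      ((tendsto_dist_limUnder U x y).add (tendsto_dist_limUnder U y z))
      fun _ => dist_triangle _ _ _

theorem UltraSeq.tendsto_dist (x y : UltraSeq U X) :
    Tendsto (fun i => Dist.dist (x i) (y i)) U (𝓝 (dist x y)) :=
  tendsto_dist_limUnder U x y

theorem UltraSeq.dist_le {x y : UltraSeq U X} {ε : ℝ} (h : ∀ᶠ i in U, Dist.dist (x i) (y i) ≤ ε) :
    dist x y ≤ ε :=
  le_of_tendsto (UltraSeq.tendsto_dist U x y) h

instance [CompleteSpace X] : CompleteSpace (UltraSeq U X) := by
  refine Metric.complete_of_convergent_controlled_sequences (fun n => (1 / 2 : ℝ) ^ n)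
    (fun n => by positivity) fun u hu => ?_
  have key : ∀ i : I, ∃ y : X, ∀ n : ℕ,
      (∀ k < n, Dist.dist (u k i) (u (k + 1) i) ≤ (1 / 2 : ℝ) ^ k) →
        Dist.dist (u n i) y ≤ 2 / 2 ^ n := by
    intro i
    have aux : ∀ w : ℕ → X, (∀ k, Dist.dist (w k) (w (k + 1)) ≤ (1 / 2 : ℝ) ^ k) →
        ∃ y, ∀ n, Dist.dist (w n) y ≤ 2 / 2 ^ n := by
      intro w hw
      have hw' : ∀ k, Dist.dist (w k) (w (k + 1)) ≤ (2 : ℝ) / 2 / 2 ^ k := fun k => by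
        simpa [div_pow] using hw k
      obtain ⟨y, hy⟩ := cauchySeq_tendsto_of_complete (cauchySeq_of_le_geometric_two hw')
      exact ⟨y, fun n => dist_le_of_le_geometric_two_of_tendsto hw' hy n⟩
    by_cases hA : ∀ k, Dist.dist (u k i) (u (k + 1) i) ≤ (1 / 2 : ℝ) ^ k
    · obtain ⟨y, hy⟩ := aux (fun k => u k i) hA
      exact ⟨y, fun n _ => hy n⟩
    · classical
      push Not at hA
      have hlt : ∀ k < Nat.find hA, Dist.dist (u k i) (u (k + 1) i) ≤ (1 / 2 : ℝ) ^ k :=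
        fun k hk => not_lt.1 (Nat.find_min hA hk)
      obtain ⟨y, hy⟩ := aux (fun k => u (min k (Nat.find hA)) i) fun k => by
        rcases lt_or_ge k (Nat.find hA) with hk | hk
        · simpa only [min_eq_left hk.le, min_eq_left (Nat.succ_le_of_lt hk)] using hlt k hk
        · simp only [min_eq_right hk, min_eq_right (hk.trans (Nat.le_succ k)), dist_self]
          positivity
      refine ⟨y, fun n hn => ?_⟩
      have hle : n ≤ Nat.find hA := by
        by_contra hlt'
        exact (Nat.find_spec hA).not_ge (hn _ (not_le.1 hlt'))
      simpa only [min_eq_left hle] using hy n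
  choose y hy using key
  refine ⟨(y : UltraSeq U X), ?_⟩
  have hev : ∀ n : ℕ, ∀ᶠ i in U, ∀ k < n,
      Dist.dist (u k i) (u (k + 1) i) ≤ (1 / 2 : ℝ) ^ k := by
    intro n
    refine (eventually_all_finite (Set.finite_lt_nat n)).2 fun k _ => ?_
    exact ((UltraSeq.tendsto_dist U (u k) (u (k + 1))).eventually_lt_const
      (hu k k (k + 1) le_rfl (Nat.le_succ k))).mono fun i hi => hi.le
  have hd : ∀ n, dist (u n) (y : UltraSeq U X) ≤ 2 / 2 ^ n := fun n =>
    UltraSeq.dist_le U ((hev n).mono fun i hi => hy i n hi)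
  refine tendsto_iff_dist_tendsto_zero.2 (squeeze_zero (fun _ => dist_nonneg) hd ?_)
  have h2 : Tendsto (fun n : ℕ => (2 : ℝ) * (1 / 2) ^ n) atTop (𝓝 (2 * 0)) :=
    (tendsto_pow_atTop_nhds_zero_of_lt_one (by norm_num) (by norm_num)).const_mul 2
  simpa [div_eq_mul_inv] using h2

/-- The ultrapower of a bounded metric space: families of points, two of them being identified
if their distance `lim_{i → U} d(x i, y i)` is `0`. -/
abbrev UltraSpace (U : Ultrafilter I) (X : Type u) [MetricSpace X] [BoundedSpace X] : Type u :=
  SeparationQuotient (UltraSeq U X)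

/-- The class `[x]` of a family. -/
def UltraSpace.mk (x : I → X) : UltraSpace U X := SeparationQuotient.mk (X := UltraSeq U X) x

/-- A family that represents a given point. -/
def UltraSpace.rep (a : UltraSpace U X) : I → X := (SeparationQuotient.surjective_mk a).choose

theorem UltraSpace.mk_rep (a : UltraSpace U X) : UltraSpace.mk U (UltraSpace.rep U a) = a :=
  (SeparationQuotient.surjective_mk a).choose_spec

theorem UltraSpace.tendsto_dist_mk (x y : I → X) :
    Tendsto (fun i => dist (x i) (y i)) U (𝓝 (dist (UltraSpace.mk U x) (UltraSpace.mk U y))) :=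
  UltraSeq.tendsto_dist U x y

theorem UltraSpace.tendsto_dist_rep (a b : UltraSpace U X) :
    Tendsto (fun i => dist (UltraSpace.rep U a i) (UltraSpace.rep U b i)) U (𝓝 (dist a b)) := by
  simpa only [UltraSpace.mk_rep] using
    UltraSpace.tendsto_dist_mk U (UltraSpace.rep U a) (UltraSpace.rep U b)

instance (M : MetricStructure.{u} L) (s : L.Srt) : BoundedSpace (M.carrier s) :=
  ⟨Metric.isBounded_iff.2 ⟨L.diam s, fun x _ y _ => M.dist_le_diam s x y⟩⟩

/-- The ultrapower `M^U`. Function symbols act coordinatewise on representing families, and the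
value of a predicate symbol is the limit along `U` of its values at the coordinates. -/
def ultrapower (M : MetricStructure.{u} L) : MetricStructure.{u} L where
  carrier s := UltraSpace U (M.carrier s)
  nonempty _ := ⟨UltraSpace.mk U fun _ => Classical.arbitrary _⟩
  dist_le_diam _ a b :=
    le_of_tendsto (UltraSpace.tendsto_dist_rep U a b)
      (Eventually.of_forall fun _ => M.dist_le_diam _ _ _)
  fn f a := UltraSpace.mk U fun i => M.fn f fun k => UltraSpace.rep U (a k) i
  fn_modulus f ε hε a b h :=
    le_of_tendsto (UltraSpace.tendsto_dist_mk U _ _) <|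
      (eventually_all.2 fun k =>
        (UltraSpace.tendsto_dist_rep U (a k) (b k)).eventually_lt_const (h k)).mono
          fun _ hi => M.fn_modulus f ε hε _ _ hi
  rel R a := limUnder (U : Filter I) fun i => M.rel R fun k => UltraSpace.rep U (a k) i
  rel_mem R _ := limUnder_mem_Icc U fun _ => M.rel_mem R _
  rel_modulus R ε hε a b h :=
    le_of_tendsto
      (((tendsto_limUnder_of_mem_Icc U fun _ => M.rel_mem R _).sub
        (tendsto_limUnder_of_mem_Icc U fun _ => M.rel_mem R _)).abs) <|
      (eventually_all.2 fun k =>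
        (UltraSpace.tendsto_dist_rep U (a k) (b k)).eventually_lt_const (h k)).mono
          fun _ hi => M.rel_modulus R ε hε _ _ hi

/-- If `x` and `y` represent the same point, then `d(x i, y i)` tends to `0` along `U`. -/
theorem UltraSpace.eventually_dist_rep_mk_lt (x : I → X) {δ : ℝ} (hδ : 0 < δ) :
    ∀ᶠ i in U, dist (UltraSpace.rep U (UltraSpace.mk U x) i) (x i) < δ := by
  have h := UltraSpace.tendsto_dist_mk U (UltraSpace.rep U (UltraSpace.mk U x)) x
  rw [UltraSpace.mk_rep, dist_self] at h
  exact h.eventually_lt_const hδ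

/-- The functions of the ultrapower do not depend on the choice of representing families. -/
theorem ultrapower_fn_mk (M : MetricStructure.{u} L) (f : L.Fn)
    (x : I → Tuple M.carrier (L.fnDom f)) :
    (ultrapower U M).fn f (fun k => UltraSpace.mk U fun i => x i k) =
      UltraSpace.mk U fun i => M.fn f (x i) := by
  refine eq_of_forall_dist_le fun ε hε => ?_
  obtain ⟨q, hq, hqε⟩ := exists_rat_btwn hε
  refine le_trans ?_ hqε.le
  have hq' : 0 < q := by exact_mod_cast hq
  have hpos : (0 : ℝ) < L.fnMod f q := by exact_mod_cast L.fnMod_pos f q hq'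
  exact le_of_tendsto (UltraSpace.tendsto_dist_mk U _ _) <|
    (eventually_all.2 fun k =>
      UltraSpace.eventually_dist_rep_mk_lt U (fun i => x i k) hpos).mono
        fun _ hi => M.fn_modulus f q hq' _ _ hi

/-- The predicates of the ultrapower do not depend on the choice of representing families. -/
theorem tendsto_ultrapower_rel_mk (M : MetricStructure.{u} L) (R : L.Rel)
    (x : I → Tuple M.carrier (L.relDom R)) :
    Tendsto (fun i => M.rel R (x i)) U
      (𝓝 ((ultrapower U M).rel R fun k => UltraSpace.mk U fun i => x i k)) := by
  have h₁ : Tendsto (fun i => M.rel R (x i)) U (𝓝 (limUnder (U : Filter I) _)) :=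
    tendsto_limUnder_of_mem_Icc U fun i => M.rel_mem R (x i)
  have h₂ : Tendsto
      (fun i => M.rel R fun k => UltraSpace.rep U (UltraSpace.mk U fun j => x j k) i) U
      (𝓝 ((ultrapower U M).rel R fun k => UltraSpace.mk U fun i => x i k)) :=
    tendsto_limUnder_of_mem_Icc U fun i => M.rel_mem R _
  convert h₁ using 2
  refine eq_of_forall_dist_le fun ε hε => ?_
  obtain ⟨q, hq, hqε⟩ := exists_rat_btwn hε
  refine le_trans ?_ hqε.le
  have hq' : 0 < q := by exact_mod_cast hq
  have hpos : (0 : ℝ) < L.relMod R q := by exact_mod_cast L.relMod_pos R q hq'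
  exact le_of_tendsto (h₂.dist h₁) <|
    (eventually_all.2 fun k =>
      UltraSpace.eventually_dist_rep_mk_lt U (fun i => x i k) hpos).mono
        fun _ hi => M.rel_modulus R q hq' _ _ hi

end Ultrapower

/-! ### The embedding problem -/

/-- The `M`EP has a positive solution: there is an effectively enumerable subset `T` of the full
theory of `M` such that every model of `T` embeds into an ultrapower of `M`. -/
def HasEP (C : Connectives) (M : MetricStructure.{u} L) : Prop :=
  ∃ T : Set (Sentence C L), T ⊆ fullTheory C M ∧ EffectivelyEnumerable T ∧
    ∀ N : MetricStructure.{u} L, Models N T →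
      ∃ (I : Type u) (U : Ultrafilter I), Nonempty (Embedding N (ultrapower U M))

end ContLogic

end

/-!
The value `σ^M` of a universal sentence is less than `r` if and only if this has a finite
certificate, and such certificates can be searched for.

The certificates come from a propositional form of continuous logic. Fix names of points, formed
from function symbols, codes of terms and Henkin witnesses, and atoms "the value of this formula,
distance or predicate at these names is at most `q`" with rational `q`. The clauses `Ax C T` express
the axioms of metric structures with the bounds and moduli of `L`, the clauses by which values of
compound formulas are computed up to rational errors, the defining properties of the Henkin
witnesses, and `τ = 0` for `τ ∈ T`. Then `σ^M < r` holds if and only if, for some rational `p < r`,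
these clauses together with `σ > p` have no satisfying truth assignment (`ContLogic.value_lt_iff`):

* if `σ^M ≥ r`, then the true statements about `M` form a satisfying assignment for every `p < r`
  (`ContLogic.ax_sat`);
* if a truth assignment satisfies the clauses for some `p` with `σ^M < p`, then it makes the names a
  pseudometric structure, whose completion `N` gives every sentence the value that the assignment
  gives it (`ContLogic.rep_eval_henkinModel`). So `N ⊨ T` and `p ≤ σ^N`. By hypothesis `N` embeds
  into an ultrapower of `M`. The theorem of Łoś for quantifier-free formulas then gives
  `σ^N ≤ σ^M` (`ContLogic.Formula.IsUniversal.value_le`), a contradiction.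

The clauses are enumerable (`ContLogic.rePred_ax`), since `L`, the connectives and `T` are. By
compactness of the Cantor space, an unsatisfiable set of clauses is already refuted by finitely many
of them, so unsatisfiability of an enumerable set of clauses is enumerable
(`ContLogic.REPred.unsat`). The same fact, for the Horn clauses that express the rules of formation,
shows that the codes of universal sentences are enumerable
(`ContLogic.rePred_universal_sentence`).

All this speaks of codes. The clauses are stated for arbitrary numbers in place of codes of
formulas, without a test for being well-formed, and `ContLogic.rawVal` gives every number a value in
`M`, which is the intended one for codes of formulas.
-/

noncomputable section

/-! ### Computability -/

attribute [fun_prop] Primrec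

namespace ContLogic

section Primrec

variable {α β γ σ : Type} [Primcodable α] [Primcodable β] [Primcodable γ] [Primcodable σ]

attribute [fun_prop] Primrec.id Primrec.const Primrec.comp Primrec.pair

@[fun_prop]
theorem primrec_fst {f : α → β × γ} (hf : Primrec f) : Primrec fun a => (f a).1 :=
  Primrec.fst.comp hf

@[fun_prop]
theorem primrec_snd {f : α → β × γ} (hf : Primrec f) : Primrec fun a => (f a).2 :=
  Primrec.snd.comp hf

@[fun_prop]
theorem primrec_inl {f : α → β} (hf : Primrec f) : Primrec fun a => (Sum.inl (f a) : β ⊕ γ) :=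
  Primrec.sumInl.comp hf

@[fun_prop]
theorem primrec_inr {f : α → γ} (hf : Primrec f) : Primrec fun a => (Sum.inr (f a) : β ⊕ γ) :=
  Primrec.sumInr.comp hf

@[fun_prop]
theorem primrec_encode {f : α → β} (hf : Primrec f) : Primrec fun a => Encodable.encode (f a) :=
  Primrec.encode.comp hf

@[fun_prop]
theorem primrec_natPair {f g : α → ℕ} (hf : Primrec f) (hg : Primrec g) :
    Primrec fun a => Nat.pair (f a) (g a) :=
  Primrec₂.natPair.comp hf hg

@[fun_prop]
theorem primrec_add {f g : α → ℕ} (hf : Primrec f) (hg : Primrec g) :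
    Primrec fun a => f a + g a :=
  Primrec.nat_add.comp hf hg

@[fun_prop]
theorem primrec_sub {f g : α → ℕ} (hf : Primrec f) (hg : Primrec g) :
    Primrec fun a => f a - g a :=
  Primrec.nat_sub.comp hf hg

@[fun_prop]
theorem primrec_mul {f g : α → ℕ} (hf : Primrec f) (hg : Primrec g) :
    Primrec fun a => f a * g a :=
  Primrec.nat_mul.comp hf hg

@[fun_prop]
theorem primrec_two_pow {f : α → ℕ} (hf : Primrec f) : Primrec fun a => 2 ^ f a := by
  have h : Primrec fun n : ℕ => 2 ^ n := by
    refine (Primrec.nat_rec₁ 1 (f := fun _ y => y * 2) ?_).of_eq fun n => ?_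
    · exact Primrec.nat_mul.comp₂ Primrec₂.right (Primrec₂.const 2)
    · induction n with
      | zero => rfl
      | succ n ih => simp only [pow_succ, ← ih]
  exact h.comp hf

@[fun_prop]
theorem primrec_not {f : α → Bool} (hf : Primrec f) : Primrec fun a => !f a :=
  Primrec.not.comp hf

@[fun_prop]
theorem primrec_some {f : α → β} (hf : Primrec f) : Primrec fun a => some (f a) :=
  Primrec.option_some.comp hf

@[fun_prop]
theorem primrec_cons {f : α → β} {g : α → List β} (hf : Primrec f) (hg : Primrec g) :
    Primrec fun a => f a :: g a :=
  Primrec.list_cons.comp hf hg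

@[fun_prop]
theorem primrec_append {f g : α → List β} (hf : Primrec f) (hg : Primrec g) :
    Primrec fun a => f a ++ g a :=
  Primrec.list_append.comp hf hg

@[fun_prop]
theorem primrec_length {f : α → List β} (hf : Primrec f) : Primrec fun a => (f a).length :=
  Primrec.list_length.comp hf

@[fun_prop]
theorem primrec_getElem? {f : α → List β} {g : α → ℕ} (hf : Primrec f) (hg : Primrec g) :
    Primrec fun a => (f a)[g a]? :=
  Primrec.list_getElem?.comp hf hg

@[fun_prop]
theorem primrec_map {f : α → List β} {g : α → β → σ} (hf : Primrec f)
    (hg : Primrec fun p : α × β => g p.1 p.2) : Primrec fun a => (f a).map (g a) :=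
  Primrec.list_map hf hg

@[fun_prop]
theorem primrec_flatMap {f : α → List β} {g : α → β → List σ} (hf : Primrec f)
    (hg : Primrec fun p : α × β => g p.1 p.2) : Primrec fun a => (f a).flatMap (g a) :=
  Primrec.list_flatMap hf hg

theorem primrecPred_eq {f g : α → β} (hf : Primrec f) (hg : Primrec g) :
    PrimrecPred fun a => f a = g a :=
  Primrec.eq.comp hf hg

theorem primrecPred_lt {f g : α → ℕ} (hf : Primrec f) (hg : Primrec g) :
    PrimrecPred fun a => f a < g a :=
  Primrec.nat_lt.comp hf hg

theorem primrecPred_forall_mem {p : α → β → Prop} {f : α → List β}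
    (hp : PrimrecPred fun x : α × β => p x.1 x.2) (hf : Primrec f) :
    PrimrecPred fun a => ∀ b ∈ f a, p a b := by
  have h : PrimrecRel fun (l : List β) (a : α) => ∀ b ∈ l, p a b :=
    PrimrecRel.forall_mem_list (R := fun b a => p a b)
      (hp.comp (f := fun x : β × α => (x.2, x.1)) (by fun_prop))
  exact h.comp hf Primrec.id

end Primrec

end ContLogic

section RE

open ContLogic

variable {α β γ : Type} [Primcodable α] [Primcodable β] [Primcodable γ]

/-- An existential quantifier over the natural numbers in front of a decidable relation gives an
enumerable predicate: search for a witness. -/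
theorem REPred.of_exists_nat {p : α → Prop} {R : ℕ → α → Prop}
    (hR : PrimrecPred fun x : ℕ × α => R x.1 x.2) (h : ∀ a, p a ↔ ∃ k, R k a) : REPred p := by
  classical
  have h1 : Computable₂ fun (a : α) (k : ℕ) => decide (R k a) := by
    have h2 := (primrecPred_iff_primrec_decide.1 hR).comp
      (g := fun x : α × ℕ => (x.2, x.1)) (by fun_prop)
    exact h2.to_comp
  have h3 : Partrec fun a => Nat.rfind fun k => Part.some (decide (R k a)) :=
    Partrec.rfind h1.partrec₂
  refine h3.dom_re.of_eq fun a => ?_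
  rw [h a]
  refine (Nat.rfind_dom' (p := fun k => Part.some (decide (R k a)))).trans ?_
  simp only [Part.mem_some_iff]
  constructor
  · rintro ⟨k, hk, -⟩
    exact ⟨k, by simpa using hk⟩
  · rintro ⟨k, hk⟩
    exact ⟨k, by simpa using hk, fun _ => trivial⟩

/-- Every enumerable predicate is the union of an increasing sequence of uniformly decidable
ones: run a machine for `k` steps. -/
theorem REPred.exists_stages {p : α → Prop} (hp : REPred p) :
    ∃ R : ℕ → α → Prop, PrimrecPred (fun x : ℕ × α => R x.1 x.2) ∧
      (∀ a k l, k ≤ l → R k a → R l a) ∧ ∀ a, p a ↔ ∃ k, R k a := by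
  obtain ⟨c, hc⟩ := Nat.Partrec.Code.exists_code.1 hp
  refine ⟨fun k a => (Nat.Partrec.Code.evaln k c (Encodable.encode a)).isSome = true, ?_, ?_, ?_⟩
  · refine primrecPred_eq (Primrec.option_isSome.comp (Nat.Partrec.Code.primrec_evaln.comp
      (g := fun x : ℕ × α => ((x.1, c), Encodable.encode x.2)) ?_)) (Primrec.const true)
    fun_prop
  · intro a k l hkl h
    obtain ⟨x, hx⟩ := Option.isSome_iff_exists.1 h
    exact Option.isSome_iff_exists.2 ⟨x, Nat.Partrec.Code.evaln_mono hkl hx⟩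
  · intro a
    have h1 : p a ↔ (Nat.Partrec.Code.eval c (Encodable.encode a)).Dom := by
      rw [hc]
      simp [Part.dom_iff_mem, Part.mem_assert_iff]
    rw [h1, Part.dom_iff_mem]
    simp only [Nat.Partrec.Code.evaln_complete, Option.isSome_iff_exists]
    exact exists_comm

theorem REPred.of_primrecPred {p : α → Prop} (hp : PrimrecPred p) : REPred p :=
  REPred.of_exists_nat (R := fun _ a => p a) (hp.comp Primrec.snd) fun _ => by simp

theorem REPred.comp {p : β → Prop} {f : α → β} (hp : REPred p) (hf : Computable f) :
    REPred fun a => p (f a) :=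
  Partrec.comp hp hf

theorem REPred.comp_primrec {p : β → Prop} {f : α → β} (hp : REPred p) (hf : Primrec f) :
    REPred fun a => p (f a) :=
  REPred.comp hp hf.to_comp

theorem REPred.and {p q : α → Prop} (hp : REPred p) (hq : REPred q) :
    REPred fun a => p a ∧ q a := by
  obtain ⟨R, hR, hRm, hRp⟩ := REPred.exists_stages hp
  obtain ⟨S, hS, hSm, hSq⟩ := REPred.exists_stages hq
  refine REPred.of_exists_nat (R := fun k a => R k a ∧ S k a) (hR.and hS) fun a => ?_
  rw [hRp, hSq]
  constructor
  · rintro ⟨⟨k, hk⟩, l, hl⟩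
    exact ⟨max k l, hRm _ _ _ (le_max_left _ _) hk, hSm _ _ _ (le_max_right _ _) hl⟩
  · rintro ⟨k, h1, h2⟩
    exact ⟨⟨k, h1⟩, k, h2⟩

theorem REPred.or {p q : α → Prop} (hp : REPred p) (hq : REPred q) :
    REPred fun a => p a ∨ q a := by
  obtain ⟨R, hR, hRm, hRp⟩ := REPred.exists_stages hp
  obtain ⟨S, hS, hSm, hSq⟩ := REPred.exists_stages hq
  refine REPred.of_exists_nat (R := fun k a => R k a ∨ S k a) (hR.or hS) fun a => ?_
  rw [hRp, hSq]
  exact exists_or.symm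

theorem REPred.exists {p : β → α → Prop} (hp : REPred fun x : β × α => p x.1 x.2) :
    REPred fun a => ∃ b, p b a := by
  obtain ⟨R, hR, hRm, hRp⟩ := REPred.exists_stages hp
  -- search for a number that codes both the witness and the stage
  refine REPred.of_exists_nat
    (R := fun n a => ∃ b ∈ (Encodable.decode (α := β) n.unpair.1).toList, R n.unpair.2 (b, a))
    ?_ fun a => ?_
  · have h : PrimrecRel fun (l : List β) (x : ℕ × α) => ∃ b ∈ l, R x.1.unpair.2 (b, x.2) := by
      refine PrimrecRel.exists_mem_list (R := fun b (x : ℕ × α) => R x.1.unpair.2 (b, x.2)) ?_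
      refine hR.comp (f := fun y : β × (ℕ × α) => (y.2.1.unpair.2, (y.1, y.2.2))) ?_
      have h0 : Primrec fun y : β × (ℕ × α) => y.2.1.unpair := Primrec.unpair.comp (by fun_prop)
      fun_prop
    have h1 : Primrec fun x : ℕ × α => (Encodable.decode (α := β) x.1.unpair.1).toList := by
      refine Primrec.optionToList.comp (Primrec.decode.comp ?_)
      exact Primrec.fst.comp (Primrec.unpair.comp Primrec.fst)
    exact h.comp h1 Primrec.id
  · constructor
    · rintro ⟨b, hb⟩
      obtain ⟨k, hk⟩ := (hRp (b, a)).1 hb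
      exact ⟨Nat.pair (Encodable.encode b) k, b, by simp, by simpa using hk⟩
    · rintro ⟨n, b, -, hb⟩
      exact ⟨b, (hRp (b, a)).2 ⟨_, hb⟩⟩

theorem REPred.forall_mem {p : β → α → Prop} (hp : REPred fun x : β × α => p x.1 x.2)
    {f : α → List β} (hf : Primrec f) : REPred fun a => ∀ b ∈ f a, p b a := by
  obtain ⟨R, hR, hRm, hRp⟩ := REPred.exists_stages hp
  refine REPred.of_exists_nat (R := fun k a => ∀ b ∈ f a, R k (b, a)) ?_ fun a => ?_
  · refine primrecPred_forall_mem (p := fun (x : ℕ × α) b => R x.1 (b, x.2))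
      (f := fun x => f x.2) ?_ (hf.comp Primrec.snd)
    exact hR.comp (f := fun y : (ℕ × α) × β => (y.1.1, (y.2, y.1.2))) (by fun_prop)
  · generalize f a = l
    induction l with
    | nil => simp
    | cons b l ih =>
      simp only [List.forall_mem_cons, ih, hRp (b, a)]
      constructor
      · rintro ⟨⟨k, hk⟩, m, hm⟩
        exact ⟨max k m, hRm _ _ _ (le_max_left _ _) hk,
          fun c hc => hRm _ _ _ (le_max_right _ _) (hm c hc)⟩
      · rintro ⟨k, h1, h2⟩
        exact ⟨⟨k, h1⟩, k, h2⟩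

theorem REPred.graph {f : α → β} (hf : Computable f) : REPred fun x : α × β => f x.1 = x.2 := by
  have h : REPred fun x : β × β => x.1 = x.2 :=
    REPred.of_primrecPred (primrecPred_eq Primrec.fst Primrec.snd)
  exact REPred.comp h ((hf.comp Computable.fst).pair Computable.snd)

/-- `{F b | P b}` is enumerable if `P` is enumerable and `F` is computable. -/
theorem REPred.image {P : β → Prop} {F : β → α} (hP : REPred P) (hF : Primrec F) :
    REPred fun a => ∃ b, P b ∧ F b = a :=
  REPred.exists (p := fun b a => P b ∧ F b = a)
    (REPred.and (REPred.comp_primrec hP Primrec.fst)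
      (REPred.of_primrecPred (primrecPred_eq (hF.comp Primrec.fst) Primrec.snd)))

theorem REPred.range {F : β → α} (hF : Primrec F) : REPred fun a => ∃ b, F b = a :=
  (REPred.image (P := fun _ => True) (REPred.of_primrecPred (PrimrecPred.of_eq
    (primrecPred_eq (Primrec.const 0) (Primrec.const 0)) (by simp))) hF).of_eq (by simp)

end RE

namespace ContLogic

/-! ### Propositional clauses -/

section Clauses

variable {α A : Type} [Primcodable α] [Primcodable A]

/-- A clause is a finite disjunction of literals: atoms, each with the truth value that it is
claimed to have. -/
abbrev Clause (A : Type) : Type := List (A × Bool)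

/-- The clause is true if exactly the atoms that satisfy `w` are true. -/
def Clause.Sat {A : Type} (w : A → Prop) (c : Clause A) : Prop := ∃ p ∈ c, p.2 = true ↔ w p.1

/-- The implication `⋀ hs → a`, where `hs` is a list of literals. -/
def Clause.imp {A : Type} (hs : List (A × Bool)) (a : A × Bool) : Clause A :=
  a :: hs.map fun p => (p.1, !p.2)

theorem Clause.sat_imp {A : Type} {w : A → Prop} {hs : List (A × Bool)} {a : A × Bool} :
    (Clause.imp hs a).Sat w ↔ ((∀ p ∈ hs, p.2 = true ↔ w p.1) → (a.2 = true ↔ w a.1)) := by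
  simp only [Clause.Sat, Clause.imp, List.mem_cons, List.mem_map, exists_eq_or_imp]
  constructor
  · rintro (h | ⟨_, ⟨p, hp, rfl⟩, h⟩) hall
    · exact h
    · have h1 := hall p hp
      rw [← h1] at h
      cases h2 : p.2 <;> simp [h2] at h
  · intro h
    by_cases hall : ∀ p ∈ hs, p.2 = true ↔ w p.1
    · exact Or.inl (h hall)
    · push Not at hall
      obtain ⟨p, hp, hpw⟩ := hall
      refine Or.inr ⟨_, ⟨p, hp, rfl⟩, ?_⟩
      cases h2 : p.2 <;> simp [h2] at hpw ⊢ <;> exact hpw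

/-- All words of length `n` over `{false, true}`. -/
def boolWords : ℕ → List (List Bool)
  | 0 => [[]]
  | n + 1 => (boolWords n).flatMap fun l => [l ++ [true], l ++ [false]]

theorem mem_boolWords {n : ℕ} {l : List Bool} : l ∈ boolWords n ↔ l.length = n := by
  induction n generalizing l with
  | zero => simp [boolWords]
  | succ n ih =>
    simp only [boolWords, List.mem_flatMap, List.mem_cons, List.not_mem_nil, or_false, ih]
    constructor
    · rintro ⟨l', rfl, rfl | rfl⟩ <;> simp
    · intro h
      obtain ⟨l', b, rfl⟩ : ∃ l' b, l = l' ++ [b] := by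
        have hne : l ≠ [] := by rintro rfl; simp at h
        exact ⟨l.dropLast, l.getLast hne, (List.dropLast_append_getLast hne).symm⟩
      refine ⟨l', by simpa using h, ?_⟩
      cases b <;> simp

theorem primrec_boolWords : Primrec boolWords := by
  refine (Primrec.nat_rec₁ [[]] (f := fun _ ls => ls.flatMap fun l => [l ++ [true], l ++ [false]])
    ?_).of_eq fun n => ?_
  · refine Primrec₂.mk ?_
    fun_prop
  · induction n with
    | zero => rfl
    | succ n ih => simp only [boolWords, ← ih]

/-- The finite partial assignment that gives the atom with code `i` the `i`-th value in `l` makes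
every literal of `c` false. -/
def Clause.FalsifiedBy (l : List Bool) (c : Clause A) : Prop :=
  ∀ p ∈ c, l[Encodable.encode p.1]? = some !p.2

/-- A set of clauses that is false under all assignments is falsified by all partial assignments
of some length, by compactness of the Cantor space. -/
theorem exists_forall_falsifiedBy {S : Set (Clause A)}
    (h : ¬ ∃ w : A → Prop, ∀ c ∈ S, c.Sat w) :
    ∃ n, ∀ l : List Bool, l.length = n → ∃ c ∈ S, c.FalsifiedBy l := by
  classical
  by_contra hn
  push Not at hn
  apply h
  let V : ℕ → Set (ℕ → Bool) := fun n =>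
    {x | ∀ c ∈ S, ¬ c.FalsifiedBy (List.ofFn fun i : Fin n => x i)}
  have hV : (⋂ n, V n).Nonempty := by
    refine IsCompact.nonempty_iInter_of_sequence_nonempty_isCompact_isClosed V ?_ ?_ ?_ ?_
    · intro n x hx c hc hf
      refine hx c hc fun p hp => ?_
      have := hf p hp
      rw [List.getElem?_ofFn] at this ⊢
      by_cases hlt : Encodable.encode p.1 < n
      · simpa [hlt, hlt.trans (Nat.lt_succ_self n)] using this
      · simp [hlt] at this
    · intro n
      obtain ⟨l, hl, hS⟩ := hn n
      refine ⟨fun i => l.getD i false, fun c hc => ?_⟩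
      have : (List.ofFn fun i : Fin n => l.getD i false) = l := by
        refine List.ext_getElem (by simp [hl]) fun i h1 h2 => by simp [h2]
      rw [this]
      exact hS c hc
    · exact (isClosed_discrete ({l | ∀ c ∈ S, ¬ c.FalsifiedBy (List.ofFn l)} :
        Set (Fin 0 → Bool))).preimage (f := fun (x : ℕ → Bool) (i : Fin 0) => x i)
        (by fun_prop) |>.isCompact
    · intro n
      exact (isClosed_discrete ({l | ∀ c ∈ S, ¬ c.FalsifiedBy (List.ofFn l)} :
        Set (Fin n → Bool))).preimage (f := fun (x : ℕ → Bool) (i : Fin n) => x i)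
        (by fun_prop)
  obtain ⟨x, hx⟩ := hV
  rw [Set.mem_iInter] at hx
  refine ⟨fun a => x (Encodable.encode a) = true, fun c hc => ?_⟩
  by_contra hsat
  -- the atoms of `c` have codes below some bound `n`
  obtain ⟨n, hlt⟩ : ∃ n, ∀ p ∈ c, Encodable.encode p.1 < n := by
    refine ⟨(c.map fun p => Encodable.encode p.1).sum + 1, fun p hp => ?_⟩
    exact Nat.lt_succ_of_le (List.le_sum_of_mem (List.mem_map.2 ⟨p, hp, rfl⟩))
  refine hx n c hc fun p hp => ?_
  have h1 : ¬ (p.2 = true ↔ x (Encodable.encode p.1) = true) := fun h => hsat ⟨p, hp, h⟩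
  rw [List.getElem?_ofFn, dif_pos (hlt p hp), Option.some_inj]
  cases h2 : p.2 <;> cases h3 : x (Encodable.encode p.1) <;> simp_all

/-- For a uniformly enumerable family of sets of clauses, unsatisfiability is an enumerable
property. -/
theorem REPred.unsat {S : α → Set (Clause A)}
    (hS : REPred fun x : α × Clause A => x.2 ∈ S x.1) :
    REPred fun a => ¬ ∃ w : A → Prop, ∀ c ∈ S a, c.Sat w := by
  have key : ∀ a, (¬ ∃ w : A → Prop, ∀ c ∈ S a, c.Sat w) ↔
      ∃ n, ∀ l ∈ boolWords n, ∃ c, c ∈ S a ∧ c.FalsifiedBy l := by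
    intro a
    constructor
    · intro h
      obtain ⟨n, hn⟩ := exists_forall_falsifiedBy h
      exact ⟨n, fun l hl => hn l (mem_boolWords.1 hl)⟩
    · rintro ⟨n, hn⟩ ⟨w, hw⟩
      classical
      obtain ⟨c, hc, hf⟩ := hn (List.ofFn fun i : Fin n =>
        decide (∃ a : A, Encodable.encode a = i ∧ w a)) (mem_boolWords.2 (by simp))
      obtain ⟨p, hp, hpw⟩ := hw c hc
      have h1 := hf p hp
      rw [List.getElem?_ofFn] at h1
      split_ifs at h1 with hlt
      have h2 : (∃ a : A, Encodable.encode a = Encodable.encode p.1 ∧ w a) ↔ w p.1 :=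
        ⟨fun ⟨a, ha, hwa⟩ => Encodable.encode_injective ha ▸ hwa, fun h => ⟨_, rfl, h⟩⟩
      simp only [Option.some_inj, h2] at h1
      by_cases h3 : w p.1 <;> simp [h3] at h1 hpw <;> simp [h1] at hpw
  refine REPred.of_eq ?_ fun a => (key a).symm
  refine REPred.exists (p := fun n a => ∀ l ∈ boolWords n, ∃ c, c ∈ S a ∧ c.FalsifiedBy l) ?_
  refine REPred.forall_mem (p := fun l (x : ℕ × α) => ∃ c, c ∈ S x.2 ∧ c.FalsifiedBy l) ?_
    (primrec_boolWords.comp Primrec.fst)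
  refine REPred.exists
    (p := fun c (x : List Bool × (ℕ × α)) => c ∈ S x.2.2 ∧ c.FalsifiedBy x.1) ?_
  refine REPred.and (REPred.comp_primrec hS
    (f := fun y : Clause A × (List Bool × (ℕ × α)) => (y.2.2.2, y.1)) (by fun_prop)) ?_
  have h : PrimrecPred fun y : Clause A × (List Bool × (ℕ × α)) =>
      ∀ p ∈ y.1, y.2.1[Encodable.encode p.1]? = some !p.2 :=
    primrecPred_forall_mem (p := fun (y : Clause A × (List Bool × (ℕ × α)))
      (p : A × Bool) => y.2.1[Encodable.encode p.1]? = some !p.2) (f := fun y => y.1)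
      (primrecPred_eq (by fun_prop) (by fun_prop))
      (by fun_prop)
  exact REPred.of_primrecPred h

end Clauses

/-! ### Arithmetic with names of rational numbers -/

theorem exists_ratOf (r : ℚ) : ∃ q, ratOf q = r := by
  refine ⟨(r.num.toNat, (-r.num).toNat, r.den - 1), ?_⟩
  have h1 : ((r.num.toNat : ℤ) : ℚ) - (((-r.num).toNat : ℤ) : ℚ) = r.num := by
    rw [← Int.cast_sub, Int.toNat_sub_toNat_neg]
  have h2 : (((r.den - 1 : ℕ) : ℚ) + 1) = r.den := by
    have := r.den_pos
    rw [Nat.cast_sub this]; simp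
  simp only [ratOf, h2]
  have h3 : ((r.num.toNat : ℚ) - ((-r.num).toNat : ℚ)) = r.num := by exact_mod_cast h1
  rw [h3, Rat.num_div_den]

/-- Addition of names. -/
def qAdd (p q : ℕ × ℕ × ℕ) : ℕ × ℕ × ℕ :=
  (p.1 * (q.2.2 + 1) + q.1 * (p.2.2 + 1), p.2.1 * (q.2.2 + 1) + q.2.1 * (p.2.2 + 1),
    (p.2.2 + 1) * (q.2.2 + 1) - 1)

theorem ratOf_qAdd (p q : ℕ × ℕ × ℕ) : ratOf (qAdd p q) = ratOf p + ratOf q := by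
  have h1 : ((((p.2.2 + 1) * (q.2.2 + 1) - 1 : ℕ) : ℚ) + 1) = (p.2.2 + 1) * (q.2.2 + 1) := by
    rw [Nat.cast_sub (Nat.succ_le_of_lt (by positivity))]; push_cast; ring
  have h2 : (p.2.2 : ℚ) + 1 ≠ 0 := by positivity
  have h3 : (q.2.2 : ℚ) + 1 ≠ 0 := by positivity
  simp only [ratOf, qAdd, h1]
  push_cast
  field_simp
  ring

/-- Negation of names. -/
def qNeg (p : ℕ × ℕ × ℕ) : ℕ × ℕ × ℕ := (p.2.1, p.1, p.2.2)

theorem ratOf_qNeg (p : ℕ × ℕ × ℕ) : ratOf (qNeg p) = - ratOf p := by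
  simp only [ratOf, qNeg]; ring

/-- A name of `a / 2 ^ m`. -/
def qDyadic (a m : ℕ) : ℕ × ℕ × ℕ := (a, 0, 2 ^ m - 1)

theorem ratOf_qDyadic (a m : ℕ) : ratOf (qDyadic a m) = a * (1 / 2) ^ m := by
  have h1 : (((2 ^ m - 1 : ℕ) : ℚ) + 1) = 2 ^ m := by
    rw [Nat.cast_sub Nat.one_le_two_pow]; simp
  simp only [ratOf, qDyadic, h1, one_div, inv_pow]
  simp [div_eq_mul_inv]

@[fun_prop]
theorem primrec_qAdd {α : Type} [Primcodable α] {f g : α → ℕ × ℕ × ℕ} (hf : Primrec f)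
    (hg : Primrec g) : Primrec fun a => qAdd (f a) (g a) := by
  unfold qAdd; fun_prop

@[fun_prop]
theorem primrec_qNeg {α : Type} [Primcodable α] {f : α → ℕ × ℕ × ℕ} (hf : Primrec f) :
    Primrec fun a => qNeg (f a) := by
  unfold qNeg; fun_prop

@[fun_prop]
theorem primrec_qDyadic {α : Type} [Primcodable α] {f g : α → ℕ} (hf : Primrec f)
    (hg : Primrec g) : Primrec fun a => qDyadic (f a) (g a) := by
  unfold qDyadic; fun_prop

theorem ratOf_lt_iff (p q : ℕ × ℕ × ℕ) : ratOf p < ratOf q ↔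
    p.1 * (q.2.2 + 1) + q.2.1 * (p.2.2 + 1) < q.1 * (p.2.2 + 1) + p.2.1 * (q.2.2 + 1) := by
  have h2 : (0 : ℚ) < p.2.2 + 1 := by positivity
  have h3 : (0 : ℚ) < q.2.2 + 1 := by positivity
  rw [ratOf, ratOf, div_lt_div_iff₀ h2 h3, ← Nat.cast_lt (α := ℚ)]
  push_cast
  constructor <;> intro h <;> linarith

theorem REPred.ratOf_lt {α : Type} [Primcodable α] {f g : α → ℕ × ℕ × ℕ} (hf : Primrec f)
    (hg : Primrec g) : REPred fun a => ratOf (f a) < ratOf (g a) := by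
  simp only [ratOf_lt_iff]
  refine REPred.of_primrecPred (primrecPred_lt ?_ ?_) <;> fun_prop

/-! ### Gödel numbers of universal sentences -/

section WellFormed

variable (C : Connectives) (L : MetricLanguage)

/-- Statements about a number in a context: that it is the code of a term of a given sort, of a
quantifier-free formula (`inr false`) or of a universal formula (`inr true`). -/
abbrev WfAtom : Type := List L.Srt × (L.Srt ⊕ Bool) × ℕ

variable {L}

/-- The intended meaning of the atoms. -/
def WfAtom.Holds : WfAtom L → Prop
  | (Γ, .inl s, n) => ∃ t : Term L Γ s, t.code = n
  | (Γ, .inr false, n) => ∃ φ : Formula C L Γ, φ.IsQF ∧ φ.code = n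
  | (Γ, .inr true, n) => ∃ φ : Formula C L Γ, φ.IsUniversal ∧ φ.code = n

/-- The rules of formation, as Horn clauses. -/
inductive WfAx : Clause (WfAtom L) → Prop
  | var (Γ : List L.Srt) (s : L.Srt) (i : ℕ) (h : Γ[i]? = some s) :
      WfAx (Clause.imp [] ((Γ, .inl s, Nat.pair 0 i), true))
  | func (Γ : List L.Srt) (f : L.Fn) (s : L.Srt) (l : List (L.Srt × ℕ))
      (h : L.fnDom f = l.map fun p => p.1) (hs : L.fnCod f = s) :
      WfAx (Clause.imp (l.map fun p => ((Γ, .inl p.1, p.2), true)) ((Γ, .inl s,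
        Nat.pair 1 (Nat.pair (Encodable.encode f) (Encodable.encode (l.map fun p => p.2)))), true))
  | dist (Γ : List L.Srt) (s : L.Srt) (t₁ t₂ : ℕ) :
      WfAx (Clause.imp [((Γ, .inl s, t₁), true), ((Γ, .inl s, t₂), true)] ((Γ, .inr false,
        Nat.pair 0 (Nat.pair (Encodable.encode s) (Nat.pair t₁ t₂))), true))
  | rel (Γ : List L.Srt) (R : L.Rel) (l : List (L.Srt × ℕ)) (h : L.relDom R = l.map fun p => p.1) :
      WfAx (Clause.imp (l.map fun p => ((Γ, .inl p.1, p.2), true)) ((Γ, .inr false,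
        Nat.pair 1 (Nat.pair (Encodable.encode R) (Encodable.encode (l.map fun p => p.2)))), true))
  | conn (Γ : List L.Srt) (n : ℕ) (l : List ℕ) (h : (C.u n).1 = l.length) :
      WfAx (Clause.imp (l.map fun m => ((Γ, .inr false, m), true)) ((Γ, .inr false,
        Nat.pair 2 (Nat.pair n (Encodable.encode l))), true))
  | qf (Γ : List L.Srt) (n : ℕ) :
      WfAx (Clause.imp [((Γ, .inr false, n), true)] ((Γ, .inr true, n), true))
  | sup (Γ : List L.Srt) (s : L.Srt) (n : ℕ) :
      WfAx (Clause.imp [((s :: Γ, .inr true, n), true)] ((Γ, .inr true,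
        Nat.pair 3 (Nat.pair (Encodable.encode s) n)), true))

@[fun_prop]
theorem primrec_imp {α A : Type} [Primcodable α] [Primcodable A] {f : α → List (A × Bool)}
    {g : α → A × Bool} (hf : Primrec f) (hg : Primrec g) :
    Primrec fun a => Clause.imp (f a) (g a) := by
  unfold Clause.imp; fun_prop

variable {C}

theorem rePred_wfAx (hL : L.IsComputable) : REPred fun c : Clause (WfAtom L) => WfAx C c := by
  have h1 := REPred.image (α := Clause (WfAtom L))
    (P := fun p : List L.Srt × L.Srt × ℕ => p.1[p.2.2]? = some p.2.1)
    (F := fun p => Clause.imp [] ((p.1, .inl p.2.1, Nat.pair 0 p.2.2), true))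
    (REPred.of_primrecPred (primrecPred_eq (by fun_prop) (by fun_prop))) (by fun_prop)
  have h2 := REPred.image (α := Clause (WfAtom L))
    (P := fun p : List L.Srt × L.Fn × L.Srt × List (L.Srt × ℕ) =>
      L.fnDom p.2.1 = p.2.2.2.map (fun p => p.1) ∧ L.fnCod p.2.1 = p.2.2.1)
    (F := fun p => Clause.imp (p.2.2.2.map fun q => ((p.1, .inl q.1, q.2), true))
      ((p.1, .inl p.2.2.1, Nat.pair 1 (Nat.pair (Encodable.encode p.2.1)
        (Encodable.encode (p.2.2.2.map fun p => p.2)))), true))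
    (REPred.and ((REPred.graph hL.fnDom).comp_primrec (f := fun p : List L.Srt × L.Fn × L.Srt ×
        List (L.Srt × ℕ) => (p.2.1, p.2.2.2.map fun p => p.1)) (by fun_prop))
      ((REPred.graph hL.fnCod).comp_primrec (f := fun p : List L.Srt × L.Fn × L.Srt ×
        List (L.Srt × ℕ) => (p.2.1, p.2.2.1)) (by fun_prop))) (by fun_prop)
  have h3 := REPred.range (α := Clause (WfAtom L))
    (F := fun p : List L.Srt × L.Srt × ℕ × ℕ =>
      Clause.imp [((p.1, .inl p.2.1, p.2.2.1), true), ((p.1, .inl p.2.1, p.2.2.2), true)]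
        ((p.1, .inr false, Nat.pair 0 (Nat.pair (Encodable.encode p.2.1)
          (Nat.pair p.2.2.1 p.2.2.2))), true)) (by fun_prop)
  have h4 := REPred.image (α := Clause (WfAtom L))
    (P := fun p : List L.Srt × L.Rel × List (L.Srt × ℕ) =>
      L.relDom p.2.1 = p.2.2.map (fun p => p.1))
    (F := fun p => Clause.imp (p.2.2.map fun q => ((p.1, .inl q.1, q.2), true))
      ((p.1, .inr false, Nat.pair 1 (Nat.pair (Encodable.encode p.2.1)
        (Encodable.encode (p.2.2.map fun p => p.2)))), true))
    ((REPred.graph hL.relDom).comp_primrec (f := fun p : List L.Srt × L.Rel × List (L.Srt × ℕ) =>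
      (p.2.1, p.2.2.map fun p => p.1)) (by fun_prop)) (by fun_prop)
  have h5 := REPred.image (α := Clause (WfAtom L))
    (P := fun p : List L.Srt × ℕ × List ℕ => (C.u p.2.1).1 = p.2.2.length)
    (F := fun p => Clause.imp (p.2.2.map fun m => ((p.1, .inr false, m), true))
      ((p.1, .inr false, Nat.pair 2 (Nat.pair p.2.1 (Encodable.encode p.2.2))), true))
    ((REPred.graph C.computable_arity).comp_primrec (f := fun p : List L.Srt × ℕ × List ℕ =>
      (p.2.1, p.2.2.length)) (by fun_prop)) (by fun_prop)
  have h6 := REPred.range (α := Clause (WfAtom L)) (F := fun p : List L.Srt × ℕ =>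
    Clause.imp [((p.1, .inr false, p.2), true)] ((p.1, .inr true, p.2), true)) (by fun_prop)
  have h7 := REPred.range (α := Clause (WfAtom L)) (F := fun p : List L.Srt × L.Srt × ℕ =>
    Clause.imp [((p.2.1 :: p.1, .inr true, p.2.2), true)] ((p.1, .inr true,
      Nat.pair 3 (Nat.pair (Encodable.encode p.2.1) p.2.2)), true)) (by fun_prop)
  refine (h1.or (h2.or (h3.or (h4.or (h5.or (h6.or h7)))))).of_eq fun c => ⟨?_, ?_⟩
  · rintro (⟨p, h, rfl⟩ | ⟨p, h, rfl⟩ | ⟨p, rfl⟩ | ⟨p, h, rfl⟩ | ⟨p, h, rfl⟩ | ⟨p, rfl⟩ | ⟨p, rfl⟩)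
    · exact .var _ _ _ h
    · exact .func _ _ _ _ h.1 h.2
    · exact .dist _ _ _ _
    · exact .rel _ _ _ h
    · exact .conn _ _ _ h
    · exact .qf _ _
    · exact .sup _ _ _
  · rintro (⟨Γ, s, i, h⟩ | ⟨Γ, f, s, l, h, h'⟩ | ⟨Γ, s, t₁, t₂⟩ | ⟨Γ, R, l, h⟩ | ⟨Γ, n, l, h⟩ |
      ⟨Γ, n⟩ | ⟨Γ, s, n⟩)
    · exact .inl ⟨(Γ, s, i), h, rfl⟩
    · exact .inr (.inl ⟨(Γ, f, s, l), ⟨h, h'⟩, rfl⟩)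
    · exact .inr (.inr (.inl ⟨(Γ, s, t₁, t₂), rfl⟩))
    · exact .inr (.inr (.inr (.inl ⟨(Γ, R, l), h, rfl⟩)))
    · exact .inr (.inr (.inr (.inr (.inl ⟨(Γ, n, l), h, rfl⟩))))
    · exact .inr (.inr (.inr (.inr (.inr (.inl ⟨(Γ, n), rfl⟩)))))
    · exact .inr (.inr (.inr (.inr (.inr (.inr ⟨(Γ, s, n), rfl⟩)))))

theorem exists_terms_of_codes {Γ Δ : List L.Srt} {l : List (L.Srt × ℕ)}
    (h : Δ = l.map fun p => p.1) (hl : ∀ p ∈ l, ∃ t : Term L Γ p.1, t.code = p.2) :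
    ∃ ts : (i : Fin Δ.length) → Term L Γ (Δ.get i),
      (List.ofFn fun i => (ts i).code) = l.map fun p => p.2 := by
  subst h
  have key : ∀ i : Fin (l.map fun p => p.1).length,
      ∃ t : Term L Γ ((l.map fun p => p.1).get i), t.code = (l[i.1]'(by simpa using i.2)).2 := by
    intro i
    have h1 : (l[i.1]'(by simpa using i.2)).1 = (l.map fun p => p.1).get i := by simp
    obtain ⟨t, ht⟩ := hl _ (List.getElem_mem (by simpa using i.2 : i.1 < l.length))
    rw [← h1]
    exact ⟨t, ht⟩
  choose ts hts using key
  refine ⟨ts, List.ext_getElem (by simp) fun i h1 h2 => ?_⟩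
  simp [hts]

/-- Soundness of the rules of formation: what they produce are codes. -/
theorem wfAtom_holds_sat {c : Clause (WfAtom L)} (hc : WfAx C c) : c.Sat (WfAtom.Holds C) := by
  induction hc with
  | var Γ s i h =>
    rw [Clause.sat_imp]
    intro _
    obtain ⟨hi, rfl⟩ := List.getElem?_eq_some_iff.1 h
    exact iff_of_true rfl ⟨.var ⟨i, hi⟩, by simp [Term.code]⟩
  | func Γ f s l h hs =>
    rw [Clause.sat_imp]
    intro hl
    subst hs
    obtain ⟨ts, hts⟩ := exists_terms_of_codes (Γ := Γ) h fun p hp =>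
      (hl _ (List.mem_map.2 ⟨p, hp, rfl⟩)).1 rfl
    exact iff_of_true rfl ⟨.func f ts, by simp only [Term.code, hts]⟩
  | dist Γ s t₁ t₂ =>
    rw [Clause.sat_imp]
    intro hl
    obtain ⟨u₁, rfl⟩ := (hl ((Γ, .inl s, t₁), true) (by simp)).1 rfl
    obtain ⟨u₂, rfl⟩ := (hl ((Γ, .inl s, t₂), true) (by simp)).1 rfl
    exact iff_of_true rfl ⟨.dist s u₁ u₂, .dist s u₁ u₂, rfl⟩
  | rel Γ R l h =>
    rw [Clause.sat_imp]
    intro hl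
    obtain ⟨ts, hts⟩ := exists_terms_of_codes (Γ := Γ) h fun p hp =>
      (hl _ (List.mem_map.2 ⟨p, hp, rfl⟩)).1 rfl
    exact iff_of_true rfl ⟨.rel R ts, .rel R ts, by simp only [Formula.code, hts]⟩
  | conn Γ n l h =>
    rw [Clause.sat_imp]
    intro hl
    have key : ∀ i : Fin (C.u n).1, ∃ φ : Formula C L Γ, φ.IsQF ∧ φ.code = l[i.1]'(h ▸ i.2) :=
      fun i => (hl _ (List.mem_map.2 ⟨_, List.getElem_mem _, rfl⟩)).1 rfl
    choose φs hφ hcode using key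
    refine iff_of_true rfl ⟨.conn n φs, .conn n φs hφ, ?_⟩
    have h1 : (List.ofFn fun i => (φs i).code) = l :=
      List.ext_getElem (by simp [h]) fun i h1 h2 => by simp [hcode]
    simp only [Formula.code, h1]
  | qf Γ n =>
    rw [Clause.sat_imp]
    intro hl
    obtain ⟨φ, hφ, rfl⟩ := (hl ((Γ, .inr false, n), true) (by simp)).1 rfl
    exact iff_of_true rfl ⟨φ, .qf φ hφ, rfl⟩
  | sup Γ s n =>
    rw [Clause.sat_imp]
    intro hl
    obtain ⟨φ, hφ, rfl⟩ := (hl ((s :: Γ, .inr true, n), true) (by simp)).1 rfl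
    exact iff_of_true rfl ⟨.sup s φ, .sup s φ hφ, rfl⟩

theorem sat_term {w : WfAtom L → Prop} (hw : ∀ c, WfAx C c → c.Sat w)
    {Γ : List L.Srt} {s : L.Srt} (t : Term L Γ s) : w (Γ, .inl s, t.code) := by
  induction t with
  | var i => exact (Clause.sat_imp.1 (hw _ (.var Γ _ i (by simp))) (by simp)).1 rfl
  | func f ts ih =>
    have h := Clause.sat_imp.1 (hw _ (.func Γ f _
      (List.ofFn fun i => ((L.fnDom f).get i, (ts i).code))
      (by simp [List.map_ofFn, Function.comp_def]) rfl))
    have h1 : ((List.ofFn fun i => ((L.fnDom f).get i, (ts i).code)).map fun p => p.2) =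
        List.ofFn fun i => (ts i).code := by simp [List.map_ofFn, Function.comp_def]
    rw [h1] at h
    refine (h fun p hp => ?_).1 rfl
    simp only [List.mem_map, List.mem_ofFn] at hp
    obtain ⟨_, ⟨i, rfl⟩, rfl⟩ := hp
    exact iff_of_true rfl (ih i)

theorem sat_qf {w : WfAtom L → Prop} (hw : ∀ c, WfAx C c → c.Sat w)
    {Γ : List L.Srt} {φ : Formula C L Γ} (hφ : φ.IsQF) :
    w (Γ, .inr false, φ.code) := by
  induction hφ with
  | dist s t₁ t₂ =>
    refine (Clause.sat_imp.1 (hw _ (.dist _ s t₁.code t₂.code)) ?_).1 rfl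
    simp [sat_term hw]
  | rel R ts =>
    have h := Clause.sat_imp.1 (hw _ (.rel Γ R
      (List.ofFn fun i => ((L.relDom R).get i, (ts i).code))
      (by simp [List.map_ofFn, Function.comp_def])))
    have h1 : ((List.ofFn fun i => ((L.relDom R).get i, (ts i).code)).map fun p => p.2) =
        List.ofFn fun i => (ts i).code := by simp [List.map_ofFn, Function.comp_def]
    rw [h1] at h
    refine (h fun p hp => ?_).1 rfl
    simp only [List.mem_map, List.mem_ofFn] at hp
    obtain ⟨_, ⟨i, rfl⟩, rfl⟩ := hp
    exact iff_of_true rfl (sat_term hw (ts i))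
  | conn n φs hφ ih =>
    refine (Clause.sat_imp.1 (hw _ (.conn _ n (List.ofFn fun i => (φs i).code) (by simp)))
      fun p hp => ?_).1 rfl
    simp only [List.mem_map, List.mem_ofFn] at hp
    obtain ⟨_, ⟨i, rfl⟩, rfl⟩ := hp
    exact iff_of_true rfl (ih i)

/-- Completeness of the rules of formation: a truth assignment that satisfies them holds at all
codes of universal formulas. -/
theorem sat_universal {w : WfAtom L → Prop} (hw : ∀ c, WfAx C c → c.Sat w)
    {Γ : List L.Srt} {φ : Formula C L Γ} (hφ : φ.IsUniversal) :
    w (Γ, .inr true, φ.code) := by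
  induction hφ with
  | qf φ h => exact (Clause.sat_imp.1 (hw _ (.qf _ φ.code)) (by simp [sat_qf hw h])).1 rfl
  | sup s φ h ih => exact (Clause.sat_imp.1 (hw _ (.sup _ s φ.code)) (by simp [ih])).1 rfl

/-- The set of codes of universal sentences is enumerable: membership is a consequence of the Horn
clauses `WfAx`. -/
theorem rePred_universal_sentence (hL : L.IsComputable) :
    REPred fun n : ℕ => ∃ σ : Sentence C L, σ.IsUniversal ∧ σ.code = n := by
  have h := REPred.unsat (α := ℕ) (A := WfAtom L)
    (S := fun n => {c | WfAx C c ∨ [(([], .inr true, n), false)] = c})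
    (((rePred_wfAx hL).comp_primrec Primrec.snd).or
      (REPred.of_primrecPred (primrecPred_eq (by fun_prop) (by fun_prop))))
  refine h.of_eq fun n => ⟨fun hn => ?_, ?_⟩
  · by_contra hno
    refine hn ⟨WfAtom.Holds C, ?_⟩
    rintro c (hc | rfl)
    · exact wfAtom_holds_sat hc
    · exact ⟨_, List.mem_singleton_self _, iff_of_false (by simp) hno⟩
  · rintro ⟨σ, hσ, rfl⟩ ⟨w, hw⟩
    obtain ⟨p, hp, hpw⟩ := hw _ (.inr rfl)
    rw [List.mem_singleton] at hp
    subst hp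
    exact absurd (hpw.2 (sat_universal (fun c hc => hw c (.inl hc)) hσ)) (by simp)

end WellFormed

/-! ### Evaluation of Gödel numbers -/

section Raw

theorem lt_encode_of_mem {l : List ℕ} {x : ℕ} (hx : x ∈ l) : x < Encodable.encode l := by
  induction l with
  | nil => simp at hx
  | cons a l ih =>
    rw [Encodable.encode_list_cons]
    rcases List.mem_cons.1 hx with rfl | hx
    · exact Nat.lt_succ_of_le (Nat.left_le_pair _ _)
    · exact Nat.lt_succ_of_le ((ih hx).le.trans (Nat.right_le_pair _ _))

theorem lt_of_mem_ofNat_list {n x : ℕ} (h : x ∈ Denumerable.ofNat (List ℕ) n) : x < n := by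
  simpa using lt_encode_of_mem h

theorem unpair_snd_lt {n : ℕ} (h : n.unpair.1 ≠ 0) : n.unpair.2 < n := by
  conv_rhs => rw [← Nat.pair_unpair n]
  rw [Nat.pair]
  split_ifs with h1
  · have h2 : n.unpair.2 * 1 ≤ n.unpair.2 * n.unpair.2 := Nat.mul_le_mul_left _ (by omega)
    omega
  · have : 0 < n.unpair.1 * n.unpair.1 := by positivity
    omega

variable {L : MetricLanguage} (M : MetricStructure.{u} L)

/-- Simultaneous elements of all sorts. They serve as untyped values: an argument of sort `s`
uses the component at `s`. -/
abbrev Point : Type u := ∀ s, M.carrier s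

/-- A fixed default point. -/
def defaultPoint : Point M := fun _ => Classical.arbitrary _

/-- The result of a function symbol, at the sort of its values; the other components are
defaults. Missing arguments are replaced by the default point. -/
def fnPoint (f : L.Fn) (l : List (Point M)) : Point M := by
  classical
  exact fun s => if h : L.fnCod f = s then
    h ▸ M.fn f fun i => l.getD i (defaultPoint M) ((L.fnDom f).get i) else defaultPoint M s

theorem fnPoint_cod (f : L.Fn) (l : List (Point M)) : fnPoint M f l (L.fnCod f) =
    M.fn f fun i => l.getD i (defaultPoint M) ((L.fnDom f).get i) := by
  simp [fnPoint]

/-- The value of a predicate symbol at a list of points. -/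
def relPoint (R : L.Rel) (l : List (Point M)) : ℝ :=
  M.rel R fun i => l.getD i (defaultPoint M) ((L.relDom R).get i)

/-- The value of the term with code `n`, when the variables have the values `ρ`. The numbers that
are not codes of terms have values, too. -/
def rawTerm (n : ℕ) (ρ : List (Point M)) : Point M :=
  if n.unpair.1 = 0 then ρ.getD n.unpair.2 (defaultPoint M)
  else
    match Encodable.decode (α := L.Fn) n.unpair.2.unpair.1 with
    | none => defaultPoint M
    | some f => fnPoint M f
        ((Denumerable.ofNat (List ℕ) n.unpair.2.unpair.2).attach.map fun t => rawTerm t.1 ρ)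
termination_by n
decreasing_by
  exact (lt_of_mem_ofNat_list t.2).trans_le
    ((Nat.unpair_right_le _).trans (Nat.unpair_right_le _))

theorem rawTerm_var (i : ℕ) (ρ : List (Point M)) :
    rawTerm M (Nat.pair 0 i) ρ = ρ.getD i (defaultPoint M) := by
  rw [rawTerm]; simp

theorem rawTerm_func (f : L.Fn) (ts : List ℕ) (ρ : List (Point M)) :
    rawTerm M (Nat.pair 1 (Nat.pair (Encodable.encode f) (Encodable.encode ts))) ρ =
      fnPoint M f (ts.map fun t => rawTerm M t ρ) := by
  rw [rawTerm]
  simp [Denumerable.ofNat_encode]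

variable (C : Connectives)

/-- The value of the formula with code `n`, when the variables have the values `ρ`. The numbers
that are not codes of formulas have values, too. -/
def rawVal (n : ℕ) (ρ : List (Point M)) : ℝ :=
  if n.unpair.1 = 0 then
    match Encodable.decode (α := L.Srt) n.unpair.2.unpair.1 with
    | none => 0
    | some s => dist (rawTerm M n.unpair.2.unpair.2.unpair.1 ρ s)
        (rawTerm M n.unpair.2.unpair.2.unpair.2 ρ s)
  else if n.unpair.1 = 1 then
    match Encodable.decode (α := L.Rel) n.unpair.2.unpair.1 with
    | none => 0
    | some R => relPoint M R
        ((Denumerable.ofNat (List ℕ) n.unpair.2.unpair.2).map fun t => rawTerm M t ρ)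
  else if n.unpair.1 = 2 then
    (C.u n.unpair.2.unpair.1).2 fun i =>
      ((Denumerable.ofNat (List ℕ) n.unpair.2.unpair.2).attach.map fun m =>
        rawVal m.1 ρ).getD i 0
  else if _ : n.unpair.1 = 3 then ⨆ a : Point M, rawVal n.unpair.2.unpair.2 (a :: ρ)
  else if _ : n.unpair.1 = 4 then ⨅ a : Point M, rawVal n.unpair.2.unpair.2 (a :: ρ)
  else 0
termination_by n
decreasing_by
  · exact (lt_of_mem_ofNat_list m.2).trans_le
      ((Nat.unpair_right_le _).trans (Nat.unpair_right_le _))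
  · exact (Nat.unpair_right_le _).trans_lt (unpair_snd_lt (by omega))
  · exact (Nat.unpair_right_le _).trans_lt (unpair_snd_lt (by omega))

theorem rawVal_dist (s : L.Srt) (t₁ t₂ : ℕ) (ρ : List (Point M)) :
    rawVal M C (Nat.pair 0 (Nat.pair (Encodable.encode s) (Nat.pair t₁ t₂))) ρ =
      dist (rawTerm M t₁ ρ s) (rawTerm M t₂ ρ s) := by
  rw [rawVal]; simp

theorem rawVal_rel (R : L.Rel) (ts : List ℕ) (ρ : List (Point M)) :
    rawVal M C (Nat.pair 1 (Nat.pair (Encodable.encode R) (Encodable.encode ts))) ρ =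
      relPoint M R (ts.map fun t => rawTerm M t ρ) := by
  rw [rawVal]; simp

theorem rawVal_conn (n : ℕ) (l : List ℕ) (ρ : List (Point M)) :
    rawVal M C (Nat.pair 2 (Nat.pair n (Encodable.encode l))) ρ =
      (C.u n).2 fun i => (l.map fun m => rawVal M C m ρ).getD i 0 := by
  have key : ∀ (k : ℕ) (l' : List ℕ), k = n → l' = l →
      ((C.u k).2 fun i => (l'.attach.map fun m => rawVal M C m.1 ρ).getD i 0) =
        (C.u n).2 fun i => (l.map fun m => rawVal M C m ρ).getD i 0 := by
    rintro k l' rfl rfl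
    simp
  rw [rawVal, if_neg (by simp), if_neg (by simp), if_pos (by simp)]
  exact key _ _ (by simp) (by simp)

theorem rawVal_sup (s φ : ℕ) (ρ : List (Point M)) :
    rawVal M C (Nat.pair 3 (Nat.pair s φ)) ρ = ⨆ a : Point M, rawVal M C φ (a :: ρ) := by
  rw [rawVal]; simp

theorem rawVal_inf (s φ : ℕ) (ρ : List (Point M)) :
    rawVal M C (Nat.pair 4 (Nat.pair s φ)) ρ = ⨅ a : Point M, rawVal M C φ (a :: ρ) := by
  rw [rawVal]; simp

theorem Connectives.exists_bound (n : ℕ) (B : ℝ) :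
    ∃ D : ℝ, ∀ x : Fin (C.u n).1 → ℝ, (∀ i, |x i| ≤ B) → |(C.u n).2 x| ≤ D := by
  have hK : IsCompact (Set.pi Set.univ fun _ : Fin (C.u n).1 => Set.Icc (-B) B) :=
    isCompact_univ_pi fun _ => isCompact_Icc
  obtain ⟨D, hD⟩ := hK.exists_bound_of_continuousOn (C.continuous_u n).continuousOn
  exact ⟨D, fun x hx => hD x fun i _ => abs_le.1 (hx i)⟩

/-- The boundedness of the values makes the suprema and infima in `rawVal` genuine ones. -/
theorem exists_rawVal_bound (n : ℕ) : ∃ B : ℝ, ∀ ρ, |rawVal M C n ρ| ≤ B := by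
  induction n using Nat.strong_induction_on with
  | _ n ih =>
  have : Nonempty (Point M) := ⟨defaultPoint M⟩
  by_cases h0 : n.unpair.1 = 0
  · rcases hs : Encodable.decode (α := L.Srt) n.unpair.2.unpair.1 with _ | s
    · refine ⟨0, fun ρ => ?_⟩
      rw [rawVal, if_pos h0, hs]; simp
    · refine ⟨L.diam s, fun ρ => ?_⟩
      rw [rawVal, if_pos h0, hs]
      simpa only [abs_of_nonneg dist_nonneg] using M.dist_le_diam s _ _
  by_cases h1 : n.unpair.1 = 1
  · rcases hR : Encodable.decode (α := L.Rel) n.unpair.2.unpair.1 with _ | R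
    · refine ⟨0, fun ρ => ?_⟩
      rw [rawVal, if_neg h0, if_pos h1, hR]; simp
    · refine ⟨max |(L.relLo R : ℝ)| |(L.relHi R : ℝ)|, fun ρ => ?_⟩
      rw [rawVal, if_neg h0, if_pos h1, hR]
      exact abs_le_max_abs_abs (M.rel_mem R _).1 (M.rel_mem R _).2
  by_cases h2 : n.unpair.1 = 2
  · have key : ∀ l : List ℕ, (∀ m ∈ l, m < n) →
        ∃ B : ℝ, ∀ ρ, ∀ i, |(l.map fun m => rawVal M C m ρ).getD i 0| ≤ B := by
      intro l
      induction l with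
      | nil => exact fun _ => ⟨0, by simp⟩
      | cons m l ihl =>
        intro hl
        obtain ⟨B₁, h₁⟩ := ih m (hl m (by simp))
        obtain ⟨B₂, h₂⟩ := ihl fun k hk => hl k (by simp [hk])
        refine ⟨max B₁ B₂, fun ρ i => ?_⟩
        rcases i with _ | i
        · simpa using Or.inl (h₁ ρ)
        · simpa using Or.inr (by simpa using h₂ ρ i)
    obtain ⟨B, hB⟩ := key (Denumerable.ofNat (List ℕ) n.unpair.2.unpair.2) fun m hm =>
      (lt_of_mem_ofNat_list hm).trans_le
        ((Nat.unpair_right_le _).trans (Nat.unpair_right_le _))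
    obtain ⟨D, hD⟩ := C.exists_bound n.unpair.2.unpair.1 B
    refine ⟨D, fun ρ => ?_⟩
    rw [rawVal, if_neg h0, if_neg h1, if_pos h2]
    refine hD _ fun i => ?_
    simpa using hB ρ i
  by_cases h3 : n.unpair.1 = 3
  · obtain ⟨B, hB⟩ := ih n.unpair.2.unpair.2
      ((Nat.unpair_right_le _).trans_lt (unpair_snd_lt (by omega)))
    refine ⟨B, fun ρ => ?_⟩
    rw [rawVal, if_neg h0, if_neg h1, if_neg h2, dif_pos h3]
    refine abs_le.2 ⟨?_, ciSup_le fun a => (abs_le.1 (hB _)).2⟩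
    exact le_ciSup_of_le ⟨B, by rintro _ ⟨a, rfl⟩; exact (abs_le.1 (hB _)).2⟩ (defaultPoint M)
      (abs_le.1 (hB _)).1
  by_cases h4 : n.unpair.1 = 4
  · obtain ⟨B, hB⟩ := ih n.unpair.2.unpair.2
      ((Nat.unpair_right_le _).trans_lt (unpair_snd_lt (by omega)))
    refine ⟨B, fun ρ => ?_⟩
    rw [rawVal, if_neg h0, if_neg h1, if_neg h2, dif_neg h3, dif_pos h4]
    refine abs_le.2 ⟨le_ciInf fun a => (abs_le.1 (hB _)).1, ?_⟩
    exact ciInf_le_of_le ⟨-B, by rintro _ ⟨a, rfl⟩; exact (abs_le.1 (hB _)).1⟩ (defaultPoint M)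
      (abs_le.1 (hB _)).2
  · refine ⟨0, fun ρ => ?_⟩
    rw [rawVal, if_neg h0, if_neg h1, if_neg h2, dif_neg h3, dif_neg h4]; simp

theorem bddAbove_range_rawVal (n : ℕ) (ρ : List (Point M)) :
    BddAbove (Set.range fun a : Point M => rawVal M C n (a :: ρ)) := by
  obtain ⟨B, hB⟩ := exists_rawVal_bound M C n
  exact ⟨B, by rintro _ ⟨a, rfl⟩; exact (abs_le.1 (hB _)).2⟩

theorem bddBelow_range_rawVal (n : ℕ) (ρ : List (Point M)) :
    BddBelow (Set.range fun a : Point M => rawVal M C n (a :: ρ)) := by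
  obtain ⟨B, hB⟩ := exists_rawVal_bound M C n
  exact ⟨-B, by rintro _ ⟨a, rfl⟩; exact (abs_le.1 (hB _)).1⟩

variable {M C}

theorem rawTerm_code {Γ : List L.Srt} {ρ : List (Point M)} {v : Tuple M.carrier Γ}
    (hρ : ∀ i : Fin Γ.length, ρ.getD i (defaultPoint M) (Γ.get i) = v i) {s : L.Srt}
    (t : Term L Γ s) : rawTerm M t.code ρ s = t.eval M v := by
  induction t with
  | var i => rw [Term.code, rawTerm_var]; exact hρ i
  | func f ts ih =>
    rw [Term.code, rawTerm_func, fnPoint_cod, Term.eval]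
    congr 1
    funext i
    rw [← ih i]
    simp

theorem getD_cons_point {Γ : List L.Srt} {ρ : List (Point M)} {v : Tuple M.carrier Γ}
    (hρ : ∀ i : Fin Γ.length, ρ.getD i (defaultPoint M) (Γ.get i) = v i) {s : L.Srt}
    (a : Point M) (i : Fin (s :: Γ).length) :
    (a :: ρ).getD i (defaultPoint M) ((s :: Γ).get i) =
      Tuple.cons (X := M.carrier) (a s) v i := by
  obtain ⟨i, hi⟩ := i
  cases i with
  | zero => rfl
  | succ i => exact hρ ⟨i, _⟩

theorem surjective_point_apply (s : L.Srt) : Function.Surjective fun a : Point M => a s := by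
  classical
  exact fun x => ⟨Function.update (defaultPoint M) s x, by simp⟩

/-- At codes of formulas, `rawVal` is the value of the formula. A point has components of all sorts,
so a quantifier over points is one over the component that the formula uses. -/
theorem rawVal_code {Γ : List L.Srt} (φ : Formula C L Γ) {ρ : List (Point M)}
    {v : Tuple M.carrier Γ}
    (hρ : ∀ i : Fin Γ.length, ρ.getD i (defaultPoint M) (Γ.get i) = v i) :
    rawVal M C φ.code ρ = φ.eval M v := by
  induction φ generalizing ρ with
  | dist s t₁ t₂ => rw [Formula.code, rawVal_dist, rawTerm_code hρ, rawTerm_code hρ, Formula.eval]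
  | rel R ts =>
    rw [Formula.code, rawVal_rel, Formula.eval, relPoint]
    congr 1
    funext i
    rw [← rawTerm_code hρ]
    simp
  | conn n φs ih =>
    rw [Formula.code, rawVal_conn, Formula.eval]
    refine congrArg _ (funext fun i => ?_)
    rw [← ih i hρ]
    simp
  | sup s φ ih =>
    rw [Formula.code, rawVal_sup, Formula.eval]
    exact (surjective_point_apply s).iSup_congr _ fun a => (ih (getD_cons_point hρ a)).symm
  | inf s φ ih =>
    rw [Formula.code, rawVal_inf, Formula.eval]
    exact (surjective_point_apply s).iInf_congr _ fun a => (ih (getD_cons_point hρ a)).symm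

theorem rawVal_sentence (σ : Sentence C L) : rawVal M C σ.code [] = Sentence.value M σ :=
  rawVal_code σ fun i => i.elim0

theorem Formula.exists_eval_bound (N : MetricStructure.{u} L) {Γ : List L.Srt}
    (φ : Formula C L Γ) : ∃ B : ℝ, ∀ v : Tuple N.carrier Γ, |φ.eval N v| ≤ B := by
  obtain ⟨B, hB⟩ := exists_rawVal_bound N C φ.code
  refine ⟨B, fun v => ?_⟩
  choose g hg using fun i : Fin Γ.length => surjective_point_apply (M := N) (Γ.get i) (v i)
  rw [← rawVal_code φ (ρ := List.ofFn g)]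
  · exact hB _
  · intro i
    rw [← hg i]
    simp

end Raw

/-! ### The Henkin axioms -/

/-- Approximations to the values of the connectives at rational points: for the `n`-th connective
at the point with the list of names `q`, up to `1 / 2 ^ m`, the argument is `(n, q, m)`. -/
def Connectives.approx (C : Connectives) : ℕ × List (ℕ × ℕ × ℕ) × ℕ → ℕ × ℕ × ℕ :=
  C.computable_values.choose

/-- Moduli of uniform continuity of the connectives on boxes: for the `n`-th connective on the box
`[-B, B]^k` and the precision `1 / 2 ^ m`, the argument is `(n, B, m)`. -/
def Connectives.modulus (C : Connectives) : ℕ × ℕ × ℕ → ℕ := C.computable_modulus.choose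

theorem Connectives.computable_approx (C : Connectives) : Computable C.approx :=
  C.computable_values.choose_spec.1

theorem Connectives.computable_mod (C : Connectives) : Computable C.modulus :=
  C.computable_modulus.choose_spec.1

section Axioms

variable (C : Connectives) (L : MetricLanguage)

/-- The ways to form a name of a point: `inl t` is the value of the term with code `t`,
`inr (inl f)` is the result of the function symbol `f`, and `inr (inr (b, φ, q))` is a Henkin
witness, namely for a value of `φ` that is greater than `q` if `b` is true, and for a value that is
at most `q` if `b` is false. -/
abbrev Head : Type := ℕ ⊕ L.Fn ⊕ (Bool × ℕ × (ℕ × ℕ × ℕ))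

/-- The things that have a real value: `inl φ` stands for the formula with code `φ`,
`inr (inl s)` for the metric of the sort `s`, and `inr (inr R)` for the predicate symbol `R`, each
of them applied to a list of names. -/
abbrev Obj : Type := (ℕ ⊕ L.Srt ⊕ L.Rel) × List ℕ

/-- The propositional atom `(k, q)` says that the value of `k` is at most the rational number
named by `q`. -/
abbrev Atom : Type := Obj L × (ℕ × ℕ × ℕ)

variable {L}

/-- Names of points are natural numbers, formed from a head and a list of names. -/
def name (h : Head L) (ρ : List ℕ) : ℕ := Encodable.encode (h, ρ)

/-- The metric of the sort `s`. -/
def distAt (s : L.Srt) (x y : ℕ) : Obj L := (.inr (.inl s), [x, y])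

/-- The predicate symbol `R`, at a list of names. -/
def relAt (R : L.Rel) (xs : List ℕ) : Obj L := (.inr (.inr R), xs)

/-- The formula with code `φ`, at a list of names. -/
def fmAt (φ : ℕ) (ρ : List ℕ) : Obj L := (.inl φ, ρ)

/-- The literal `k ≤ q`. -/
def le (k : Obj L) (q : ℕ × ℕ × ℕ) : Atom L × Bool := ((k, q), true)

/-- The literal `k > q`. -/
def gt (k : Obj L) (q : ℕ × ℕ × ℕ) : Atom L × Bool := ((k, q), false)

variable {α : Type} [Primcodable α]

@[fun_prop]
theorem primrec_name {f : α → Head L} {g : α → List ℕ} (hf : Primrec f) (hg : Primrec g) :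
    Primrec fun a => name (f a) (g a) := by
  unfold name; fun_prop

@[fun_prop]
theorem primrec_distAt {f : α → L.Srt} {g h : α → ℕ} (hf : Primrec f) (hg : Primrec g)
    (hh : Primrec h) : Primrec fun a => distAt (f a) (g a) (h a) := by
  unfold distAt; fun_prop

@[fun_prop]
theorem primrec_relAt {f : α → L.Rel} {g : α → List ℕ} (hf : Primrec f) (hg : Primrec g) :
    Primrec fun a => relAt (f a) (g a) := by
  unfold relAt; fun_prop

@[fun_prop]
theorem primrec_fmAt {f : α → ℕ} {g : α → List ℕ} (hf : Primrec f) (hg : Primrec g) :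
    Primrec fun a => (fmAt (f a) (g a) : Obj L) := by
  unfold fmAt; fun_prop

@[fun_prop]
theorem primrec_le {f : α → Obj L} {g : α → ℕ × ℕ × ℕ} (hf : Primrec f) (hg : Primrec g) :
    Primrec fun a => le (f a) (g a) := by
  unfold le; fun_prop

@[fun_prop]
theorem primrec_gt {f : α → Obj L} {g : α → ℕ × ℕ × ℕ} (hf : Primrec f) (hg : Primrec g) :
    Primrec fun a => gt (f a) (g a) := by
  unfold gt; fun_prop

/-- The literals which say that the values of the formulas in the list `l` are within `1 / 2 ^ d` of
the rational numbers that are listed with them. -/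
def boxLits (l : List (ℕ × (ℕ × ℕ × ℕ))) (d : ℕ) (ρ : List ℕ) : List (Atom L × Bool) :=
  l.flatMap fun p => [le (fmAt p.1 ρ) (qAdd p.2 (qDyadic 1 d)),
    gt (fmAt p.1 ρ) (qAdd p.2 (qNeg (qDyadic 1 d)))]

/-- The literals which say that the coordinates of two tuples have distance at most `δ`. The
tuples are given by a list of triples (sort, name, name). -/
def closeLits (l : List (L.Srt × ℕ × ℕ)) (δ : ℕ × ℕ × ℕ) : List (Atom L × Bool) :=
  l.map fun p => le (distAt p.1 p.2.1 p.2.2) δ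

@[fun_prop]
theorem primrec_boxLits {f : α → List (ℕ × (ℕ × ℕ × ℕ))} {g : α → ℕ} {h : α → List ℕ}
    (hf : Primrec f) (hg : Primrec g) (hh : Primrec h) :
    Primrec fun a => (boxLits (f a) (g a) (h a) : List (Atom L × Bool)) := by
  unfold boxLits; fun_prop

@[fun_prop]
theorem primrec_closeLits {f : α → List (L.Srt × ℕ × ℕ)} {g : α → ℕ × ℕ × ℕ}
    (hf : Primrec f) (hg : Primrec g) : Primrec fun a => closeLits (f a) (g a) := by
  unfold closeLits; fun_prop

/-- The axioms of a metric structure whose points have names, with Henkin witnesses, in which the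
sentences with codes in `T` have the value `0`. All of them are clauses.

* The parameters `s`, `x`, `t`, `φ`, `ρ` are arbitrary: every name denotes a point of every sort,
  and nothing is required to be a code. In particular the axioms on `sup` and `inf` do not look at
  the sort of the variable.
* `conn_le` and `le_conn` determine the values of the `n`-th connective. If the arguments are within
  `1 / 2 ^ d` of rational numbers in a box, where `d` comes from the modulus of continuity for the
  precision `1 / 2 ^ m`, then the value is within `2 / 2 ^ m` of the computed approximation `g`: one
  `1 / 2 ^ m` for the modulus and one for `g`. The bound `3 / 2 ^ m` in `le_conn` makes room for the
  strict inequality. The rational numbers keep the distance `1` from the boundary of the box, so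
  that the arguments lie in the box.
* `sup_gt` and `le_inf` introduce the Henkin witnesses. A supremum greater than `q` has a witness
  for just that; an infimum that is at most `p` has a witness for every `q > p`. -/
inductive Ax (T : ℕ → Prop) : Clause (Atom L) → Prop
  | mono (k : Obj L) (p q : ℕ × ℕ × ℕ) (h : ratOf p < ratOf q) :
      Ax T (.imp [le k p] (le k q))
  | dist_nonneg (s : L.Srt) (x y : ℕ) (q : ℕ × ℕ × ℕ) (h : ratOf q < ratOf (0, 0, 0)) :
      Ax T (.imp [] (gt (distAt s x y) q))
  | dist_diam (s : L.Srt) (x y : ℕ) (q : ℕ × ℕ × ℕ) (h : L.diam s < ratOf q) :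
      Ax T (.imp [] (le (distAt s x y) q))
  | dist_self (s : L.Srt) (x : ℕ) (q : ℕ × ℕ × ℕ) (h : ratOf (0, 0, 0) < ratOf q) :
      Ax T (.imp [] (le (distAt s x x) q))
  | dist_symm (s : L.Srt) (x y : ℕ) (q : ℕ × ℕ × ℕ) :
      Ax T (.imp [le (distAt s x y) q] (le (distAt s y x) q))
  | dist_triangle (s : L.Srt) (x y z : ℕ) (p q : ℕ × ℕ × ℕ) :
      Ax T (.imp [le (distAt s x y) p, le (distAt s y z) q] (le (distAt s x z) (qAdd p q)))
  | fn_mod (f : L.Fn) (s : L.Srt) (l : List (L.Srt × ℕ × ℕ)) (ε δ : ℕ × ℕ × ℕ)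
      (hs : L.fnCod f = s) (hl : L.fnDom f = l.map fun p => p.1)
      (hε : ratOf (0, 0, 0) < ratOf ε) (hδ : ratOf δ < L.fnMod f (ratOf ε)) :
      Ax T (.imp (closeLits l δ) (le (distAt s (name (.inr (.inl f)) (l.map fun p => p.2.1))
        (name (.inr (.inl f)) (l.map fun p => p.2.2))) ε))
  | rel_lo (R : L.Rel) (xs : List ℕ) (q : ℕ × ℕ × ℕ) (h : ratOf q < L.relLo R) :
      Ax T (.imp [] (gt (relAt R xs) q))
  | rel_hi (R : L.Rel) (xs : List ℕ) (q : ℕ × ℕ × ℕ) (h : L.relHi R < ratOf q) :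
      Ax T (.imp [] (le (relAt R xs) q))
  | rel_mod (R : L.Rel) (l : List (L.Srt × ℕ × ℕ)) (ε δ p : ℕ × ℕ × ℕ)
      (hl : L.relDom R = l.map fun p => p.1)
      (hε : ratOf (0, 0, 0) < ratOf ε) (hδ : ratOf δ < L.relMod R (ratOf ε)) :
      Ax T (.imp (le (relAt R (l.map fun p => p.2.1)) p :: closeLits l δ)
        (le (relAt R (l.map fun p => p.2.2)) (qAdd p ε)))
  | term_var (s : L.Srt) (i : ℕ) (ρ : List ℕ) (x : ℕ) (q : ℕ × ℕ × ℕ) (h : ρ[i]? = some x)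
      (hq : ratOf (0, 0, 0) < ratOf q) :
      Ax T (.imp [] (le (distAt s (name (.inl (Nat.pair 0 i) : Head L) ρ) x) q))
  | term_func (s : L.Srt) (f : L.Fn) (ts ρ : List ℕ) (q : ℕ × ℕ × ℕ)
      (hq : ratOf (0, 0, 0) < ratOf q) :
      Ax T (.imp [] (le (distAt s
        (name (.inl (Nat.pair 1 (Nat.pair (Encodable.encode f) (Encodable.encode ts))) : Head L) ρ)
        (name (.inr (.inl f)) (ts.map fun t => name (.inl t : Head L) ρ))) q))
  | dist_le (s : L.Srt) (t₁ t₂ : ℕ) (ρ : List ℕ) (q : ℕ × ℕ × ℕ) :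
      Ax T (.imp [le (distAt s (name (.inl t₁ : Head L) ρ) (name (.inl t₂ : Head L) ρ)) q]
        (le (fmAt (Nat.pair 0 (Nat.pair (Encodable.encode s) (Nat.pair t₁ t₂))) ρ) q))
  | le_dist (s : L.Srt) (t₁ t₂ : ℕ) (ρ : List ℕ) (q : ℕ × ℕ × ℕ) :
      Ax T (.imp [le (fmAt (Nat.pair 0 (Nat.pair (Encodable.encode s) (Nat.pair t₁ t₂))) ρ) q]
        (le (distAt s (name (.inl t₁ : Head L) ρ) (name (.inl t₂ : Head L) ρ)) q))
  | rel_le (R : L.Rel) (ts ρ : List ℕ) (q : ℕ × ℕ × ℕ) :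
      Ax T (.imp [le (relAt R (ts.map fun t => name (.inl t : Head L) ρ)) q]
        (le (fmAt (Nat.pair 1 (Nat.pair (Encodable.encode R) (Encodable.encode ts))) ρ) q))
  | le_rel (R : L.Rel) (ts ρ : List ℕ) (q : ℕ × ℕ × ℕ) :
      Ax T (.imp [le (fmAt (Nat.pair 1 (Nat.pair (Encodable.encode R) (Encodable.encode ts))) ρ) q]
        (le (relAt R (ts.map fun t => name (.inl t : Head L) ρ)) q))
  | conn_le (n : ℕ) (l : List (ℕ × (ℕ × ℕ × ℕ))) (B m d : ℕ) (g : ℕ × ℕ × ℕ) (ρ : List ℕ)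
      (hl : (C.u n).1 = l.length) (hd : C.modulus (n, B, m) = d)
      (hg : C.approx (n, l.map (fun p => p.2), m) = g)
      (hB : ∀ p ∈ l, ratOf (qAdd p.2 (1, 0, 0)) < ratOf (B, 0, 0) ∧
        ratOf (qAdd (qNeg p.2) (1, 0, 0)) < ratOf (B, 0, 0)) :
      Ax T (.imp (boxLits l d ρ)
        (le (fmAt (Nat.pair 2 (Nat.pair n (Encodable.encode (l.map fun p => p.1)))) ρ)
          (qAdd g (qDyadic 2 m))))
  | le_conn (n : ℕ) (l : List (ℕ × (ℕ × ℕ × ℕ))) (B m d : ℕ) (g : ℕ × ℕ × ℕ) (ρ : List ℕ)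
      (hl : (C.u n).1 = l.length) (hd : C.modulus (n, B, m) = d)
      (hg : C.approx (n, l.map (fun p => p.2), m) = g)
      (hB : ∀ p ∈ l, ratOf (qAdd p.2 (1, 0, 0)) < ratOf (B, 0, 0) ∧
        ratOf (qAdd (qNeg p.2) (1, 0, 0)) < ratOf (B, 0, 0)) :
      Ax T (.imp (boxLits l d ρ)
        (gt (fmAt (Nat.pair 2 (Nat.pair n (Encodable.encode (l.map fun p => p.1)))) ρ)
          (qAdd g (qNeg (qDyadic 3 m)))))
  | sup_le (s φ : ℕ) (ρ : List ℕ) (x : ℕ) (q : ℕ × ℕ × ℕ) :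
      Ax T (.imp [le (fmAt (Nat.pair 3 (Nat.pair s φ)) ρ) q] (le (fmAt φ (x :: ρ)) q))
  | sup_gt (s φ : ℕ) (ρ : List ℕ) (q : ℕ × ℕ × ℕ) :
      Ax T (.imp [gt (fmAt (Nat.pair 3 (Nat.pair s φ)) ρ) q]
        (gt (fmAt φ (name (.inr (.inr (true, φ, q)) : Head L) ρ :: ρ)) q))
  | inf_le (s φ : ℕ) (ρ : List ℕ) (x : ℕ) (q : ℕ × ℕ × ℕ) :
      Ax T (.imp [le (fmAt φ (x :: ρ)) q] (le (fmAt (Nat.pair 4 (Nat.pair s φ)) ρ) q))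
  | le_inf (s φ : ℕ) (ρ : List ℕ) (p q : ℕ × ℕ × ℕ) (h : ratOf p < ratOf q) :
      Ax T (.imp [le (fmAt (Nat.pair 4 (Nat.pair s φ)) ρ) p]
        (le (fmAt φ (name (.inr (.inr (false, φ, q)) : Head L) ρ :: ρ)) q))
  | theory_le (n : ℕ) (q : ℕ × ℕ × ℕ) (hn : T n) (h : ratOf (0, 0, 0) < ratOf q) :
      Ax T (.imp [] (le (fmAt n []) q))
  | theory_ge (n : ℕ) (q : ℕ × ℕ × ℕ) (hn : T n) (h : ratOf q < ratOf (0, 0, 0)) :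
      Ax T (.imp [] (gt (fmAt n []) q))

theorem REPred.computable_eq {β γ : Type} [Primcodable β] [Primcodable γ] {g : β → γ}
    (hg : Computable g) {f : α → β} {h : α → γ} (hf : Primrec f) (hh : Primrec h) :
    REPred fun a => g (f a) = h a :=
  (REPred.graph hg).comp_primrec (hf.pair hh)

theorem REPred.computableRat_lt {β : Type} [Primcodable β] {g : β → ℚ}
    (hg : ComputableRat g) {f : α → β} {h : α → ℕ × ℕ × ℕ} (hf : Primrec f) (hh : Primrec h) :
    REPred fun a => g (f a) < ratOf (h a) := by
  obtain ⟨g', hg', hgg'⟩ := hg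
  simp only [hgg']
  exact REPred.comp (f := fun a => (g' (f a), h a)) (REPred.ratOf_lt Primrec.fst Primrec.snd)
    ((hg'.comp hf.to_comp).pair hh.to_comp)

theorem REPred.lt_computableRat {β : Type} [Primcodable β] {g : β → ℚ}
    (hg : ComputableRat g) {f : α → β} {h : α → ℕ × ℕ × ℕ} (hf : Primrec f) (hh : Primrec h) :
    REPred fun a => ratOf (h a) < g (f a) := by
  obtain ⟨g', hg', hgg'⟩ := hg
  simp only [hgg']
  exact REPred.comp (f := fun a => (h a, g' (f a))) (REPred.ratOf_lt Primrec.fst Primrec.snd)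
    (hh.to_comp.pair (hg'.comp hf.to_comp))

/-- The axioms are enumerable, as each kind of axiom is the image of an enumerable set of parameters
under a computable map. -/
theorem rePred_ax (hL : L.IsComputable) {T : ℕ → Prop} (hT : REPred T) :
    REPred fun c : Clause (Atom L) => Ax C T c := by
  have mono := REPred.image (α := Clause (Atom L))
    (P := fun p : Obj L × (ℕ × ℕ × ℕ) × (ℕ × ℕ × ℕ) => ratOf p.2.1 < ratOf p.2.2)
    (F := fun p => .imp [le p.1 p.2.1] (le p.1 p.2.2))
    (REPred.ratOf_lt (by fun_prop) (by fun_prop)) (by fun_prop)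
  have dist_nonneg := REPred.image (α := Clause (Atom L))
    (P := fun p : L.Srt × ℕ × ℕ × (ℕ × ℕ × ℕ) => ratOf p.2.2.2 < ratOf (0, 0, 0))
    (F := fun p => .imp [] (gt (distAt p.1 p.2.1 p.2.2.1) p.2.2.2))
    (REPred.ratOf_lt (by fun_prop) (by fun_prop)) (by fun_prop)
  have dist_diam := REPred.image (α := Clause (Atom L))
    (P := fun p : L.Srt × ℕ × ℕ × (ℕ × ℕ × ℕ) => L.diam p.1 < ratOf p.2.2.2)
    (F := fun p => .imp [] (le (distAt p.1 p.2.1 p.2.2.1) p.2.2.2))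
    (REPred.computableRat_lt hL.diam (by fun_prop) (by fun_prop)) (by fun_prop)
  have dist_self := REPred.image (α := Clause (Atom L))
    (P := fun p : L.Srt × ℕ × (ℕ × ℕ × ℕ) => ratOf (0, 0, 0) < ratOf p.2.2)
    (F := fun p => .imp [] (le (distAt p.1 p.2.1 p.2.1) p.2.2))
    (REPred.ratOf_lt (by fun_prop) (by fun_prop)) (by fun_prop)
  have dist_symm := REPred.range (α := Clause (Atom L))
    (F := fun p : L.Srt × ℕ × ℕ × (ℕ × ℕ × ℕ) => .imp [le (distAt p.1 p.2.1 p.2.2.1) p.2.2.2]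
      (le (distAt p.1 p.2.2.1 p.2.1) p.2.2.2)) (by fun_prop)
  have dist_triangle := REPred.range (α := Clause (Atom L))
    (F := fun p : L.Srt × (ℕ × ℕ × ℕ) × (ℕ × ℕ × ℕ) × (ℕ × ℕ × ℕ) =>
      .imp [le (distAt p.1 p.2.1.1 p.2.1.2.1) p.2.2.1, le (distAt p.1 p.2.1.2.1 p.2.1.2.2) p.2.2.2]
        (le (distAt p.1 p.2.1.1 p.2.1.2.2) (qAdd p.2.2.1 p.2.2.2))) (by fun_prop)
  have fn_mod := REPred.image (α := Clause (Atom L))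
    (P := fun p : L.Fn × L.Srt × List (L.Srt × ℕ × ℕ) × (ℕ × ℕ × ℕ) × (ℕ × ℕ × ℕ) =>
      L.fnCod p.1 = p.2.1 ∧ L.fnDom p.1 = p.2.2.1.map (fun p => p.1) ∧
        ratOf (0, 0, 0) < ratOf p.2.2.2.1 ∧ ratOf p.2.2.2.2 < L.fnMod p.1 (ratOf p.2.2.2.1))
    (F := fun p => .imp (closeLits p.2.2.1 p.2.2.2.2)
      (le (distAt p.2.1 (name (.inr (.inl p.1)) (p.2.2.1.map fun p => p.2.1))
        (name (.inr (.inl p.1)) (p.2.2.1.map fun p => p.2.2))) p.2.2.2.1))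
    ((REPred.computable_eq hL.fnCod (by fun_prop) (by fun_prop)).and
      ((REPred.computable_eq hL.fnDom (by fun_prop) (by fun_prop)).and
        ((REPred.ratOf_lt (by fun_prop) (by fun_prop)).and
          (REPred.lt_computableRat hL.fnMod (f := fun p : L.Fn × L.Srt × List (L.Srt × ℕ × ℕ) ×
            (ℕ × ℕ × ℕ) × (ℕ × ℕ × ℕ) => (p.1, p.2.2.2.1)) (by fun_prop) (by fun_prop)))))
    (by fun_prop)
  have rel_lo := REPred.image (α := Clause (Atom L))
    (P := fun p : L.Rel × List ℕ × (ℕ × ℕ × ℕ) => ratOf p.2.2 < L.relLo p.1)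
    (F := fun p => .imp [] (gt (relAt p.1 p.2.1) p.2.2))
    (REPred.lt_computableRat hL.relLo (by fun_prop) (by fun_prop)) (by fun_prop)
  have rel_hi := REPred.image (α := Clause (Atom L))
    (P := fun p : L.Rel × List ℕ × (ℕ × ℕ × ℕ) => L.relHi p.1 < ratOf p.2.2)
    (F := fun p => .imp [] (le (relAt p.1 p.2.1) p.2.2))
    (REPred.computableRat_lt hL.relHi (by fun_prop) (by fun_prop)) (by fun_prop)
  have rel_mod := REPred.image (α := Clause (Atom L))
    (P := fun p : L.Rel × List (L.Srt × ℕ × ℕ) × (ℕ × ℕ × ℕ) × (ℕ × ℕ × ℕ) × (ℕ × ℕ × ℕ) =>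
      L.relDom p.1 = p.2.1.map (fun p => p.1) ∧
        ratOf (0, 0, 0) < ratOf p.2.2.1 ∧ ratOf p.2.2.2.1 < L.relMod p.1 (ratOf p.2.2.1))
    (F := fun p => .imp (le (relAt p.1 (p.2.1.map fun p => p.2.1)) p.2.2.2.2 ::
      closeLits p.2.1 p.2.2.2.1)
        (le (relAt p.1 (p.2.1.map fun p => p.2.2)) (qAdd p.2.2.2.2 p.2.2.1)))
    ((REPred.computable_eq hL.relDom (by fun_prop) (by fun_prop)).and
      ((REPred.ratOf_lt (by fun_prop) (by fun_prop)).and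
        (REPred.lt_computableRat hL.relMod (f := fun p : L.Rel × List (L.Srt × ℕ × ℕ) ×
            (ℕ × ℕ × ℕ) × (ℕ × ℕ × ℕ) × (ℕ × ℕ × ℕ) => (p.1, p.2.2.1)) (by fun_prop)
            (by fun_prop)))) (by fun_prop)
  have term_var := REPred.image (α := Clause (Atom L))
    (P := fun p : L.Srt × ℕ × List ℕ × ℕ × (ℕ × ℕ × ℕ) =>
      p.2.2.1[p.2.1]? = some p.2.2.2.1 ∧ ratOf (0, 0, 0) < ratOf p.2.2.2.2)
    (F := fun p => .imp [] (le (distAt p.1 (name (.inl (Nat.pair 0 p.2.1) : Head L) p.2.2.1)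
      p.2.2.2.1) p.2.2.2.2))
    ((REPred.of_primrecPred (primrecPred_eq (by fun_prop) (by fun_prop))).and
      (REPred.ratOf_lt (by fun_prop) (by fun_prop))) (by fun_prop)
  have term_func := REPred.image (α := Clause (Atom L))
    (P := fun p : L.Srt × L.Fn × List ℕ × List ℕ × (ℕ × ℕ × ℕ) =>
      ratOf (0, 0, 0) < ratOf p.2.2.2.2)
    (F := fun p => .imp [] (le (distAt p.1
      (name (.inl (Nat.pair 1 (Nat.pair (Encodable.encode p.2.1) (Encodable.encode p.2.2.1))) :
        Head L) p.2.2.2.1)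
      (name (.inr (.inl p.2.1)) (p.2.2.1.map fun t => name (.inl t : Head L) p.2.2.2.1)))
      p.2.2.2.2))
    (REPred.ratOf_lt (by fun_prop) (by fun_prop)) (by fun_prop)
  have dist_le := REPred.range (α := Clause (Atom L))
    (F := fun p : L.Srt × ℕ × ℕ × List ℕ × (ℕ × ℕ × ℕ) =>
      .imp [le (distAt p.1 (name (.inl p.2.1 : Head L) p.2.2.2.1)
          (name (.inl p.2.2.1 : Head L) p.2.2.2.1)) p.2.2.2.2]
        (le (fmAt (Nat.pair 0 (Nat.pair (Encodable.encode p.1) (Nat.pair p.2.1 p.2.2.1)))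
          p.2.2.2.1) p.2.2.2.2)) (by fun_prop)
  have le_dist := REPred.range (α := Clause (Atom L))
    (F := fun p : L.Srt × ℕ × ℕ × List ℕ × (ℕ × ℕ × ℕ) =>
      .imp [le (fmAt (Nat.pair 0 (Nat.pair (Encodable.encode p.1) (Nat.pair p.2.1 p.2.2.1)))
          p.2.2.2.1) p.2.2.2.2]
        (le (distAt p.1 (name (.inl p.2.1 : Head L) p.2.2.2.1)
          (name (.inl p.2.2.1 : Head L) p.2.2.2.1)) p.2.2.2.2)) (by fun_prop)
  have rel_le := REPred.range (α := Clause (Atom L))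
    (F := fun p : L.Rel × List ℕ × List ℕ × (ℕ × ℕ × ℕ) =>
      .imp [le (relAt p.1 (p.2.1.map fun t => name (.inl t : Head L) p.2.2.1)) p.2.2.2]
        (le (fmAt (Nat.pair 1 (Nat.pair (Encodable.encode p.1) (Encodable.encode p.2.1)))
          p.2.2.1) p.2.2.2)) (by fun_prop)
  have le_rel := REPred.range (α := Clause (Atom L))
    (F := fun p : L.Rel × List ℕ × List ℕ × (ℕ × ℕ × ℕ) =>
      .imp [le (fmAt (Nat.pair 1 (Nat.pair (Encodable.encode p.1) (Encodable.encode p.2.1)))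
          p.2.2.1) p.2.2.2]
        (le (relAt p.1 (p.2.1.map fun t => name (.inl t : Head L) p.2.2.1)) p.2.2.2))
    (by fun_prop)
  have conn_side : REPred fun p : ℕ × List (ℕ × (ℕ × ℕ × ℕ)) × (ℕ × ℕ × ℕ) × (ℕ × ℕ × ℕ) ×
      List ℕ => (C.u p.1).1 = p.2.1.length ∧
        C.modulus (p.1, p.2.2.1.1, p.2.2.1.2.1) = p.2.2.1.2.2 ∧
        C.approx (p.1, p.2.1.map (fun p => p.2), p.2.2.1.2.1) = p.2.2.2.1 ∧
        ∀ r ∈ p.2.1, ratOf (qAdd r.2 (1, 0, 0)) < ratOf (p.2.2.1.1, 0, 0) ∧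
          ratOf (qAdd (qNeg r.2) (1, 0, 0)) < ratOf (p.2.2.1.1, 0, 0) := by
    refine (REPred.computable_eq C.computable_arity (by fun_prop) (by fun_prop)).and
      ((REPred.computable_eq C.computable_mod (by fun_prop) (by fun_prop)).and
      ((REPred.computable_eq C.computable_approx (by fun_prop) (by fun_prop)).and ?_))
    exact REPred.forall_mem
      (p := fun (r : ℕ × (ℕ × ℕ × ℕ))
        (p : ℕ × List (ℕ × (ℕ × ℕ × ℕ)) × (ℕ × ℕ × ℕ) × (ℕ × ℕ × ℕ) × List ℕ) =>
        ratOf (qAdd r.2 (1, 0, 0)) < ratOf (p.2.2.1.1, 0, 0) ∧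
          ratOf (qAdd (qNeg r.2) (1, 0, 0)) < ratOf (p.2.2.1.1, 0, 0))
      ((REPred.ratOf_lt (by fun_prop) (by fun_prop)).and
        (REPred.ratOf_lt (by fun_prop) (by fun_prop))) (by fun_prop)
  have conn_le := REPred.image (α := Clause (Atom L)) conn_side
    (F := fun p => .imp (boxLits p.2.1 p.2.2.1.2.2 p.2.2.2.2)
        (le (fmAt (Nat.pair 2 (Nat.pair p.1 (Encodable.encode (p.2.1.map fun p => p.1))))
          p.2.2.2.2) (qAdd p.2.2.2.1 (qDyadic 2 p.2.2.1.2.1)))) (by fun_prop)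
  have le_conn := REPred.image (α := Clause (Atom L)) conn_side
    (F := fun p => .imp (boxLits p.2.1 p.2.2.1.2.2 p.2.2.2.2)
        (gt (fmAt (Nat.pair 2 (Nat.pair p.1 (Encodable.encode (p.2.1.map fun p => p.1))))
          p.2.2.2.2) (qAdd p.2.2.2.1 (qNeg (qDyadic 3 p.2.2.1.2.1))))) (by fun_prop)
  have sup_le := REPred.range (α := Clause (Atom L))
    (F := fun p : ℕ × ℕ × List ℕ × ℕ × (ℕ × ℕ × ℕ) =>
      .imp [le (fmAt (Nat.pair 3 (Nat.pair p.1 p.2.1)) p.2.2.1) p.2.2.2.2]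
        (le (fmAt p.2.1 (p.2.2.2.1 :: p.2.2.1)) p.2.2.2.2)) (by fun_prop)
  have sup_gt := REPred.range (α := Clause (Atom L))
    (F := fun p : ℕ × ℕ × List ℕ × (ℕ × ℕ × ℕ) =>
      .imp [gt (fmAt (Nat.pair 3 (Nat.pair p.1 p.2.1)) p.2.2.1) p.2.2.2]
        (gt (fmAt p.2.1 (name (.inr (.inr (true, p.2.1, p.2.2.2)) : Head L) p.2.2.1 :: p.2.2.1))
          p.2.2.2)) (by fun_prop)
  have inf_le := REPred.range (α := Clause (Atom L))
    (F := fun p : ℕ × ℕ × List ℕ × ℕ × (ℕ × ℕ × ℕ) =>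
      .imp [le (fmAt p.2.1 (p.2.2.2.1 :: p.2.2.1)) p.2.2.2.2]
        (le (fmAt (Nat.pair 4 (Nat.pair p.1 p.2.1)) p.2.2.1) p.2.2.2.2)) (by fun_prop)
  have le_inf := REPred.image (α := Clause (Atom L))
    (P := fun p : ℕ × ℕ × List ℕ × (ℕ × ℕ × ℕ) × (ℕ × ℕ × ℕ) =>
      ratOf p.2.2.2.1 < ratOf p.2.2.2.2)
    (F := fun p => .imp [le (fmAt (Nat.pair 4 (Nat.pair p.1 p.2.1)) p.2.2.1) p.2.2.2.1]
        (le (fmAt p.2.1 (name (.inr (.inr (false, p.2.1, p.2.2.2.2)) : Head L) p.2.2.1 ::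
          p.2.2.1)) p.2.2.2.2)) (REPred.ratOf_lt (by fun_prop) (by fun_prop)) (by fun_prop)
  have theory_le := REPred.image (α := Clause (Atom L))
    (P := fun p : ℕ × (ℕ × ℕ × ℕ) => T p.1 ∧ ratOf (0, 0, 0) < ratOf p.2)
    (F := fun p => .imp [] (le (fmAt p.1 []) p.2))
    ((hT.comp_primrec (by fun_prop)).and (REPred.ratOf_lt (by fun_prop) (by fun_prop)))
    (by fun_prop)
  have theory_ge := REPred.image (α := Clause (Atom L))
    (P := fun p : ℕ × (ℕ × ℕ × ℕ) => T p.1 ∧ ratOf p.2 < ratOf (0, 0, 0))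
    (F := fun p => .imp [] (gt (fmAt p.1 []) p.2))
    ((hT.comp_primrec (by fun_prop)).and (REPred.ratOf_lt (by fun_prop) (by fun_prop)))
    (by fun_prop)
  have dist_axioms := dist_nonneg.or (dist_diam.or (dist_self.or (dist_symm.or dist_triangle)))
  have symbol_axioms := fn_mod.or (rel_lo.or (rel_hi.or rel_mod))
  have term_axioms := term_var.or term_func
  have atomic_axioms := dist_le.or (le_dist.or (rel_le.or le_rel))
  have conn_axioms := conn_le.or le_conn
  have quantifier_axioms := sup_le.or (sup_gt.or (inf_le.or le_inf))
  have theory_axioms := theory_le.or theory_ge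
  refine (mono.or (dist_axioms.or (symbol_axioms.or (term_axioms.or (atomic_axioms.or
    (conn_axioms.or (quantifier_axioms.or theory_axioms))))))).of_eq fun c => ⟨?_, ?_⟩
  · rintro (⟨p, h, rfl⟩ |
      (⟨p, h, rfl⟩ | ⟨p, h, rfl⟩ | ⟨p, h, rfl⟩ | ⟨p, rfl⟩ | ⟨p, rfl⟩) |
      (⟨p, h, rfl⟩ | ⟨p, h, rfl⟩ | ⟨p, h, rfl⟩ | ⟨p, h, rfl⟩) |
      (⟨p, h, rfl⟩ | ⟨p, h, rfl⟩) |
      (⟨p, rfl⟩ | ⟨p, rfl⟩ | ⟨p, rfl⟩ | ⟨p, rfl⟩) |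
      (⟨p, h, rfl⟩ | ⟨p, h, rfl⟩) |
      (⟨p, rfl⟩ | ⟨p, rfl⟩ | ⟨p, rfl⟩ | ⟨p, h, rfl⟩) |
      (⟨p, h, rfl⟩ | ⟨p, h, rfl⟩))
    · exact .mono _ _ _ h
    · exact .dist_nonneg _ _ _ _ h
    · exact .dist_diam _ _ _ _ h
    · exact .dist_self _ _ _ h
    · exact .dist_symm _ _ _ _
    · exact .dist_triangle _ _ _ _ _ _
    · exact .fn_mod _ _ _ _ _ h.1 h.2.1 h.2.2.1 h.2.2.2
    · exact .rel_lo _ _ _ h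
    · exact .rel_hi _ _ _ h
    · exact .rel_mod _ _ _ _ _ h.1 h.2.1 h.2.2
    · exact .term_var _ _ _ _ _ h.1 h.2
    · exact .term_func _ _ _ _ _ h
    · exact .dist_le _ _ _ _ _
    · exact .le_dist _ _ _ _ _
    · exact .rel_le _ _ _ _
    · exact .le_rel _ _ _ _
    · exact .conn_le _ _ _ _ _ _ _ h.1 h.2.1 h.2.2.1 h.2.2.2
    · exact .le_conn _ _ _ _ _ _ _ h.1 h.2.1 h.2.2.1 h.2.2.2
    · exact .sup_le _ _ _ _ _
    · exact .sup_gt _ _ _ _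
    · exact .inf_le _ _ _ _ _
    · exact .le_inf _ _ _ _ _ h
    · exact .theory_le _ _ h.1 h.2
    · exact .theory_ge _ _ h.1 h.2
  · intro hc
    induction hc with
    | mono k p q h => exact .inl ⟨(k, p, q), h, rfl⟩
    | dist_nonneg s x y q h => exact .inr (.inl (.inl ⟨(s, x, y, q), h, rfl⟩))
    | dist_diam s x y q h => exact .inr (.inl (.inr (.inl ⟨(s, x, y, q), h, rfl⟩)))
    | dist_self s x q h => exact .inr (.inl (.inr (.inr (.inl ⟨(s, x, q), h, rfl⟩))))
    | dist_symm s x y q => exact .inr (.inl (.inr (.inr (.inr (.inl ⟨(s, x, y, q), rfl⟩)))))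
    | dist_triangle s x y z p q =>
      exact .inr (.inl (.inr (.inr (.inr (.inr ⟨(s, (x, y, z), p, q), rfl⟩)))))
    | fn_mod f s l ε δ hs hl hε hδ =>
      exact .inr (.inr (.inl (.inl ⟨(f, s, l, ε, δ), ⟨hs, hl, hε, hδ⟩, rfl⟩)))
    | rel_lo R xs q h => exact .inr (.inr (.inl (.inr (.inl ⟨(R, xs, q), h, rfl⟩))))
    | rel_hi R xs q h => exact .inr (.inr (.inl (.inr (.inr (.inl ⟨(R, xs, q), h, rfl⟩)))))
    | rel_mod R l ε δ p hl hε hδ =>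
      exact .inr (.inr (.inl (.inr (.inr (.inr ⟨(R, l, ε, δ, p), ⟨hl, hε, hδ⟩, rfl⟩)))))
    | term_var s i ρ x q h hq =>
      exact .inr (.inr (.inr (.inl (.inl ⟨(s, i, ρ, x, q), ⟨h, hq⟩, rfl⟩))))
    | term_func s f ts ρ q hq =>
      exact .inr (.inr (.inr (.inl (.inr ⟨(s, f, ts, ρ, q), hq, rfl⟩))))
    | dist_le s t₁ t₂ ρ q =>
      exact .inr (.inr (.inr (.inr (.inl (.inl ⟨(s, t₁, t₂, ρ, q), rfl⟩)))))
    | le_dist s t₁ t₂ ρ q =>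
      exact .inr (.inr (.inr (.inr (.inl (.inr (.inl ⟨(s, t₁, t₂, ρ, q), rfl⟩))))))
    | rel_le R ts ρ q =>
      exact .inr (.inr (.inr (.inr (.inl (.inr (.inr (.inl ⟨(R, ts, ρ, q), rfl⟩)))))))
    | le_rel R ts ρ q =>
      exact .inr (.inr (.inr (.inr (.inl (.inr (.inr (.inr ⟨(R, ts, ρ, q), rfl⟩)))))))
    | conn_le n l B m d g ρ hl hd hg hB =>
      exact .inr (.inr (.inr (.inr (.inr (.inl (.inl
        ⟨(n, l, (B, m, d), g, ρ), ⟨hl, hd, hg, hB⟩, rfl⟩))))))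
    | le_conn n l B m d g ρ hl hd hg hB =>
      exact .inr (.inr (.inr (.inr (.inr (.inl (.inr
        ⟨(n, l, (B, m, d), g, ρ), ⟨hl, hd, hg, hB⟩, rfl⟩))))))
    | sup_le s φ ρ x q =>
      exact .inr (.inr (.inr (.inr (.inr (.inr (.inl (.inl ⟨(s, φ, ρ, x, q), rfl⟩)))))))
    | sup_gt s φ ρ q =>
      exact .inr (.inr (.inr (.inr (.inr (.inr (.inl (.inr (.inl ⟨(s, φ, ρ, q), rfl⟩))))))))
    | inf_le s φ ρ x q =>
      exact .inr (.inr (.inr (.inr (.inr (.inr (.inl (.inr (.inr (.inl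
        ⟨(s, φ, ρ, x, q), rfl⟩)))))))))
    | le_inf s φ ρ p q h =>
      exact .inr (.inr (.inr (.inr (.inr (.inr (.inl (.inr (.inr (.inr
        ⟨(s, φ, ρ, p, q), h, rfl⟩)))))))))
    | theory_le n q hn h =>
      exact .inr (.inr (.inr (.inr (.inr (.inr (.inr (.inl ⟨(n, q), ⟨hn, h⟩, rfl⟩)))))))
    | theory_ge n q hn h =>
      exact .inr (.inr (.inr (.inr (.inr (.inr (.inr (.inr ⟨(n, q), ⟨hn, h⟩, rfl⟩)))))))

end Axioms

/-! ### Every structure satisfies the Henkin axioms of its theory -/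

section Soundness

variable {L : MetricLanguage}

/-- Interpretation of all names, by recursion, when the meaning of the heads is given. -/
def interp {X : Type u} (G : Head L → List X → X) (d : X) (n : ℕ) : X :=
  match _h : Encodable.decode₂ (Head L × List ℕ) n with
  | none => d
  | some p => G p.1 (p.2.attach.map fun x => interp G d x.1)
termination_by n
decreasing_by
  rw [← Encodable.mem_decode₂.1 (Option.mem_def.2 _h)]
  exact (lt_encode_of_mem x.2).trans_le (Nat.right_le_pair _ _)

theorem interp_name {X : Type u} (G : Head L → List X → X) (d : X) (h : Head L) (ρ : List ℕ) :
    interp G d (name h ρ) = G h (ρ.map (interp G d)) := by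
  have h1 : Encodable.decode₂ (Head L × List ℕ) (name h ρ) = some (h, ρ) :=
    Encodable.decode₂_encode _
  rw [interp]
  split
  · next h2 => rw [h1] at h2; cases h2
  · next p h2 =>
    rw [h1, Option.some_inj] at h2
    subst h2
    simp

variable (C : Connectives) (M : MetricStructure.{u} L)

open Classical in
/-- The meaning of the heads of names in the structure `M`. -/
def headPoint : Head L → List (Point M) → Point M
  | .inl t, ρ => rawTerm M t ρ
  | .inr (.inl f), l => fnPoint M f l
  | .inr (.inr (true, φ, q)), ρ =>
      if h : ∃ a, (ratOf q : ℝ) < rawVal M C φ (a :: ρ) then h.choose else defaultPoint M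
  | .inr (.inr (false, φ, q)), ρ =>
      if h : ∃ a, rawVal M C φ (a :: ρ) ≤ ratOf q then h.choose else defaultPoint M

/-- The point of `M` with the name `n`. -/
def pointOf (n : ℕ) : Point M := interp (headPoint C M) (defaultPoint M) n

theorem pointOf_name (h : Head L) (ρ : List ℕ) :
    pointOf C M (name h ρ) = headPoint C M h (ρ.map (pointOf C M)) :=
  interp_name _ _ _ _

/-- The real value of an object in `M`. -/
def objVal : Obj L → ℝ
  | (.inl φ, ρ) => rawVal M C φ (ρ.map (pointOf C M))
  | (.inr (.inl s), l) => dist (pointOf C M (l.getD 0 0) s) (pointOf C M (l.getD 1 0) s)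
  | (.inr (.inr R), l) => relPoint M R (l.map (pointOf C M))

theorem objVal_fmAt (φ : ℕ) (ρ : List ℕ) :
    objVal C M (fmAt φ ρ) = rawVal M C φ (ρ.map (pointOf C M)) := rfl

theorem objVal_distAt (s : L.Srt) (x y : ℕ) :
    objVal C M (distAt s x y) = dist (pointOf C M x s) (pointOf C M y s) := rfl

theorem objVal_relAt (R : L.Rel) (xs : List ℕ) :
    objVal C M (relAt R xs) = relPoint M R (xs.map (pointOf C M)) := rfl

theorem le_iff {w : Atom L → Prop} (k : Obj L) (q : ℕ × ℕ × ℕ) :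
    ((le k q).2 = true ↔ w (le k q).1) ↔ w (k, q) := by
  simp [le]

theorem gt_iff {w : Atom L → Prop} (k : Obj L) (q : ℕ × ℕ × ℕ) :
    ((gt k q).2 = true ↔ w (gt k q).1) ↔ ¬ w (k, q) := by
  simp [gt]

theorem forall_closeLits_iff {w : Atom L → Prop} (l : List (L.Srt × ℕ × ℕ)) (δ : ℕ × ℕ × ℕ) :
    (∀ p ∈ closeLits l δ, p.2 = true ↔ w p.1) ↔
      ∀ p ∈ l, w (distAt p.1 p.2.1 p.2.2, δ) := by
  simp only [closeLits, List.forall_mem_map, le_iff]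

theorem forall_boxLits_iff {w : Atom L → Prop} (l : List (ℕ × (ℕ × ℕ × ℕ))) (d : ℕ)
    (ρ : List ℕ) : (∀ p ∈ boxLits l d ρ, p.2 = true ↔ w p.1) ↔
      ∀ p ∈ l, w (fmAt p.1 ρ, qAdd p.2 (qDyadic 1 d)) ∧
        ¬ w (fmAt p.1 ρ, qAdd p.2 (qNeg (qDyadic 1 d))) := by
  simp only [boxLits, List.forall_mem_flatMap, List.forall_mem_cons, List.not_mem_nil,
    false_implies, implies_true, and_true, le_iff, gt_iff]

/-- The approximations control the connectives: if the `xᵢ` are close to rational numbers in a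
box, then the value at `x` is close to the approximate value at these numbers. -/
theorem Connectives.abs_approx_sub_le (n : ℕ) (q : List (ℕ × ℕ × ℕ)) (B m : ℕ)
    (hq : (C.u n).1 = q.length) (x : Fin (C.u n).1 → ℝ)
    (hB : ∀ i : Fin (C.u n).1, |(ratOf (q[i.1]'(hq ▸ i.2)) : ℝ)| + 1 ≤ B)
    (hx : ∀ i : Fin (C.u n).1,
      |x i - ratOf (q[i.1]'(hq ▸ i.2))| ≤ (1 / 2) ^ C.modulus (n, B, m)) :
    |(ratOf (C.approx (n, q, m)) : ℝ) - (C.u n).2 x| ≤ 2 * (1 / 2) ^ m := by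
  have h1 := C.computable_values.choose_spec.2 n q m hq.symm
  have h2 := C.computable_modulus.choose_spec.2 n B m
    (fun i => (ratOf (q[i.1]'(hq ▸ i.2)) : ℝ)) x
    (fun i => by linarith [hB i]) (fun i => ?_) (fun i => by rw [abs_sub_comm]; exact hx i)
  · have h3 := abs_sub_le (ratOf (C.approx (n, q, m)) : ℝ)
      ((C.u n).2 fun i => (ratOf (q[i.1]'(hq ▸ i.2)) : ℝ)) ((C.u n).2 x)
    have h1' : |(ratOf (C.approx (n, q, m)) : ℝ) -
        (C.u n).2 fun i => (ratOf (q[i.1]'(hq ▸ i.2)) : ℝ)| ≤ (1 / 2) ^ m := h1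
    linarith
  · have h4 : ((1 : ℝ) / 2) ^ C.modulus (n, B, m) ≤ 1 := pow_le_one₀ (by norm_num) (by norm_num)
    have h5 : |x i| ≤ |x i - ratOf (q[i.1]'(hq ▸ i.2))| + |(ratOf (q[i.1]'(hq ▸ i.2)) : ℝ)| := by
      simpa using abs_add_le (x i - ratOf (q[i.1]'(hq ▸ i.2))) (ratOf (q[i.1]'(hq ▸ i.2)) : ℝ)
    linarith [hB i, hx i]

/-- The intended truth assignment: `(k, q)` is true if the value of `k` in `M` is at most `q`. -/
def truthIn (a : Atom L) : Prop := objVal C M a.1 ≤ ratOf a.2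

theorem truthIn_mk (k : Obj L) (q : ℕ × ℕ × ℕ) :
    truthIn C M (k, q) ↔ objVal C M k ≤ ratOf q := Iff.rfl

/-- Soundness of the axioms: they are true in every structure in which the sentences with codes in
`T` have the value `0`. -/
theorem ax_sat {T : ℕ → Prop} (hT : ∀ n, T n → rawVal M C n [] = 0) {c : Clause (Atom L)}
    (hc : Ax C T c) : c.Sat (truthIn C M) := by
  have hzero : ratOf (0, 0, 0) = 0 := by simp [ratOf]
  have hconn : ∀ (n : ℕ) (l : List (ℕ × (ℕ × ℕ × ℕ))) (B m : ℕ) (ρ : List ℕ),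
      (C.u n).1 = l.length → (∀ p ∈ l, ratOf (qAdd p.2 (1, 0, 0)) < ratOf (B, 0, 0) ∧
        ratOf (qAdd (qNeg p.2) (1, 0, 0)) < ratOf (B, 0, 0)) →
      (∀ p ∈ l, objVal C M (fmAt p.1 ρ) ≤ ratOf (qAdd p.2 (qDyadic 1 (C.modulus (n, B, m)))) ∧
        ¬ objVal C M (fmAt p.1 ρ) ≤
          ratOf (qAdd p.2 (qNeg (qDyadic 1 (C.modulus (n, B, m)))))) →
      |(ratOf (C.approx (n, l.map (fun p => p.2), m)) : ℝ) - objVal C M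
        (fmAt (Nat.pair 2 (Nat.pair n (Encodable.encode (l.map fun p => p.1)))) ρ)| ≤
          2 * (1 / 2) ^ m := by
    intro n l B m ρ hl hB hx
    rw [objVal_fmAt, rawVal_conn]
    refine C.abs_approx_sub_le n _ B m (by simpa using hl) _ (fun i => ?_) fun i => ?_
    · have h := hB _ (List.getElem_mem (hl ▸ i.2 : i.1 < l.length))
      simp only [ratOf_qAdd, ratOf_qNeg] at h
      have h1 : ratOf (1, 0, 0) = 1 := by simp [ratOf]
      have h2 : ratOf (B, 0, 0) = B := by simp [ratOf]
      rw [h1, h2] at h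
      have h3 : |ratOf (l[i.1]'(hl ▸ i.2)).2| ≤ B - 1 :=
        abs_le.2 ⟨by linarith [h.2], by linarith [h.1]⟩
      simp only [List.getElem_map]
      have h4 : |(ratOf (l[i.1]'(hl ▸ i.2)).2 : ℝ)| ≤ B - 1 := by exact_mod_cast h3
      linarith
    · have h := hx _ (List.getElem_mem (hl ▸ i.2 : i.1 < l.length))
      simp only [ratOf_qAdd, ratOf_qNeg, ratOf_qDyadic, not_le, objVal_fmAt] at h
      push_cast at h
      have h1 : (((l.map fun p => p.1).map fun m => rawVal M C m (ρ.map (pointOf C M))).getD i 0) =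
          rawVal M C (l[i.1]'(hl ▸ i.2)).1 (ρ.map (pointOf C M)) := by
        have hi : i.1 < l.length := hl ▸ i.2
        simp [hi]
      rw [h1, List.getElem_map]
      exact abs_le.2 ⟨by linarith [h.2], by linarith [h.1]⟩
  induction hc with
  | mono k p q h =>
    simp only [Clause.sat_imp, List.forall_mem_singleton, le_iff, truthIn_mk]
    exact fun h1 => h1.trans (by exact_mod_cast h.le)
  | dist_nonneg s x y q h =>
    simp only [Clause.sat_imp, gt_iff, truthIn_mk, objVal_distAt, not_le]
    rw [hzero] at h
    exact fun _ => lt_of_lt_of_le (by exact_mod_cast h) dist_nonneg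
  | dist_diam s x y q h =>
    simp only [Clause.sat_imp, le_iff, truthIn_mk, objVal_distAt]
    exact fun _ => (M.dist_le_diam s _ _).trans (by exact_mod_cast h.le)
  | dist_self s x q h =>
    simp only [Clause.sat_imp, le_iff, truthIn_mk, objVal_distAt, dist_self]
    rw [hzero] at h
    exact fun _ => by exact_mod_cast h.le
  | dist_symm s x y q =>
    simp only [Clause.sat_imp, List.forall_mem_singleton, le_iff, truthIn_mk, objVal_distAt]
    rw [dist_comm]
    exact id
  | dist_triangle s x y z p q =>
    simp only [Clause.sat_imp, List.forall_mem_cons, List.not_mem_nil, false_implies,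
      implies_true, and_true, le_iff, truthIn_mk, objVal_distAt, ratOf_qAdd]
    rintro ⟨h1, h2⟩
    push_cast
    exact (dist_triangle _ _ _).trans (add_le_add h1 h2)
  | fn_mod f s l ε δ hs hl hε hδ =>
    simp only [Clause.sat_imp, forall_closeLits_iff, le_iff, truthIn_mk]
    subst hs
    intro h
    simp only [objVal_distAt, pointOf_name, headPoint, fnPoint_cod]
    rw [hzero] at hε
    refine M.fn_modulus f _ hε _ _ fun i => ?_
    have hi : i.1 < l.length := by simpa [hl] using i.2
    have h1 : l[i.1].1 = (L.fnDom f).get i := by simp [hl]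
    have h2 := h _ (List.getElem_mem hi)
    simp only [objVal_distAt] at h2
    rw [h1] at h2
    simp only [List.map_map, List.getD_eq_getElem?_getD, List.getElem?_map, hi,
      List.getElem?_eq_getElem, Option.map_some, Option.getD_some, Function.comp_apply]
    exact h2.trans_lt (by exact_mod_cast hδ)
  | rel_lo R xs q h =>
    simp only [Clause.sat_imp, gt_iff, truthIn_mk, objVal_relAt, not_le]
    exact fun _ => lt_of_lt_of_le (by exact_mod_cast h) (M.rel_mem R _).1
  | rel_hi R xs q h =>
    simp only [Clause.sat_imp, le_iff, truthIn_mk, objVal_relAt]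
    exact fun _ => (M.rel_mem R _).2.trans (by exact_mod_cast h.le)
  | rel_mod R l ε δ p hl hε hδ =>
    simp only [Clause.sat_imp, List.forall_mem_cons, forall_closeLits_iff, le_iff, truthIn_mk]
    rintro ⟨hp, h⟩
    simp only [objVal_relAt] at hp ⊢
    rw [hzero] at hε
    have h3 : |relPoint M R ((l.map fun p => p.2.1).map (pointOf C M)) -
        relPoint M R ((l.map fun p => p.2.2).map (pointOf C M))| ≤ ratOf ε := by
      refine M.rel_modulus R _ hε _ _ fun i => ?_
      have hi : i.1 < l.length := by simpa [hl] using i.2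
      have h1 : l[i.1].1 = (L.relDom R).get i := by simp [hl]
      have h2 := h _ (List.getElem_mem hi)
      simp only [objVal_distAt] at h2
      rw [h1] at h2
      simp only [List.map_map, List.getD_eq_getElem?_getD, List.getElem?_map, hi,
        List.getElem?_eq_getElem, Option.map_some, Option.getD_some, Function.comp_apply]
      exact h2.trans_lt (by exact_mod_cast hδ)
    rw [ratOf_qAdd]
    push_cast
    linarith [(abs_le.1 h3).1]
  | term_var s i ρ x q h hq =>
    simp only [Clause.sat_imp, le_iff, truthIn_mk, objVal_distAt, pointOf_name, headPoint,
      rawTerm_var]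
    rw [hzero] at hq
    intro _
    have h1 : (ρ.map (pointOf C M)).getD i (defaultPoint M) = pointOf C M x := by simp [h]
    rw [h1, dist_self]
    exact_mod_cast hq.le
  | term_func s f ts ρ q hq =>
    simp only [Clause.sat_imp, le_iff, truthIn_mk, objVal_distAt, pointOf_name, headPoint,
      rawTerm_func,
      List.map_map, Function.comp_def, dist_self]
    rw [hzero] at hq
    exact fun _ => by exact_mod_cast hq.le
  | dist_le s t₁ t₂ ρ q =>
    simp only [Clause.sat_imp, List.forall_mem_singleton, le_iff, truthIn_mk, objVal_distAt,
      objVal_fmAt,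
      rawVal_dist, pointOf_name, headPoint, imp_self]
  | le_dist s t₁ t₂ ρ q =>
    simp only [Clause.sat_imp, List.forall_mem_singleton, le_iff, truthIn_mk, objVal_distAt,
      objVal_fmAt,
      rawVal_dist, pointOf_name, headPoint, imp_self]
  | rel_le R ts ρ q =>
    simp only [Clause.sat_imp, List.forall_mem_singleton, le_iff, truthIn_mk, objVal_relAt,
      objVal_fmAt,
      rawVal_rel, pointOf_name, headPoint, List.map_map, Function.comp_def, imp_self]
  | le_rel R ts ρ q =>
    simp only [Clause.sat_imp, List.forall_mem_singleton, le_iff, truthIn_mk, objVal_relAt,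
      objVal_fmAt,
      rawVal_rel, pointOf_name, headPoint, List.map_map, Function.comp_def, imp_self]
  | conn_le n l B m d g ρ hl hd hg hB =>
    simp only [Clause.sat_imp, forall_boxLits_iff, le_iff, truthIn_mk]
    subst hd hg
    intro h
    have h1 := abs_le.1 (hconn n l B m ρ hl hB h)
    rw [ratOf_qAdd, ratOf_qDyadic]
    push_cast
    linarith [h1.1]
  | le_conn n l B m d g ρ hl hd hg hB =>
    simp only [Clause.sat_imp, forall_boxLits_iff, gt_iff, truthIn_mk]
    subst hd hg
    intro h
    have h1 := abs_le.1 (hconn n l B m ρ hl hB h)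
    rw [ratOf_qAdd, ratOf_qNeg, ratOf_qDyadic, not_le]
    have h2 : (0 : ℝ) < (1 / 2) ^ m := by positivity
    push_cast
    linarith [h1.2]
  | sup_le s φ ρ x q =>
    simp only [Clause.sat_imp, List.forall_mem_singleton, le_iff, truthIn_mk, objVal_fmAt,
      rawVal_sup,
      List.map_cons]
    exact fun h => (le_ciSup (bddAbove_range_rawVal M C φ _) _).trans h
  | sup_gt s φ ρ q =>
    simp only [Clause.sat_imp, List.forall_mem_singleton, gt_iff, truthIn_mk, objVal_fmAt,
      rawVal_sup,
      List.map_cons, pointOf_name, headPoint, not_le]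
    intro h
    have : Nonempty (Point M) := ⟨defaultPoint M⟩
    have hex := exists_lt_of_lt_ciSup h
    rw [dif_pos hex]
    exact hex.choose_spec
  | inf_le s φ ρ x q =>
    simp only [Clause.sat_imp, List.forall_mem_singleton, le_iff, truthIn_mk, objVal_fmAt,
      rawVal_inf,
      List.map_cons]
    exact fun h => (ciInf_le (bddBelow_range_rawVal M C φ _) _).trans h
  | le_inf s φ ρ p q h =>
    simp only [Clause.sat_imp, List.forall_mem_singleton, le_iff, truthIn_mk, objVal_fmAt,
      rawVal_inf,
      List.map_cons, pointOf_name, headPoint]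
    intro h1
    have : Nonempty (Point M) := ⟨defaultPoint M⟩
    have hex : ∃ a, rawVal M C φ (a :: ρ.map (pointOf C M)) ≤ ratOf q := by
      obtain ⟨a, ha⟩ := exists_lt_of_ciInf_lt (h1.trans_lt (by exact_mod_cast h :
        (ratOf p : ℝ) < ratOf q))
      exact ⟨a, ha.le⟩
    rw [dif_pos hex]
    exact hex.choose_spec
  | theory_le n q hn h =>
    simp only [Clause.sat_imp, le_iff, truthIn_mk, objVal_fmAt, List.map_nil, hT n hn]
    rw [hzero] at h
    exact fun _ => by exact_mod_cast h.le
  | theory_ge n q hn h =>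
    simp only [Clause.sat_imp, gt_iff, truthIn_mk, objVal_fmAt, List.map_nil, hT n hn, not_le]
    rw [hzero] at h
    exact fun _ => by exact_mod_cast h

end Soundness

/-! ### Completion of a structure on pseudometric spaces -/

section Completion

/-- The data of a metric structure on pseudometric spaces that need not be complete. -/
structure PreStructure (L : MetricLanguage) where
  /-- the underlying pseudometric spaces -/
  carrier : L.Srt → Type u
  [metric : ∀ s, PseudoMetricSpace (carrier s)]
  [nonempty : ∀ s, Nonempty (carrier s)]
  dist_le_diam : ∀ s (x y : carrier s), dist x y ≤ L.diam s
  /-- interpretation of function symbols -/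
  fn : (f : L.Fn) → Tuple carrier (L.fnDom f) → carrier (L.fnCod f)
  fn_modulus : ∀ (f : L.Fn) (ε : ℚ), 0 < ε → ∀ x y : Tuple carrier (L.fnDom f),
    (∀ i, dist (x i) (y i) < L.fnMod f ε) → dist (fn f x) (fn f y) ≤ ε
  /-- interpretation of predicate symbols -/
  rel : (R : L.Rel) → Tuple carrier (L.relDom R) → ℝ
  rel_mem : ∀ R x, rel R x ∈ Set.Icc (L.relLo R : ℝ) (L.relHi R)
  rel_modulus : ∀ (R : L.Rel) (ε : ℚ), 0 < ε → ∀ x y : Tuple carrier (L.relDom R),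
    (∀ i, dist (x i) (y i) < L.relMod R ε) → |rel R x - rel R y| ≤ ε

attribute [instance] PreStructure.metric PreStructure.nonempty

section Approximation

open UniformSpace

variable {X : Type u} [PseudoMetricSpace X]

theorem exists_dist_coe_lt (a : Completion X) (n : ℕ) :
    ∃ x : X, dist a (x : Completion X) < 1 / (n + 1) :=
  Completion.denseRange_coe.exists_dist_lt a Nat.one_div_pos_of_nat

/-- A sequence in `X` that converges to a given point of the completion. -/
def approxSeq (a : Completion X) (n : ℕ) : X := (exists_dist_coe_lt a n).choose

theorem tendsto_approxSeq (a : Completion X) :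
    Tendsto (fun n => ((approxSeq a n : X) : Completion X)) atTop (𝓝 a) := by
  rw [tendsto_iff_dist_tendsto_zero]
  refine squeeze_zero (fun _ => dist_nonneg) (fun n => ?_) tendsto_one_div_add_atTop_nhds_zero_nat
  rw [dist_comm]
  exact (exists_dist_coe_lt a n).choose_spec.le

theorem tendsto_dist_approxSeq (a b : Completion X) :
    Tendsto (fun n => dist (approxSeq a n) (approxSeq b n)) atTop (𝓝 (dist a b)) := by
  simpa only [Completion.dist_eq] using (tendsto_approxSeq a).dist (tendsto_approxSeq b)

theorem tendsto_dist_approxSeq_coe (x : X) :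
    Tendsto (fun n => dist (approxSeq (x : Completion X) n) x) atTop (𝓝 0) := by
  have h := (tendsto_approxSeq (x : Completion X)).dist
    (tendsto_const_nhds (x := (x : Completion X)))
  simpa only [Completion.dist_eq, dist_self] using h

theorem eventually_dist_approxSeq_lt (a : Completion X) {δ : ℝ} (hδ : 0 < δ) :
    ∀ᶠ p in atTop (α := ℕ × ℕ), dist (approxSeq a p.1) (approxSeq a p.2) < δ := by
  have h : CauchySeq (fun n => ((approxSeq a n : X) : Completion X)) :=
    (tendsto_approxSeq a).cauchySeq
  have h1 := (cauchySeq_iff_tendsto.1 h).eventually (Metric.dist_mem_uniformity hδ)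
  simpa only [Prod.map_fst, Prod.map_snd, Completion.dist_eq] using h1

end Approximation

variable {L : MetricLanguage} (N : PreStructure.{u} L)

open UniformSpace

theorem PreStructure.cauchySeq_fn (f : L.Fn)
    (a : Tuple (fun s => Completion (N.carrier s)) (L.fnDom f)) :
    CauchySeq fun n =>
      (N.fn f (fun k => approxSeq (a k) n) : Completion (N.carrier (L.fnCod f))) := by
  refine cauchySeq_iff_tendsto.2 (Metric.uniformity_basis_dist.tendsto_right_iff.2 fun ε hε => ?_)
  obtain ⟨q, hq, hqε⟩ := exists_rat_btwn hε
  have hq' : 0 < q := by exact_mod_cast hq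
  have hpos : (0 : ℝ) < L.fnMod f q := by exact_mod_cast L.fnMod_pos f q hq'
  filter_upwards [eventually_all.2 fun k => eventually_dist_approxSeq_lt (a k) hpos] with p hp
  simp only [Prod.map_fst, Prod.map_snd, Completion.dist_eq]
  exact (N.fn_modulus f q hq' _ _ hp).trans_lt hqε

theorem PreStructure.cauchySeq_rel (R : L.Rel)
    (a : Tuple (fun s => Completion (N.carrier s)) (L.relDom R)) :
    CauchySeq fun n => N.rel R fun k => approxSeq (a k) n := by
  refine cauchySeq_iff_tendsto.2 (Metric.uniformity_basis_dist.tendsto_right_iff.2 fun ε hε => ?_)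
  obtain ⟨q, hq, hqε⟩ := exists_rat_btwn hε
  have hq' : 0 < q := by exact_mod_cast hq
  have hpos : (0 : ℝ) < L.relMod R q := by exact_mod_cast L.relMod_pos R q hq'
  filter_upwards [eventually_all.2 fun k => eventually_dist_approxSeq_lt (a k) hpos] with p hp
  exact (N.rel_modulus R q hq' _ _ hp).trans_lt hqε

/-- The completion of a structure. The symbols are extended as limits along approximating
sequences. -/
def PreStructure.completion : MetricStructure.{u} L where
  carrier s := Completion (N.carrier s)
  nonempty s := ⟨((Classical.arbitrary (N.carrier s) : N.carrier s) : Completion (N.carrier s))⟩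
  dist_le_diam _ a b :=
    le_of_tendsto (tendsto_dist_approxSeq a b) (Eventually.of_forall fun _ => N.dist_le_diam _ _ _)
  fn f a := haveI : Nonempty (Completion (N.carrier (L.fnCod f))) :=
      ⟨((Classical.arbitrary (N.carrier (L.fnCod f)) : N.carrier _) : Completion _)⟩
    limUnder atTop fun n =>
      (N.fn f (fun k => approxSeq (a k) n) : Completion (N.carrier (L.fnCod f)))
  fn_modulus f ε hε a b h :=
    le_of_tendsto
      ((N.cauchySeq_fn f a).tendsto_limUnder.dist (N.cauchySeq_fn f b).tendsto_limUnder) <|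
      (eventually_all.2 fun k =>
        (tendsto_dist_approxSeq (a k) (b k)).eventually_lt_const (h k)).mono fun _ hn => by
          rw [Completion.dist_eq]
          exact N.fn_modulus f ε hε _ _ hn
  rel R a := limUnder atTop fun n => N.rel R fun k => approxSeq (a k) n
  rel_mem R a := isClosed_Icc.mem_of_tendsto (N.cauchySeq_rel R a).tendsto_limUnder
    (Eventually.of_forall fun _ => N.rel_mem R _)
  rel_modulus R ε hε a b h :=
    le_of_tendsto
      ((N.cauchySeq_rel R a).tendsto_limUnder.sub (N.cauchySeq_rel R b).tendsto_limUnder).abs <|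
      (eventually_all.2 fun k =>
        (tendsto_dist_approxSeq (a k) (b k)).eventually_lt_const (h k)).mono fun _ hn =>
          N.rel_modulus R ε hε _ _ hn

/-- The canonical map to the completion. -/
def PreStructure.toCompletion {s : L.Srt} (x : N.carrier s) : N.completion.carrier s :=
  (x : Completion (N.carrier s))

theorem PreStructure.dist_toCompletion {s : L.Srt} (x y : N.carrier s) :
    dist (N.toCompletion x) (N.toCompletion y) = dist x y :=
  Completion.dist_eq x y

theorem PreStructure.denseRange_toCompletion (s : L.Srt) :
    DenseRange (N.toCompletion (s := s)) :=
  Completion.denseRange_coe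

theorem PreStructure.completion_fn (f : L.Fn) (x : Tuple N.carrier (L.fnDom f)) :
    N.completion.fn f (fun k => N.toCompletion (x k)) = N.toCompletion (N.fn f x) := by
  refine eq_of_forall_dist_le fun ε hε => ?_
  obtain ⟨q, hq, hqε⟩ := exists_rat_btwn hε
  refine le_trans ?_ hqε.le
  have hq' : 0 < q := by exact_mod_cast hq
  have hpos : (0 : ℝ) < L.fnMod f q := by exact_mod_cast L.fnMod_pos f q hq'
  have : Nonempty (Completion (N.carrier (L.fnCod f))) := N.completion.nonempty (L.fnCod f)
  refine le_of_tendsto ((N.cauchySeq_fn f fun k => N.toCompletion (x k)).tendsto_limUnder.dist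
    (tendsto_const_nhds (x := N.toCompletion (N.fn f x)))) <|
      (eventually_all.2 fun k =>
        (tendsto_dist_approxSeq_coe (x k)).eventually_lt_const hpos).mono fun n hn => ?_
  exact (Completion.dist_eq _ _).trans_le (N.fn_modulus f q hq' _ _ hn)

theorem PreStructure.completion_rel (R : L.Rel) (x : Tuple N.carrier (L.relDom R)) :
    N.completion.rel R (fun k => N.toCompletion (x k)) = N.rel R x := by
  refine eq_of_forall_dist_le fun ε hε => ?_
  obtain ⟨q, hq, hqε⟩ := exists_rat_btwn hε
  refine le_trans ?_ hqε.le
  have hq' : 0 < q := by exact_mod_cast hq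
  have hpos : (0 : ℝ) < L.relMod R q := by exact_mod_cast L.relMod_pos R q hq'
  refine le_of_tendsto ((N.cauchySeq_rel R fun k => N.toCompletion (x k)).tendsto_limUnder.dist
    (tendsto_const_nhds (x := N.rel R x))) <|
      (eventually_all.2 fun k =>
        (tendsto_dist_approxSeq_coe (x k)).eventually_lt_const hpos).mono fun n hn => ?_
  exact N.rel_modulus R q hq' _ _ hn

end Completion

/-! ### Uniform continuity of formulas -/

section UniformContinuity

variable {C : Connectives} {L : MetricLanguage} (N : MetricStructure.{u} L)

theorem MetricStructure.uniformContinuous_fn (f : L.Fn) : UniformContinuous (N.fn f) := by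
  refine Metric.uniformContinuous_iff.2 fun ε hε => ?_
  obtain ⟨q, hq, hqε⟩ := exists_rat_btwn hε
  have hq' : 0 < q := by exact_mod_cast hq
  have hpos : (0 : ℝ) < L.fnMod f q := by exact_mod_cast L.fnMod_pos f q hq'
  exact ⟨_, hpos, fun {x y} h =>
    (N.fn_modulus f q hq' x y ((dist_pi_lt_iff hpos).1 h)).trans_lt hqε⟩

theorem MetricStructure.uniformContinuous_rel (R : L.Rel) : UniformContinuous (N.rel R) := by
  refine Metric.uniformContinuous_iff.2 fun ε hε => ?_
  obtain ⟨q, hq, hqε⟩ := exists_rat_btwn hε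
  have hq' : 0 < q := by exact_mod_cast hq
  have hpos : (0 : ℝ) < L.relMod R q := by exact_mod_cast L.relMod_pos R q hq'
  exact ⟨_, hpos, fun {x y} h =>
    (N.rel_modulus R q hq' x y ((dist_pi_lt_iff hpos).1 h)).trans_lt hqε⟩

theorem Term.uniformContinuous_eval {Γ : List L.Srt} {s : L.Srt} (t : Term L Γ s) :
    UniformContinuous fun v : Tuple N.carrier Γ => t.eval N v := by
  induction t with
  | var i => exact Pi.uniformContinuous_proj _ i
  | func f ts ih => exact (N.uniformContinuous_fn f).comp (uniformContinuous_pi.2 ih)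

theorem dist_tuple_cons_lt {Γ : List L.Srt} {s : L.Srt} (a : N.carrier s)
    {v v' : Tuple N.carrier Γ} {δ : ℝ} (hδ : 0 < δ) (h : dist v v' < δ) :
    dist (Tuple.cons (X := N.carrier) a v : Tuple N.carrier (s :: Γ)) (Tuple.cons a v') < δ := by
  refine (dist_pi_lt_iff hδ).2 ?_
  rintro ⟨_ | i, hi⟩
  · exact (dist_self a).trans_lt hδ
  · exact (dist_pi_lt_iff hδ).1 h ⟨i, _⟩

theorem Formula.bddAbove_range (N : MetricStructure.{u} L) {Γ : List L.Srt} {s : L.Srt}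
    (φ : Formula C L (s :: Γ)) (v : Tuple N.carrier Γ) :
    BddAbove (Set.range fun a : N.carrier s => φ.eval N (Tuple.cons a v)) := by
  obtain ⟨B, hB⟩ := φ.exists_eval_bound N
  exact ⟨B, by rintro _ ⟨a, rfl⟩; exact (abs_le.1 (hB _)).2⟩

theorem Formula.bddBelow_range (N : MetricStructure.{u} L) {Γ : List L.Srt} {s : L.Srt}
    (φ : Formula C L (s :: Γ)) (v : Tuple N.carrier Γ) :
    BddBelow (Set.range fun a : N.carrier s => φ.eval N (Tuple.cons a v)) := by
  obtain ⟨B, hB⟩ := φ.exists_eval_bound N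
  exact ⟨-B, by rintro _ ⟨a, rfl⟩; exact (abs_le.1 (hB _)).1⟩

theorem abs_ciSup_sub_ciSup_le {X : Type u} [Nonempty X] {f g : X → ℝ}
    (hf : BddAbove (Set.range f)) (hg : BddAbove (Set.range g)) {ε : ℝ}
    (h : ∀ x, |f x - g x| ≤ ε) : |(⨆ x, f x) - ⨆ x, g x| ≤ ε := by
  refine abs_sub_le_iff.2 ⟨?_, ?_⟩ <;> rw [sub_le_iff_le_add] <;> refine ciSup_le fun x => ?_
  · linarith [(abs_sub_le_iff.1 (h x)).1, le_ciSup hg x]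
  · linarith [(abs_sub_le_iff.1 (h x)).2, le_ciSup hf x]

theorem abs_ciInf_sub_ciInf_le {X : Type u} [Nonempty X] {f g : X → ℝ}
    (hf : BddBelow (Set.range f)) (hg : BddBelow (Set.range g)) {ε : ℝ}
    (h : ∀ x, |f x - g x| ≤ ε) : |(⨅ x, f x) - ⨅ x, g x| ≤ ε := by
  refine abs_sub_le_iff.2 ⟨?_, ?_⟩ <;> rw [sub_le_comm] <;> refine le_ciInf fun x => ?_
  · linarith [(abs_sub_le_iff.1 (h x)).1, ciInf_le hf x]
  · linarith [(abs_sub_le_iff.1 (h x)).2, ciInf_le hg x]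

theorem Formula.uniformContinuous_eval {Γ : List L.Srt} (φ : Formula C L Γ) :
    UniformContinuous fun v : Tuple N.carrier Γ => φ.eval N v := by
  induction φ with
  | dist s t₁ t₂ =>
    exact (t₁.uniformContinuous_eval N).dist (t₂.uniformContinuous_eval N)
  | rel R ts =>
    exact (N.uniformContinuous_rel R).comp
      (uniformContinuous_pi.2 fun i => (ts i).uniformContinuous_eval N)
  | conn n φs ih =>
    choose B hB using fun i => (φs i).exists_eval_bound N
    have hK : IsCompact (Set.pi Set.univ fun i : Fin (C.u n).1 => Set.Icc (-B i) (B i)) :=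
      isCompact_univ_pi fun _ => isCompact_Icc
    have h1 := hK.uniformContinuousOn_of_continuous (C.continuous_u n).continuousOn
    have h2 : UniformContinuous fun (v : Tuple N.carrier _) i => (φs i).eval N v :=
      uniformContinuous_pi.2 ih
    exact uniformContinuousOn_univ.1 (h1.comp (uniformContinuousOn_univ.2 h2)
      fun v _ i _ => abs_le.1 (hB i v))
  | sup s φ ih =>
    refine Metric.uniformContinuous_iff.2 fun ε hε => ?_
    obtain ⟨δ, hδ, h⟩ := Metric.uniformContinuous_iff.1 ih (ε / 2) (by positivity)
    refine ⟨δ, hδ, fun {v v'} hv => lt_of_le_of_lt ?_ (half_lt_self hε)⟩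
    exact abs_ciSup_sub_ciSup_le (φ.bddAbove_range N v) (φ.bddAbove_range N v')
      fun a => (h (dist_tuple_cons_lt N a hδ hv)).le
  | inf s φ ih =>
    refine Metric.uniformContinuous_iff.2 fun ε hε => ?_
    obtain ⟨δ, hδ, h⟩ := Metric.uniformContinuous_iff.1 ih (ε / 2) (by positivity)
    refine ⟨δ, hδ, fun {v v'} hv => lt_of_le_of_lt ?_ (half_lt_self hε)⟩
    exact abs_ciInf_sub_ciInf_le (φ.bddBelow_range N v) (φ.bddBelow_range N v')
      fun a => (h (dist_tuple_cons_lt N a hδ hv)).le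

theorem Formula.continuous_eval_cons {Γ : List L.Srt} {s : L.Srt} (φ : Formula C L (s :: Γ))
    (v : Tuple N.carrier Γ) : Continuous fun a : N.carrier s => φ.eval N (Tuple.cons a v) := by
  refine (φ.uniformContinuous_eval N).continuous.comp (continuous_pi ?_)
  rintro ⟨_ | i, hi⟩
  · exact continuous_id
  · exact continuous_const

end UniformContinuity

/-! ### The structure of names -/

section Values

variable {L : MetricLanguage} {w : Atom L → Prop}

/-- The truth assignment `w` gives `k` the value `x`: the atoms `k ≤ q` are true for `q > x` and
false for `q < x`. -/
def Rep (w : Atom L → Prop) (k : Obj L) (x : ℝ) : Prop :=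
  ∀ q, (x < ratOf q → w (k, q)) ∧ (w (k, q) → x ≤ ratOf q)

theorem exists_ratOf_btwn {x y : ℝ} (h : x < y) : ∃ q, x < ratOf q ∧ (ratOf q : ℝ) < y := by
  obtain ⟨r, h1, h2⟩ := exists_rat_btwn h
  obtain ⟨q, rfl⟩ := exists_ratOf r
  exact ⟨q, h1, h2⟩

theorem Rep.le_of_forall {k : Obj L} {x y : ℝ} (h : Rep w k x)
    (hy : ∀ q, y < ratOf q → w (k, q)) : x ≤ y := by
  by_contra! hlt
  obtain ⟨q, h1, h2⟩ := exists_ratOf_btwn hlt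
  exact h2.not_ge ((h q).2 (hy q h1))

theorem Rep.ge_of_forall {k : Obj L} {x y : ℝ} (h : Rep w k x)
    (hy : ∀ q, (ratOf q : ℝ) < y → ¬ w (k, q)) : y ≤ x := by
  by_contra! hlt
  obtain ⟨q, h1, h2⟩ := exists_ratOf_btwn hlt
  exact hy q h2 ((h q).1 h1)

/-- The infimum of the rational numbers `q` for which `k ≤ q` is true. -/
def valueOf (w : Atom L → Prop) (k : Obj L) : ℝ :=
  sInf ((fun q => (ratOf q : ℝ)) '' {q | w (k, q)})

/-- `valueOf` is the value that `w` gives to `k`, if the atoms `k ≤ q` are monotone in `q`, false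
for small `q` and true for large `q`. -/
theorem rep_valueOf {k : Obj L} {a b : ℝ} (hmono : ∀ p q, ratOf p < ratOf q → w (k, p) → w (k, q))
    (ha : ∀ q, (ratOf q : ℝ) < a → ¬ w (k, q)) (hb : ∀ q, b < ratOf q → w (k, q)) :
    Rep w k (valueOf w k) := by
  have hbdd : BddBelow ((fun q => (ratOf q : ℝ)) '' {q | w (k, q)}) := by
    refine ⟨a, ?_⟩
    rintro _ ⟨q, hq, rfl⟩
    by_contra! hlt
    exact ha q hlt hq
  have hne : ((fun q => (ratOf q : ℝ)) '' {q | w (k, q)}).Nonempty := by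
    obtain ⟨q, hq, -⟩ := exists_ratOf_btwn (lt_add_one b)
    exact ⟨_, q, hb q hq, rfl⟩
  refine fun q => ⟨fun h => ?_, fun h => csInf_le hbdd ⟨q, h, rfl⟩⟩
  obtain ⟨_, ⟨p, hp, rfl⟩, hpq⟩ := (csInf_lt_iff hbdd hne).1 h
  have hpq' : (ratOf p : ℝ) < ratOf q := hpq
  exact hmono p q (by exact_mod_cast hpq') hp

end Values

section Names

variable {C : Connectives} {L : MetricLanguage} {T : ℕ → Prop} {w : Atom L → Prop}

theorem ratOf_zero : ratOf (0, 0, 0) = 0 := by simp [ratOf]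

theorem sat_mono (hw : ∀ c, Ax C T c → c.Sat w) (k : Obj L) (p q : ℕ × ℕ × ℕ)
    (h : ratOf p < ratOf q) (hp : w (k, p)) : w (k, q) := by
  have := hw _ (.mono k p q h)
  simp only [Clause.sat_imp, List.forall_mem_singleton, le_iff] at this
  exact this hp

theorem rep_dist (hw : ∀ c, Ax C T c → c.Sat w) (s : L.Srt) (x y : ℕ) :
    Rep w (distAt s x y) (valueOf w (distAt s x y)) := by
  refine rep_valueOf (a := 0) (b := L.diam s) (sat_mono hw _) (fun q hq => ?_) fun q hq => ?_
  · have := hw _ (.dist_nonneg s x y q (by rw [ratOf_zero]; exact_mod_cast hq))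
    simpa [Clause.sat_imp, gt_iff] using this
  · have := hw _ (.dist_diam s x y q (by exact_mod_cast hq))
    simpa [Clause.sat_imp, le_iff] using this

theorem rep_rel (hw : ∀ c, Ax C T c → c.Sat w) (R : L.Rel) (xs : List ℕ) :
    Rep w (relAt R xs) (valueOf w (relAt R xs)) := by
  refine rep_valueOf (a := L.relLo R) (b := L.relHi R) (sat_mono hw _) (fun q hq => ?_)
    fun q hq => ?_
  · have := hw _ (.rel_lo R xs q (by exact_mod_cast hq))
    simpa [Clause.sat_imp, gt_iff] using this
  · have := hw _ (.rel_hi R xs q (by exact_mod_cast hq))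
    simpa [Clause.sat_imp, le_iff] using this

/-- The names, as points of the structure that a truth assignment determines. -/
def NamePoint : Type u := ULift.{u} ℕ

/-- The pseudometric on names of the sort `s`. -/
@[reducible]
def nameMetric (hw : ∀ c, Ax C T c → c.Sat w) (s : L.Srt) : PseudoMetricSpace NamePoint.{u} where
  dist x y := valueOf w (distAt s x.down y.down)
  dist_self x := by
    refine le_antisymm ((rep_dist hw s _ _).le_of_forall fun q hq => ?_)
      ((rep_dist hw s _ _).ge_of_forall fun q hq => ?_)
    · have := hw _ (.dist_self s x.down q (by rw [ratOf_zero]; exact_mod_cast hq))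
      simpa [Clause.sat_imp, le_iff] using this
    · have := hw _ (.dist_nonneg s x.down x.down q (by rw [ratOf_zero]; exact_mod_cast hq))
      simpa [Clause.sat_imp, gt_iff] using this
  dist_comm x y := by
    have key : ∀ x y : ℕ, valueOf w (distAt s x y) ≤ valueOf w (distAt s y x) := by
      intro x y
      refine (rep_dist hw s _ _).le_of_forall fun q hq => ?_
      have := hw _ (.dist_symm s y x q)
      simp only [Clause.sat_imp, List.forall_mem_singleton, le_iff] at this
      exact this ((rep_dist hw s y x q).1 hq)
    exact le_antisymm (key _ _) (key _ _)
  dist_triangle x y z := by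
    refine le_of_forall_pos_lt_add fun ε hε => ?_
    obtain ⟨p, hp1, hp2⟩ := exists_ratOf_btwn
      (lt_add_of_pos_right (valueOf w (distAt s x.down y.down)) (half_pos hε))
    obtain ⟨q, hq1, hq2⟩ := exists_ratOf_btwn
      (lt_add_of_pos_right (valueOf w (distAt s y.down z.down)) (half_pos hε))
    have := hw _ (.dist_triangle s x.down y.down z.down p q)
    simp only [Clause.sat_imp, List.forall_mem_cons, List.not_mem_nil, false_implies,
      implies_true, and_true, le_iff] at this
    have h := (rep_dist hw s _ _ _).2
      (this ⟨(rep_dist hw s _ _ p).1 hp1, (rep_dist hw s _ _ q).1 hq1⟩)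
    rw [ratOf_qAdd] at h
    push_cast at h
    linarith

/-- Finitely many real numbers less than a rational number have a common rational upper bound
that is less than it. -/
theorem exists_ratOf_forall_lt {n : ℕ} {x : Fin n → ℝ} {r : ℚ} (h : ∀ i, x i < r) :
    ∃ q, ratOf q < r ∧ ∀ i, x i < ratOf q := by
  have h1 : ∀ᶠ t in 𝓝[<] (r : ℝ), (∀ i, x i < t) ∧ t < r :=
    (eventually_all.2 fun i => eventually_nhdsWithin_of_eventually_nhds
      (eventually_gt_nhds (h i))).and self_mem_nhdsWithin
  obtain ⟨t, ht, htr⟩ := h1.exists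
  obtain ⟨q, hq1, hq2⟩ := exists_ratOf_btwn htr
  exact ⟨q, by exact_mod_cast hq2, fun i => (ht i).trans hq1⟩

theorem map_ofFn_triple {Δ : List L.Srt} (x y : Fin Δ.length → ℕ) :
    ((List.ofFn fun i => (Δ.get i, x i, y i)).map fun p => p.1) = Δ ∧
    ((List.ofFn fun i => (Δ.get i, x i, y i)).map fun p => p.2.1) = List.ofFn x ∧
    ((List.ofFn fun i => (Δ.get i, x i, y i)).map fun p => p.2.2) = List.ofFn y := by
  simp [List.map_ofFn, Function.comp_def]

theorem sat_fn_mod (hw : ∀ c, Ax C T c → c.Sat w) (f : L.Fn) (ε : ℚ) (hε : 0 < ε)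
    (x y : Fin (L.fnDom f).length → ℕ)
    (h : ∀ i, valueOf w (distAt ((L.fnDom f).get i) (x i) (y i)) < L.fnMod f ε) :
    valueOf w (distAt (L.fnCod f) (name (.inr (.inl f)) (List.ofFn x))
      (name (.inr (.inl f)) (List.ofFn y))) ≤ ε := by
  obtain ⟨e, rfl⟩ := exists_ratOf ε
  obtain ⟨δ, hδ, hxy⟩ := exists_ratOf_forall_lt h
  obtain ⟨h1, h2, h3⟩ := map_ofFn_triple x y
  have := hw _ (.fn_mod f _ _ e δ rfl h1.symm (by rwa [ratOf_zero]) hδ)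
  simp only [Clause.sat_imp, forall_closeLits_iff, le_iff, h2, h3] at this
  refine (rep_dist hw _ _ _ e).2 (this ?_)
  intro p hp
  obtain ⟨i, rfl⟩ := List.mem_ofFn.1 hp
  exact (rep_dist hw _ _ _ δ).1 (hxy i)

theorem sat_rel_mod (hw : ∀ c, Ax C T c → c.Sat w) (R : L.Rel) (ε : ℚ) (hε : 0 < ε)
    (x y : Fin (L.relDom R).length → ℕ)
    (h : ∀ i, valueOf w (distAt ((L.relDom R).get i) (x i) (y i)) < L.relMod R ε) :
    valueOf w (relAt R (List.ofFn y)) ≤ valueOf w (relAt R (List.ofFn x)) + ε := by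
  obtain ⟨e, rfl⟩ := exists_ratOf ε
  obtain ⟨δ, hδ, hxy⟩ := exists_ratOf_forall_lt h
  obtain ⟨h1, h2, h3⟩ := map_ofFn_triple x y
  refine le_of_forall_pos_lt_add fun η hη => ?_
  obtain ⟨p, hp1, hp2⟩ := exists_ratOf_btwn
    (lt_add_of_pos_right (valueOf w (relAt R (List.ofFn x))) hη)
  have := hw _ (.rel_mod R _ e δ p h1.symm (by rwa [ratOf_zero]) hδ)
  simp only [Clause.sat_imp, List.forall_mem_cons, forall_closeLits_iff, le_iff, h2, h3] at this
  have h4 := (rep_rel hw R (List.ofFn y) _).2 (this ⟨(rep_rel hw R _ p).1 hp1, ?_⟩)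
  · rw [ratOf_qAdd] at h4
    push_cast at h4
    linarith
  · intro p hp
    obtain ⟨i, rfl⟩ := List.mem_ofFn.1 hp
    exact (rep_dist hw _ _ _ δ).1 (hxy i)

/-- The structure of names that is determined by a truth assignment which satisfies the axioms. All
names are points of all sorts; the sorts differ in their metrics. -/
def nameStructure (hw : ∀ c, Ax C T c → c.Sat w) : PreStructure.{u} L where
  carrier _ := NamePoint
  metric s := nameMetric hw s
  nonempty _ := ⟨⟨0⟩⟩
  dist_le_diam s x y := by
    refine (rep_dist hw s x.down y.down).le_of_forall fun q hq => ?_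
    have := hw _ (.dist_diam s x.down y.down q (by exact_mod_cast hq))
    simpa [Clause.sat_imp, le_iff] using this
  fn f x := ⟨name (.inr (.inl f)) (List.ofFn fun i => (x i).down)⟩
  fn_modulus f ε hε x y h := sat_fn_mod hw f ε hε _ _ h
  rel R x := valueOf w (relAt R (List.ofFn fun i => (x i).down))
  rel_mem R x := by
    refine ⟨(rep_rel hw R _).ge_of_forall fun q hq => ?_,
      (rep_rel hw R _).le_of_forall fun q hq => ?_⟩
    · have := hw _ (.rel_lo R (List.ofFn fun i => (x i).down) q (by exact_mod_cast hq))
      simpa [Clause.sat_imp, gt_iff] using this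
    · have := hw _ (.rel_hi R (List.ofFn fun i => (x i).down) q (by exact_mod_cast hq))
      simpa [Clause.sat_imp, le_iff] using this
  rel_modulus R ε hε x y h := by
    have h1 := sat_rel_mod hw R ε hε (fun i => (x i).down) (fun i => (y i).down) h
    have h2 := sat_rel_mod hw R ε hε (fun i => (y i).down) (fun i => (x i).down) fun i =>
      ((nameMetric hw ((L.relDom R).get i)).dist_comm (y i) (x i)).trans_lt (h i)
    exact abs_sub_le_iff.2 ⟨by linarith, by linarith⟩

/-- The completed structure of names. -/
def henkinModel (hw : ∀ c, Ax C T c → c.Sat w) : MetricStructure.{u} L :=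
  (nameStructure.{u} hw).completion

/-- The point with a given name. -/
def namedPoint (hw : ∀ c, Ax C T c → c.Sat w) (s : L.Srt) (x : ℕ) :
    (henkinModel.{u} hw).carrier s :=
  (nameStructure.{u} hw).toCompletion (s := s) ⟨x⟩

theorem dist_namedPoint (hw : ∀ c, Ax C T c → c.Sat w) (s : L.Srt) (x y : ℕ) :
    dist (namedPoint.{u} hw s x) (namedPoint hw s y) = valueOf w (distAt s x y) :=
  PreStructure.dist_toCompletion _ _ _

theorem namedPoint_eq (hw : ∀ c, Ax C T c → c.Sat w) {s : L.Srt} {x y : ℕ}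
    (h : ∀ q, ratOf (0, 0, 0) < ratOf q → w (distAt s x y, q)) :
    namedPoint.{u} hw s x = namedPoint hw s y := by
  refine dist_le_zero.1 ?_
  rw [dist_namedPoint]
  exact (rep_dist hw s x y).le_of_forall fun q hq =>
    h q (by rw [ratOf_zero]; exact_mod_cast hq)

theorem denseRange_namedPoint (hw : ∀ c, Ax C T c → c.Sat w) (s : L.Srt) :
    DenseRange (namedPoint.{u} hw s) := by
  have h := (nameStructure.{u} hw).denseRange_toCompletion s
  refine h.mono ?_
  rintro _ ⟨x, rfl⟩
  exact ⟨x.down, rfl⟩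

theorem henkinModel_fn (hw : ∀ c, Ax C T c → c.Sat w) (f : L.Fn)
    (x : Fin (L.fnDom f).length → ℕ) :
    (henkinModel.{u} hw).fn f (fun i => namedPoint hw _ (x i)) =
      namedPoint hw _ (name (.inr (.inl f)) (List.ofFn x)) :=
  (nameStructure.{u} hw).completion_fn f fun i => ⟨x i⟩

theorem henkinModel_rel (hw : ∀ c, Ax C T c → c.Sat w) (R : L.Rel)
    (x : Fin (L.relDom R).length → ℕ) :
    (henkinModel.{u} hw).rel R (fun i => namedPoint hw _ (x i)) =
      valueOf w (relAt R (List.ofFn x)) :=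
  (nameStructure.{u} hw).completion_rel R fun i => ⟨x i⟩

theorem eval_term_henkinModel (hw : ∀ c, Ax C T c → c.Sat w) {Γ : List L.Srt} {ρ : List ℕ}
    {v : Tuple (henkinModel.{u} hw).carrier Γ}
    (hρ : ∀ i : Fin Γ.length, ∃ x, ρ[i.1]? = some x ∧ v i = namedPoint hw (Γ.get i) x)
    {s : L.Srt} (t : Term L Γ s) :
    t.eval (henkinModel.{u} hw) v = namedPoint hw s (name (.inl t.code : Head L) ρ) := by
  induction t with
  | var i =>
    obtain ⟨x, hx, hv⟩ := hρ i
    rw [Term.eval, hv]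
    refine (namedPoint_eq hw fun q hq => ?_).symm
    have := hw _ (.term_var (Γ.get i) i ρ x q hx hq)
    simpa [Clause.sat_imp, le_iff, Term.code] using this
  | func f ts ih =>
    rw [Term.eval, funext ih, henkinModel_fn]
    refine (namedPoint_eq hw fun q hq => ?_).symm
    have := hw _ (.term_func (L.fnCod f) f (List.ofFn fun i => (ts i).code) ρ q hq)
    simpa [Clause.sat_imp, le_iff, Term.code, List.map_ofFn, Function.comp_def] using this

theorem Rep.congr {k k' : Obj L} {x : ℝ} (h : Rep w k x) (h1 : ∀ q, w (k, q) → w (k', q))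
    (h2 : ∀ q, w (k', q) → w (k, q)) : Rep w k' x :=
  fun q => ⟨fun hq => h1 q ((h q).1 hq), fun hq => (h q).2 (h2 q hq)⟩

/-- The axioms on connectives determine their values, as the approximations are arbitrarily good. -/
theorem rep_conn (hw : ∀ c, Ax C T c → c.Sat w) (n : ℕ) (φ : Fin (C.u n).1 → ℕ) (ρ : List ℕ)
    (x : Fin (C.u n).1 → ℝ) (h : ∀ i, Rep w (fmAt (φ i) ρ) (x i)) :
    Rep w (fmAt (Nat.pair 2 (Nat.pair n (Encodable.encode (List.ofFn φ)))) ρ) ((C.u n).2 x) := by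
  -- for each `m`, one axiom determines the value of the connective up to `5 / 2 ^ m`
  have key : ∀ m : ℕ, ∃ g : ℕ × ℕ × ℕ, |(ratOf g : ℝ) - (C.u n).2 x| ≤ 2 * (1 / 2) ^ m ∧
      w (fmAt (Nat.pair 2 (Nat.pair n (Encodable.encode (List.ofFn φ)))) ρ,
        qAdd g (qDyadic 2 m)) ∧
      ¬ w (fmAt (Nat.pair 2 (Nat.pair n (Encodable.encode (List.ofFn φ)))) ρ,
        qAdd g (qNeg (qDyadic 3 m))) := by
    intro m
    -- the rational approximations `q i` lie within distance `1` of the `x i`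
    obtain ⟨B, hB⟩ : ∃ B : ℕ, ∀ i, |x i| + 2 < B := by
      obtain ⟨B, hB⟩ := exists_nat_gt (∑ i, |x i| + 2)
      exact ⟨B, fun i => lt_of_le_of_lt (by
        linarith [Finset.single_le_sum (f := fun i => |x i|) (fun j _ => abs_nonneg (x j))
          (Finset.mem_univ i)]) hB⟩
    set d := C.modulus (n, B, m) with hd
    have hd0 : (0 : ℝ) < (1 / 2) ^ d := by positivity
    have hd1 : ((1 : ℝ) / 2) ^ d ≤ 1 := pow_le_one₀ (by norm_num) (by norm_num)
    have hq : ∀ i, ∃ q, x i - (1 / 2) ^ d < ratOf q ∧ (ratOf q : ℝ) < x i + (1 / 2) ^ d :=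
      fun i => exists_ratOf_btwn (by linarith)
    choose q hq1 hq2 using hq
    have e1 : ((List.ofFn fun i => (φ i, q i)).map fun p => p.1) = List.ofFn φ := by
      simp [List.map_ofFn, Function.comp_def]
    have e2 : ((List.ofFn fun i => (φ i, q i)).map fun p => p.2) = List.ofFn q := by
      simp [List.map_ofFn, Function.comp_def]
    have hside : ∀ p ∈ List.ofFn fun i => (φ i, q i),
        ratOf (qAdd p.2 (1, 0, 0)) < ratOf (B, 0, 0) ∧
          ratOf (qAdd (qNeg p.2) (1, 0, 0)) < ratOf (B, 0, 0) := by
      intro p hp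
      obtain ⟨i, rfl⟩ := List.mem_ofFn.1 hp
      have h1 : ratOf (1, 0, 0) = 1 := by simp [ratOf]
      have h2 : ratOf (B, 0, 0) = B := by simp [ratOf]
      simp only [ratOf_qAdd, ratOf_qNeg, h1, h2]
      have h3 : (ratOf (q i) : ℝ) + 1 < B := by linarith [hB i, le_abs_self (x i), hq2 i]
      have h4 : -(ratOf (q i) : ℝ) + 1 < B := by linarith [hB i, neg_abs_le (x i), hq1 i]
      exact ⟨by exact_mod_cast h3, by exact_mod_cast h4⟩
    have hlits : ∀ p ∈ List.ofFn fun i => (φ i, q i), w (fmAt p.1 ρ, qAdd p.2 (qDyadic 1 d)) ∧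
        ¬ w (fmAt p.1 ρ, qAdd p.2 (qNeg (qDyadic 1 d))) := by
      intro p hp
      obtain ⟨i, rfl⟩ := List.mem_ofFn.1 hp
      refine ⟨(h i _).1 ?_, fun hcon => ?_⟩
      · rw [ratOf_qAdd, ratOf_qDyadic]
        push_cast
        linarith [hq1 i]
      · have := (h i _).2 hcon
        rw [ratOf_qAdd, ratOf_qNeg, ratOf_qDyadic] at this
        push_cast at this
        linarith [hq2 i]
    refine ⟨C.approx (n, List.ofFn q, m), ?_, ?_, ?_⟩
    · refine C.abs_approx_sub_le n _ B m (by simp) x (fun i => ?_) fun i => ?_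
      · have h1 : |(ratOf (q i) : ℝ)| ≤ |x i| + 1 :=
          abs_le.2 ⟨by linarith [neg_abs_le (x i), hq1 i], by linarith [le_abs_self (x i), hq2 i]⟩
        simp only [List.getElem_ofFn]
        linarith [hB i]
      · simp only [List.getElem_ofFn]
        exact abs_le.2 ⟨by linarith [hq2 i], by linarith [hq1 i]⟩
    · have := hw _ (.conn_le n _ B m d _ ρ (by simp) hd.symm rfl hside)
      simp only [Clause.sat_imp, forall_boxLits_iff, le_iff, e1, e2] at this
      exact this hlits
    · have := hw _ (.le_conn n _ B m d _ ρ (by simp) hd.symm rfl hside)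
      simp only [Clause.sat_imp, forall_boxLits_iff, gt_iff, e1, e2] at this
      exact this hlits
  have hsmall : ∀ ε : ℝ, 0 < ε → ∃ m : ℕ, 5 * (1 / 2) ^ m < ε := by
    intro ε hε
    obtain ⟨m, hm⟩ := exists_pow_lt_of_lt_one (by positivity : 0 < ε / 5)
      (by norm_num : (1 / 2 : ℝ) < 1)
    exact ⟨m, by linarith⟩
  intro p
  constructor
  · intro hp
    obtain ⟨m, hm⟩ := hsmall _ (sub_pos.2 hp)
    obtain ⟨g, hg, hle, -⟩ := key m
    refine sat_mono hw _ _ _ ?_ hle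
    have h0 : (0 : ℝ) < (1 / 2) ^ m := by positivity
    have h1 : (ratOf (qAdd g (qDyadic 2 m)) : ℝ) < ratOf p := by
      rw [ratOf_qAdd, ratOf_qDyadic]
      push_cast
      linarith [(abs_le.1 hg).2]
    exact_mod_cast h1
  · intro hp
    by_contra! hlt
    obtain ⟨m, hm⟩ := hsmall _ (sub_pos.2 hlt)
    obtain ⟨g, hg, -, hgt⟩ := key m
    refine hgt (sat_mono hw _ _ _ ?_ hp)
    have h1 : (ratOf p : ℝ) < ratOf (qAdd g (qNeg (qDyadic 3 m))) := by
      rw [ratOf_qAdd, ratOf_qNeg, ratOf_qDyadic]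
      push_cast
      linarith [(abs_le.1 hg).1]
    exact_mod_cast h1

theorem exists_getElem?_cons (hw : ∀ c, Ax C T c → c.Sat w) {Γ : List L.Srt} {ρ : List ℕ}
    {v : Tuple (henkinModel.{u} hw).carrier Γ}
    (hρ : ∀ i : Fin Γ.length, ∃ x, ρ[i.1]? = some x ∧ v i = namedPoint hw (Γ.get i) x)
    (s : L.Srt) (y : ℕ) (i : Fin (s :: Γ).length) :
    ∃ x, (y :: ρ)[i.1]? = some x ∧
      Tuple.cons (X := (henkinModel.{u} hw).carrier) (namedPoint hw s y) v i =
        namedPoint hw ((s :: Γ).get i) x := by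
  obtain ⟨_ | i, hi⟩ := i
  · exact ⟨y, rfl, rfl⟩
  · exact hρ ⟨i, Nat.lt_of_succ_lt_succ hi⟩

/-- The values that the truth assignment gives to formulas are their values in the structure of
names. The Henkin witnesses are used for the quantifiers. -/
theorem rep_eval_henkinModel (hw : ∀ c, Ax C T c → c.Sat w) {Γ : List L.Srt}
    (φ : Formula C L Γ) {ρ : List ℕ} {v : Tuple (henkinModel.{u} hw).carrier Γ}
    (hρ : ∀ i : Fin Γ.length, ∃ x, ρ[i.1]? = some x ∧ v i = namedPoint hw (Γ.get i) x) :
    Rep w (fmAt φ.code ρ) (φ.eval (henkinModel.{u} hw) v) := by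
  induction φ generalizing ρ with
  | dist s t₁ t₂ =>
    rw [Formula.eval, eval_term_henkinModel hw hρ, eval_term_henkinModel hw hρ, dist_namedPoint]
    refine (rep_dist hw _ _ _).congr (fun q hq => ?_) fun q hq => ?_
    · have := hw _ (.dist_le s t₁.code t₂.code ρ q)
      simp only [Clause.sat_imp, List.forall_mem_singleton, le_iff] at this
      exact this hq
    · have := hw _ (.le_dist s t₁.code t₂.code ρ q)
      simp only [Clause.sat_imp, List.forall_mem_singleton, le_iff] at this
      exact this hq
  | rel R ts =>
    have e : ((List.ofFn fun i => (ts i).code).map fun t => name (.inl t : Head L) ρ) =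
        List.ofFn fun i => name (.inl (ts i).code : Head L) ρ := by
      simp [List.map_ofFn, Function.comp_def]
    rw [Formula.eval, funext fun i => eval_term_henkinModel hw hρ (ts i), henkinModel_rel]
    refine (rep_rel hw _ _).congr (fun q hq => ?_) fun q hq => ?_
    · have := hw _ (.rel_le R (List.ofFn fun i => (ts i).code) ρ q)
      simp only [Clause.sat_imp, List.forall_mem_singleton, le_iff, e] at this
      exact this hq
    · have := hw _ (.le_rel R (List.ofFn fun i => (ts i).code) ρ q)
      simp only [Clause.sat_imp, List.forall_mem_singleton, le_iff, e] at this
      exact this hq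
  | conn n φs ih => exact rep_conn hw n _ ρ _ fun i => ih i hρ
  | sup s φ ih =>
    have ih' := fun y => ih (exists_getElem?_cons hw hρ s y)
    rw [Formula.code, Formula.eval]
    refine fun q => ⟨fun hq => ?_, fun hq => ciSup_le fun a => ?_⟩
    · by_contra hcon
      have := hw _ (.sup_gt (Encodable.encode s) φ.code ρ q)
      simp only [Clause.sat_imp, List.forall_mem_singleton, gt_iff] at this
      refine this hcon ((ih' _ q).1 (lt_of_le_of_lt ?_ hq))
      exact le_ciSup (φ.bddAbove_range (henkinModel.{u} hw) v) _
    · refine (denseRange_namedPoint.{u} hw s).induction_on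
        (p := fun a => φ.eval (henkinModel.{u} hw) (Tuple.cons a v) ≤ ratOf q) a
        (isClosed_le (φ.continuous_eval_cons _ v) continuous_const) fun y => ?_
      have := hw _ (.sup_le (Encodable.encode s) φ.code ρ y q)
      simp only [Clause.sat_imp, List.forall_mem_singleton, le_iff] at this
      exact (ih' y q).2 (this hq)
  | inf s φ ih =>
    have ih' := fun y => ih (exists_getElem?_cons hw hρ s y)
    rw [Formula.code, Formula.eval]
    refine fun q => ⟨fun hq => ?_, fun hq => ?_⟩
    · obtain ⟨a, ha⟩ := exists_lt_of_ciInf_lt hq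
      obtain ⟨y, hy⟩ := (denseRange_namedPoint.{u} hw s).exists_mem_open
        (isOpen_lt (φ.continuous_eval_cons _ v) continuous_const) ⟨a, ha⟩
      have := hw _ (.inf_le (Encodable.encode s) φ.code ρ y q)
      simp only [Clause.sat_imp, List.forall_mem_singleton, le_iff] at this
      exact this ((ih' y q).1 hy)
    · by_contra! hlt
      obtain ⟨p, hp1, hp2⟩ := exists_ratOf_btwn hlt
      have := hw _ (.le_inf (Encodable.encode s) φ.code ρ q p (by exact_mod_cast hp1))
      simp only [Clause.sat_imp, List.forall_mem_singleton, le_iff] at this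
      refine hp2.not_ge (le_trans ?_ ((ih' _ p).2 (this hq)))
      exact ciInf_le (φ.bddBelow_range (henkinModel.{u} hw) v) _

theorem rep_sentence_henkinModel (hw : ∀ c, Ax C T c → c.Sat w) (σ : Sentence C L) :
    Rep w (fmAt σ.code []) (Sentence.value (henkinModel.{u} hw) σ) :=
  rep_eval_henkinModel hw σ fun i => i.elim0

/-- Hence the structure of names is a model of the sentences with codes in `T`. -/
theorem models_henkinModel {S : Set (Sentence C L)} (hS : ∀ σ ∈ S, T σ.code)
    (hw : ∀ c, Ax C T c → c.Sat w) : Models (henkinModel.{u} hw) S := by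
  intro σ hσ
  refine le_antisymm ((rep_sentence_henkinModel hw σ).le_of_forall fun q hq => ?_)
    ((rep_sentence_henkinModel hw σ).ge_of_forall fun q hq => ?_)
  · have := hw _ (.theory_le σ.code q (hS σ hσ) (by rw [ratOf_zero]; exact_mod_cast hq))
    simpa [Clause.sat_imp, le_iff] using this
  · have := hw _ (.theory_ge σ.code q (hS σ hσ) (by rw [ratOf_zero]; exact_mod_cast hq))
    simpa [Clause.sat_imp, gt_iff] using this

end Names

/-! ### Universal sentences and embeddings into ultrapowers -/

section Ultrapower

variable {C : Connectives} {L : MetricLanguage} {M N : MetricStructure.{u} L} {I : Type u}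
  {U : Ultrafilter I}

theorem Term.eval_ultrapower (e : Embedding N (ultrapower U M)) {Γ : List L.Srt}
    {v : Tuple N.carrier Γ} {x : I → Tuple M.carrier Γ}
    (hx : ∀ k, e.toFun _ (v k) = UltraSpace.mk U fun i => x i k) {s : L.Srt} (t : Term L Γ s) :
    e.toFun s (t.eval N v) = UltraSpace.mk U fun i => t.eval M (x i) := by
  induction t with
  | var k => exact hx k
  | func f ts ih =>
    simp only [Term.eval]
    rw [e.map_fn, funext ih]
    exact ultrapower_fn_mk U M f fun i k => (ts k).eval M (x i)

/-- The theorem of Łoś for quantifier-free formulas, combined with the invariance of their values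
under embeddings. -/
theorem Formula.IsQF.tendsto_eval (e : Embedding N (ultrapower U M)) {Γ : List L.Srt}
    {φ : Formula C L Γ} (hφ : φ.IsQF) {v : Tuple N.carrier Γ} {x : I → Tuple M.carrier Γ}
    (hx : ∀ k, e.toFun _ (v k) = UltraSpace.mk U fun i => x i k) :
    Tendsto (fun i => φ.eval M (x i)) U (𝓝 (φ.eval N v)) := by
  induction hφ with
  | dist s t₁ t₂ =>
    simp only [Formula.eval]
    rw [← (e.isometry s).dist_eq, Term.eval_ultrapower e hx, Term.eval_ultrapower e hx]
    exact UltraSpace.tendsto_dist_mk U _ _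
  | rel R ts =>
    simp only [Formula.eval]
    rw [← e.map_rel, funext fun k => Term.eval_ultrapower e hx (ts k)]
    exact tendsto_ultrapower_rel_mk U M R fun i k => (ts k).eval M (x i)
  | conn n φs h ih =>
    simp only [Formula.eval]
    exact ((C.continuous_u n).tendsto _).comp (tendsto_pi_nhds.2 ih)

/-- An upper bound for the values of a universal formula at tuples of `M` carries over to their
ultralimits, since a point of `N` is the class of a family of points of `M`. -/
theorem Formula.IsUniversal.eval_le (e : Embedding N (ultrapower U M)) {Γ : List L.Srt}
    {φ : Formula C L Γ} (hφ : φ.IsUniversal) {v : Tuple N.carrier Γ} {x : I → Tuple M.carrier Γ}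
    (hx : ∀ k, e.toFun _ (v k) = UltraSpace.mk U fun i => x i k) {c : ℝ}
    (hc : ∀ i, φ.eval M (x i) ≤ c) : φ.eval N v ≤ c := by
  induction hφ with
  | qf φ h => exact le_of_tendsto' (h.tendsto_eval e hx) hc
  | sup s φ h ih =>
    rw [Formula.eval]
    refine ciSup_le fun a => ?_
    refine ih (x := fun i => Tuple.cons (UltraSpace.rep U (e.toFun s a) i) (x i)) ?_ fun i => ?_
    · rintro ⟨_ | k, hk⟩
      · exact (UltraSpace.mk_rep U (e.toFun s a)).symm
      · exact hx ⟨k, Nat.lt_of_succ_lt_succ hk⟩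
    · exact (le_ciSup (φ.bddAbove_range M (x i)) _).trans (hc i)

/-- The values of universal sentences do not increase when one passes to a structure that embeds
into an ultrapower. -/
theorem Formula.IsUniversal.value_le (e : Embedding N (ultrapower U M)) {σ : Sentence C L}
    (hσ : σ.IsUniversal) : Sentence.value N σ ≤ Sentence.value M σ :=
  hσ.eval_le e (v := fun i => i.elim0) (x := fun _ i => i.elim0) (fun k => k.elim0) fun _ => le_rfl

end Ultrapower

/-! ### Enumeration of the universal theory -/

section Enumeration

variable {C : Connectives} {L : MetricLanguage}

/-- The clauses which say that the structure is a model of `T` in which the sentence with code `m`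
has a value greater than `p`. -/
def refutation (C : Connectives) (L : MetricLanguage) (T : ℕ → Prop) (a : ℕ × (ℕ × ℕ × ℕ)) :
    Set (Clause (Atom L)) :=
  {c | Ax C T c ∨ [gt (fmAt a.1 []) a.2] = c}

theorem rePred_refutation (hL : L.IsComputable) {T : ℕ → Prop} (hT : REPred T) :
    REPred fun a => ¬ ∃ w : Atom L → Prop, ∀ c ∈ refutation C L T a, c.Sat w :=
  REPred.unsat (((rePred_ax C hL hT).comp_primrec Primrec.snd).or
    (REPred.of_primrecPred (primrecPred_eq (by fun_prop) (by fun_prop))))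

theorem sat_singleton_gt {w : Atom L → Prop} (k : Obj L) (q : ℕ × ℕ × ℕ) :
    Clause.Sat w [gt k q] ↔ ¬ w (k, q) := by
  simp only [Clause.Sat, List.mem_singleton, exists_eq_left, gt_iff]

/-- The completeness theorem for universal sentences: `σ^M < r` holds if and only if the axioms
refute `σ > p` for some `p < r`. -/
theorem value_lt_iff {M : MetricStructure.{u} L} {T : Set (Sentence C L)}
    (hTM : T ⊆ fullTheory C M)
    (hT : ∀ N : MetricStructure.{u} L, Models N T →
      ∃ (I : Type u) (U : Ultrafilter I), Nonempty (Embedding N (ultrapower U M)))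
    {σ : Sentence C L} (hσ : σ.IsUniversal) (r : ℚ) :
    Sentence.value M σ < r ↔ ∃ p, ratOf p < r ∧
      ¬ ∃ w : Atom L → Prop, ∀ c ∈ refutation C L (fun n => ∃ τ ∈ T, τ.code = n) (σ.code, p),
        c.Sat w := by
  constructor
  · intro h
    obtain ⟨p, hp1, hp2⟩ := exists_ratOf_btwn h
    refine ⟨p, by exact_mod_cast hp2, ?_⟩
    rintro ⟨w, hw⟩
    have hax : ∀ c, Ax C (fun n => ∃ τ ∈ T, τ.code = n) c → c.Sat w := fun c hc => hw c (.inl hc)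
    obtain ⟨I, U, ⟨e⟩⟩ := hT (henkinModel.{u} hax)
      (models_henkinModel (fun τ hτ => ⟨τ, hτ, rfl⟩) hax)
    have h1 := (sat_singleton_gt _ _).1 (hw _ (.inr rfl))
    exact h1 ((rep_sentence_henkinModel hax σ p).1 ((hσ.value_le e).trans_lt hp1))
  · rintro ⟨p, hp, hw⟩
    by_contra! hlt
    refine hw ⟨truthIn C M, ?_⟩
    rintro c (hc | rfl)
    · refine ax_sat C M ?_ hc
      rintro _ ⟨τ, hτ, rfl⟩
      rw [rawVal_sentence]
      exact hTM hτ
    · rw [sat_singleton_gt, truthIn_mk, objVal_fmAt, List.map_nil, rawVal_sentence, not_le]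
      exact lt_of_lt_of_le (by exact_mod_cast hp) hlt

/-- The code of `σ ∸ r` is computed from the code of `σ` and the index of multiplication by `r`. -/
theorem code_dotminusRat (σ : Sentence C L) (r : ℚ) : (σ.dotminusRat r).code =
    Nat.pair 2 (Nat.pair C.dotminus (Encodable.encode [σ.code,
      Nat.pair 2 (Nat.pair (C.scale r) (Encodable.encode [Nat.pair 2 (Nat.pair C.one
        (Encodable.encode [σ.code]))]))])) := by
  have key : ∀ (k n : ℕ) (hk : (C.u n).1 = k) (g : Fin k → ℕ),
      (List.ofFn fun i : Fin (C.u n).1 => g (i.cast hk)) = List.ofFn g := by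
    rintro _ n rfl g
    rfl
  have hone : (C.u C.one).1 = 1 := congrArg Sigma.fst C.u_one
  have hscale : (C.u (C.scale r)).1 = 1 := congrArg Sigma.fst (C.u_scale r)
  have hdot : (C.u C.dotminus).1 = 2 := congrArg Sigma.fst C.u_dotminus
  have e1 : (Formula.conn C.one fun _ => σ : Sentence C L).code =
      Nat.pair 2 (Nat.pair C.one (Encodable.encode [σ.code])) := by
    simp only [Formula.code]
    rw [key 1 C.one hone fun _ => σ.code]
    simp
  have e2 : (Formula.conn (C.scale r) fun _ => .conn C.one fun _ => σ : Sentence C L).code =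
      Nat.pair 2 (Nat.pair (C.scale r) (Encodable.encode [Nat.pair 2 (Nat.pair C.one
        (Encodable.encode [σ.code]))])) := by
    rw [Formula.code, ← e1,
      key 1 _ hscale fun _ => (Formula.conn C.one fun _ => σ : Sentence C L).code]
    simp
  rw [Formula.dotminusRat, Formula.code, ← e2]
  rw [key 2 C.dotminus hdot fun i => (![σ, .conn (C.scale r) fun _ => .conn C.one fun _ => σ] i :
    Sentence C L).code]
  simp [List.ofFn_succ]

end Enumeration

end ContLogic

end

theorem mainTheorem4 (C : ContLogic.Connectives) (L : ContLogic.MetricLanguage)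
    (hL : L.IsComputable) (M : ContLogic.MetricStructure.{u} L) (hM : ContLogic.HasEP C M) :
    ContLogic.WeaklyEffectivelyEnumerable C M := by
  obtain ⟨T, hTM, hTre, hT⟩ := hM
  -- `m` is the code of a universal sentence `σ`, `q` is a name of `r`, and `k` is the index of
  -- multiplication by `r`
  have hre : REPred fun x : (ℕ × (ℕ × ℕ × ℕ) × ℕ) =>
      (∃ σ : ContLogic.Sentence C L, σ.IsUniversal ∧ σ.code = x.1) ∧
      C.scale (ContLogic.ratOf x.2.1) = x.2.2 ∧
      ContLogic.ratOf (0, 0, 0) < ContLogic.ratOf x.2.1 ∧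
      ∃ p, ContLogic.ratOf p < ContLogic.ratOf x.2.1 ∧
        ¬ ∃ w : ContLogic.Atom L → Prop, ∀ c ∈ ContLogic.refutation C L
          (fun n => ∃ τ ∈ T, ContLogic.Formula.code τ = n) (x.1, p), c.Sat w := by
    refine ((ContLogic.rePred_universal_sentence hL).comp_primrec (by fun_prop)).and
      ((ContLogic.REPred.computable_eq C.computable_scale (by fun_prop) (by fun_prop)).and
      ((ContLogic.REPred.ratOf_lt (by fun_prop) (by fun_prop)).and ?_))
    refine REPred.exists (p := fun (p : ℕ × ℕ × ℕ) (x : ℕ × (ℕ × ℕ × ℕ) × ℕ) =>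
      ContLogic.ratOf p < ContLogic.ratOf x.2.1 ∧
        ¬ ∃ w : ContLogic.Atom L → Prop, ∀ c ∈ ContLogic.refutation C L
          (fun n => ∃ τ ∈ T, ContLogic.Formula.code τ = n) (x.1, p), c.Sat w) ?_
    refine (ContLogic.REPred.ratOf_lt (by fun_prop) (by fun_prop)).and ?_
    exact (ContLogic.rePred_refutation (C := C) hL hTre).comp_primrec
      (f := fun y : (ℕ × ℕ × ℕ) × (ℕ × (ℕ × ℕ × ℕ) × ℕ) => (y.2.1, y.1)) (by fun_prop)
  have himage := hre.image (F := fun x => Nat.pair 2 (Nat.pair C.dotminus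
    (Encodable.encode [x.1, Nat.pair 2 (Nat.pair x.2.2 (Encodable.encode
      [Nat.pair 2 (Nat.pair C.one (Encodable.encode [x.1]))]))]))) (by fun_prop)
  refine himage.of_eq fun n => ⟨?_, ?_⟩
  · rintro ⟨⟨m, q, k⟩, ⟨⟨σ, hσ, hm⟩, hk, hq, hp⟩, rfl⟩
    dsimp only at hm hk hq hp ⊢
    subst hm hk
    rw [ContLogic.ratOf_zero] at hq
    exact ⟨_, ⟨σ, _, hσ, hq, (ContLogic.value_lt_iff hTM hT hσ _).2 hp, rfl⟩,
      ContLogic.code_dotminusRat σ _⟩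
  · rintro ⟨_, ⟨σ, r, hσ, hr, hlt, rfl⟩, rfl⟩
    obtain ⟨q, rfl⟩ := ContLogic.exists_ratOf r
    refine ⟨(σ.code, q, C.scale (ContLogic.ratOf q)), ⟨⟨σ, hσ, rfl⟩, rfl, ?_,
      (ContLogic.value_lt_iff hTM hT hσ _).1 hlt⟩, (ContLogic.code_dotminusRat σ _).symm⟩
    rw [ContLogic.ratOf_zero]
    exact hr
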